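/- **Theorem (Parallel Implementation).** All logarithms are to base two. Write $\log^{(i)}$ for the $i$-fold iterate of $\log$, let $\log^* n=\min\{i\ge 0 : \log^{(i)} n\le 1\}$, and let $\Delta_{n,k}=\{x\in[0,1]^n : \|x\|_1\le k\}$. A probability distribution $\mathcal D$ over deterministic algorithms $\mathcal A$ mapping each $x\in\Delta_{n,k}$ to a subset $\mathcal A(x)$ of $[n]$ is an *$\alpha$-stretch correlated sampling algorithm* for $\Delta_{n,k}$ if for all $x,y\in\Delta_{n,k}$: 1. (Cardinality) $|\mathcal A(x)|\in\{\lfloor\|x\|_1\rfloor,\lceil\|x\|_1\rceil\}$ for every $\mathcal A$ in the support of $\mathcal D$; 2. (Marginals) $\Pr_{\mathcal A\sim\mathcal D}[i\in\mathcal A(x)]=x_i$ for all $i\in[n]$; 3. (Stretch) $\mathbb E_{\mathcal A\sim\mathcal D}\big[|\mathcal A(x)\oplus\mathcal A(y)|\big]\le\alpha\,\|x-y\|_1$, where $\oplus$ is symmetric difference. The model of computation is the parallel random access machine with work and depth. A program is a sequential control structure around synchronous parallel steps "for all $i<N$ in parallel, $M[a_i]\leftarrow v_i$" on a shared memory of words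 and exact real numbers (all reads precede all writes; concurrent writes to one cell are resolved in favour of the lowest index). It may use, at unit cost per operation, arithmetic and bitwise operations on words of $O(\log(n+k))$ bits, $+,-,\times,\div$ and comparisons on reals (but no rounding of reals to words), memory accesses, and reads of a common random seed that is drawn once, independently of the input, and provides independent uniform reals in $[0,1]$, rate-one exponential reals, and uniform integers from $\{0,\dots,b-1\}$. No other initialization is performed. The *work* is the total number of operations, and the *depth* is the number of parallel time steps. There are a single program in this model and an absolute constant $C$ such that for all integers $n,k\ge 1$ the program, given $n$, $k$ and $x$ and with the randomness of the seed, is a $C\max(1,\log k)$-stretch correlated sampling algorithm for $\Delta_{n,k}$, and on every input $x\in\Delta_{n,k}$ and every seed it computes $\mathcal A(x)$ with work at most $C\,n\max(1,\log^* n)$ and depth at most $C\max(1,\log n)\max(1,\log^* n)$. In other words, the stretch is $O(\log k)$, the work is $O(n\cdot\log^* n)$ and the parallel depth is $O(\log n\cdot\log^* n)$. -/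

import Mathlib

open MeasureTheory

namespace CorrelatedSampling

/-! ### Correlated sampling for the hypersimplex -/

/-- `Δ_{n,k}`: the vectors of `[0,1]^n` whose `ℓ₁` norm is at most `k`. -/
def hypersimplex (n k : ℕ) : Set (Fin n → ℝ) :=
  {x | (∀ i, 0 ≤ x i ∧ x i ≤ 1) ∧ ∑ i, |x i| ≤ (k : ℝ)}

/-- `A`, drawn by drawing `ω` from the probability measure `μ`, is an `α`-stretch correlated
sampling algorithm for `Δ_{n,k}`. (The field `measurable` makes the probabilities and the
expectation meaningful.) -/
structure IsCorrelatedSampling {Ω : Type*} [MeasurableSpace Ω] (μ : Measure Ω)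
    (n k : ℕ) (α : ℝ) (A : Ω → (Fin n → ℝ) → Finset (Fin n)) : Prop where
  measurable : ∀ x ∈ hypersimplex n k, ∀ i, MeasurableSet {ω | i ∈ A ω x}
  cardinality : ∀ ω, ∀ x ∈ hypersimplex n k,
    (A ω x).card = ⌊∑ i, |x i|⌋₊ ∨ (A ω x).card = ⌈∑ i, |x i|⌉₊
  marginals : ∀ x ∈ hypersimplex n k, ∀ i, μ {ω | i ∈ A ω x} = ENNReal.ofReal (x i)
  stretch : ∀ x ∈ hypersimplex n k, ∀ y ∈ hypersimplex n k,
    ∫ ω, ((symmDiff (A ω x) (A ω y)).card : ℝ) ∂μ ≤ α * ∑ i, |x i - y i|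

/-- The iterated binary logarithm: the least `i` such that the `i`-fold iterate of `log₂` at `n`
is at most `1`. -/
noncomputable def logStar (n : ℕ) : ℕ :=
  sInf {i : ℕ | (Real.logb 2)^[i] (n : ℝ) ≤ 1}

/-! ### The random seed -/

/-- The common random seed, drawn once: a read-only tape of numbers in `[0,1]`. -/
abbrev Seed : Type := ℕ → unitInterval

/-- The entries of the seed are independent and uniform on `[0,1]`. -/
noncomputable def seedMeasure : Measure Seed :=
  Measure.infinitePi fun _ : ℕ => (volume : Measure unitInterval)

/-! ### A parallel random access machine with a work and a depth count

Shared memory consists of arrays of `w`-bit words and arrays of real numbers. A program is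
made of synchronous parallel steps `for all i < N pardo M[addr i] := val i` (all reads precede
all writes; if several processors write to one cell, the one of lowest index succeeds) and of
the usual sequential control. Every operation on words or reals, every memory access and every
access to the seed has unit cost. Reals can be added, subtracted, multiplied, divided and
compared, but there is no rounding of reals to words. -/

/-- The types of expressions. -/
inductive Ty
  | word
  | real
  | bool

/-- Values of expressions. -/
abbrev Ty.Val : Ty → Type
  | .word => ℕ
  | .real => ℝ
  | .bool => Prop

/-- Operations on words. -/
inductive WordOp
  | add | sub | mul | div | mod | and | xor

/-- Operations on `w`-bit words; addition, subtraction and multiplication are modulo `2 ^ w`. -/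
def WordOp.eval (w : ℕ) : WordOp → ℕ → ℕ → ℕ
  | .add, a, b => (a + b) % 2 ^ w
  | .sub, a, b => (a + 2 ^ w - b) % 2 ^ w
  | .mul, a, b => (a * b) % 2 ^ w
  | .div, a, b => a / b
  | .mod, a, b => a % b
  | .and, a, b => Nat.land a b
  | .xor, a, b => Nat.xor a b

/-- Operations on reals. -/
inductive RealOp
  | add | sub | mul | div

/-- Exact real arithmetic (division by zero returns zero). -/
noncomputable def RealOp.eval : RealOp → ℝ → ℝ → ℝ
  | .add, a, b => a + b
  | .sub, a, b => a - b
  | .mul, a, b => a * b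
  | .div, a, b => a / b

/-- The expressions that a single processor can evaluate. -/
inductive Expr : Ty → Type
  /-- a constant word -/
  | lit (v : ℕ) : Expr .word
  /-- the index of the processor -/
  | pid : Expr .word
  /-- the cell with address `e` of the word array `a` -/
  | loadW (a : ℕ) (e : Expr .word) : Expr .word
  | wop (o : WordOp) (e f : Expr .word) : Expr .word
  /-- an integer uniform in `{0, …, b - 1}`, from entry `e` of the seed -/
  | randW (e b : Expr .word) : Expr .word
  /-- the cell with address `e` of the real array `a` -/
  | loadR (a : ℕ) (e : Expr .word) : Expr .real
  | ofWord (e : Expr .word) : Expr .real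
  | rop (o : RealOp) (e f : Expr .real) : Expr .real
  /-- a real uniform in `[0,1]`, from entry `e` of the seed -/
  | randU (e : Expr .word) : Expr .real
  /-- an exponential variable of rate one, from entry `e` of the seed -/
  | randE (e : Expr .word) : Expr .real
  | ltW (e f : Expr .word) : Expr .bool
  | ltR (e f : Expr .real) : Expr .bool
  | not (e : Expr .bool) : Expr .bool
  | and (e f : Expr .bool) : Expr .bool
  | cond {t : Ty} (c : Expr .bool) (e f : Expr t) : Expr t

/-- The number of operations in an expression: the cost of its evaluation. -/
def Expr.size : {t : Ty} → Expr t → ℕ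
  | _, .lit _ => 1
  | _, .pid => 1
  | _, .loadW _ e => e.size + 1
  | _, .wop _ e f => e.size + f.size + 1
  | _, .randW e b => e.size + b.size + 1
  | _, .loadR _ e => e.size + 1
  | _, .ofWord e => e.size + 1
  | _, .rop _ e f => e.size + f.size + 1
  | _, .randU e => e.size + 1
  | _, .randE e => e.size + 1
  | _, .ltW e f => e.size + f.size + 1
  | _, .ltR e f => e.size + f.size + 1
  | _, .not e => e.size + 1
  | _, .and e f => e.size + f.size + 1
  | _, .cond c e f => c.size + e.size + f.size + 1

/-- The shared memory: `word a j` and `real a j` are the cells with address `j` of the word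
array and of the real array with name `a`. -/
@[ext] structure Mem where
  word : ℕ → ℕ → ℕ
  real : ℕ → ℕ → ℝ

/-- Replace the word array `a` by `M`. -/
def Mem.setW (s : Mem) (a : ℕ) (M : ℕ → ℕ) : Mem := ⟨Function.update s.word a M, s.real⟩

/-- Replace the real array `a` by `M`. -/
def Mem.setR (s : Mem) (a : ℕ) (M : ℕ → ℝ) : Mem := ⟨s.word, Function.update s.real a M⟩

open Classical in
/-- The value of an expression for processor `i`, with word size `w`, seed `ω` and memory `s`. -/
noncomputable def Expr.eval (w : ℕ) (ω : Seed) (s : Mem) (i : ℕ) : {t : Ty} → Expr t → t.Val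
  | _, .lit v => v % 2 ^ w
  | _, .pid => i
  | _, .loadW a e => s.word a (e.eval w ω s i)
  | _, .wop o e f => o.eval w (e.eval w ω s i) (f.eval w ω s i)
  | _, .randW e b =>
      min ⌊(Nat.cast (b.eval w ω s i) : ℝ) * (ω (e.eval w ω s i) : ℝ)⌋₊ (b.eval w ω s i - 1)
  | _, .loadR a e => s.real a (e.eval w ω s i)
  | _, .ofWord e => (Nat.cast (e.eval w ω s i) : ℝ)
  | _, .rop o e f => o.eval (e.eval w ω s i) (f.eval w ω s i)
  | _, .randU e => (ω (e.eval w ω s i) : ℝ)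
  | _, .randE e => - Real.log (ω (e.eval w ω s i) : ℝ)
  | _, .ltW e f => LT.lt (α := ℕ) (e.eval w ω s i) (f.eval w ω s i)
  | _, .ltR e f => LT.lt (α := ℝ) (e.eval w ω s i) (f.eval w ω s i)
  | _, .not e => ¬ e.eval w ω s i
  | _, .and e f => e.eval w ω s i ∧ f.eval w ω s i
  | _, .cond c e f => if c.eval w ω s i then e.eval w ω s i else f.eval w ω s i

/-- Programs. -/
inductive Program
  | skip
  /-- for all `i < N` in parallel: word array `a` at `addr` becomes `val` -/
  | parW (N : Expr .word) (a : ℕ) (addr : Expr .word) (val : Expr .word)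
  /-- for all `i < N` in parallel: real array `a` at `addr` becomes `val` -/
  | parR (N : Expr .word) (a : ℕ) (addr : Expr .word) (val : Expr .real)
  | seq (p q : Program)
  | ite (c : Expr .bool) (p q : Program)
  | while (c : Expr .bool) (p : Program)

/-- The result of `M[addr i] := val i` for all `i < N` at once, where the lowest index that
writes to a cell succeeds. -/
def parWrite {β : Type} (N : ℕ) (addr : ℕ → ℕ) (val : ℕ → β) (M : ℕ → β) : ℕ → β :=
  fun j => match (List.range N).find? (fun i => addr i == j) with
    | some i => val i
    | none => M j

/-- `Exec w ω p s s' W D`: with word size `w` and seed `ω`, the program `p` started in memory `s`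
halts in memory `s'` after `W` operations in total (work) in `D` parallel time steps (depth).
Sequential control is evaluated by processor `0`. -/
inductive Exec (w : ℕ) (ω : Seed) : Program → Mem → Mem → ℕ → ℕ → Prop
  | skip (s : Mem) : Exec w ω .skip s s 1 1
  | parW (N : Expr .word) (a : ℕ) (addr val : Expr .word) (s : Mem) :
      Exec w ω (.parW N a addr val) s
        (s.setW a (parWrite (N.eval w ω s 0) (fun i => addr.eval w ω s i)
          (fun i => val.eval w ω s i) (s.word a)))
        (N.size + 1 + N.eval w ω s 0 * (addr.size + val.size + 1))
        (N.size + 1 + (addr.size + val.size + 1))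
  | parR (N : Expr .word) (a : ℕ) (addr : Expr .word) (val : Expr .real) (s : Mem) :
      Exec w ω (.parR N a addr val) s
        (s.setR a (parWrite (N.eval w ω s 0) (fun i => addr.eval w ω s i)
          (fun i => val.eval w ω s i) (s.real a)))
        (N.size + 1 + N.eval w ω s 0 * (addr.size + val.size + 1))
        (N.size + 1 + (addr.size + val.size + 1))
  | seq {p q : Program} {s s' s'' : Mem} {W D W' D' : ℕ} :
      Exec w ω p s s' W D → Exec w ω q s' s'' W' D' →
      Exec w ω (.seq p q) s s'' (W + W') (D + D')
  | iteTrue {c : Expr .bool} {p q : Program} {s s' : Mem} {W D : ℕ} :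
      c.eval w ω s 0 → Exec w ω p s s' W D →
      Exec w ω (.ite c p q) s s' (c.size + 1 + W) (c.size + 1 + D)
  | iteFalse {c : Expr .bool} {p q : Program} {s s' : Mem} {W D : ℕ} :
      ¬ c.eval w ω s 0 → Exec w ω q s s' W D →
      Exec w ω (.ite c p q) s s' (c.size + 1 + W) (c.size + 1 + D)
  | whileTrue {c : Expr .bool} {p : Program} {s s' s'' : Mem} {W D W' D' : ℕ} :
      c.eval w ω s 0 → Exec w ω p s s' W D → Exec w ω (.while c p) s' s'' W' D' →
      Exec w ω (.while c p) s s'' (c.size + 1 + W + W') (c.size + 1 + D + D')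
  | whileFalse {c : Expr .bool} {p : Program} {s : Mem} :
      ¬ c.eval w ω s 0 → Exec w ω (.while c p) s s (c.size + 1) (c.size + 1)

/-- Execution is deterministic: the seed and the initial memory fix the result and the costs. -/
theorem Exec.deterministic {w : ℕ} {ω : Seed} {p : Program} {s s₁ s₂ : Mem} {W₁ D₁ W₂ D₂ : ℕ}
    (h₁ : Exec w ω p s s₁ W₁ D₁) (h₂ : Exec w ω p s s₂ W₂ D₂) :
    s₁ = s₂ ∧ W₁ = W₂ ∧ D₁ = D₂ := by
  induction h₁ generalizing s₂ W₂ D₂ with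
  | skip s => cases h₂; exact ⟨rfl, rfl, rfl⟩
  | parW => cases h₂; exact ⟨rfl, rfl, rfl⟩
  | parR => cases h₂; exact ⟨rfl, rfl, rfl⟩
  | seq _ _ ih ih' =>
    cases h₂ with
    | seq g g' =>
      obtain ⟨rfl, rfl, rfl⟩ := ih g
      obtain ⟨rfl, rfl, rfl⟩ := ih' g'
      exact ⟨rfl, rfl, rfl⟩
  | iteTrue hc _ ih =>
    cases h₂ with
    | iteTrue _ g => obtain ⟨rfl, rfl, rfl⟩ := ih g; exact ⟨rfl, rfl, rfl⟩
    | iteFalse hn _ => exact absurd hc hn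
  | iteFalse hc _ ih =>
    cases h₂ with
    | iteTrue hn _ => exact absurd hn hc
    | iteFalse _ g => obtain ⟨rfl, rfl, rfl⟩ := ih g; exact ⟨rfl, rfl, rfl⟩
  | whileTrue hc _ _ ih ih' =>
    cases h₂ with
    | whileTrue _ g g' =>
      obtain ⟨rfl, rfl, rfl⟩ := ih g
      obtain ⟨rfl, rfl, rfl⟩ := ih' g'
      exact ⟨rfl, rfl, rfl⟩
    | whileFalse hn => exact absurd hc hn
  | whileFalse hc =>
    cases h₂ with
    | whileTrue hn _ _ => exact absurd hn hc
    | whileFalse _ => exact ⟨rfl, rfl, rfl⟩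

/-- The initial memory: `n` and `k` are in the cells `0` and `1` of word array `0`, the vector `x`
is in the cells `0, …, n - 1` of real array `0`, and all other cells are zero. -/
noncomputable def initMem {n : ℕ} (k : ℕ) (x : Fin n → ℝ) : Mem where
  word a j := if a = 0 ∧ j = 0 then n else if a = 0 ∧ j = 1 then k else 0
  real a j := if h : a = 0 ∧ j < n then x ⟨j, h.2⟩ else 0

/-- The output: the coordinates `i` whose cell in word array `1` is nonzero. -/
def output (n : ℕ) (s : Mem) : Finset (Fin n) :=
  Finset.univ.filter fun i => s.word 1 i ≠ 0

/-- The word size: `c` times the binary length of `n + k`, up to rounding. -/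
def wordSize (c n k : ℕ) : ℕ := c * Nat.clog 2 (n + k + 1)

/-- With words of `c * ⌈log₂ (n + k + 1)⌉` bits, the program `p` computes the map
`(ω, x) ↦ A ω x` on `Δ_{n,k}` with work at most `W` and depth at most `D`, whatever
the seed `ω` and the input `x` are. -/
def Program.Implements (p : Program) (c n k : ℕ) (A : Seed → (Fin n → ℝ) → Finset (Fin n))
    (W D : ℝ) : Prop :=
  ∀ ω : Seed, ∀ x ∈ hypersimplex n k, ∃ (s : Mem) (work depth : ℕ),
    Exec (wordSize c n k) ω p (initMem k x) s work depth ∧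
      output n s = A ω x ∧ (work : ℝ) ≤ W ∧ (depth : ℝ) ≤ D

end CorrelatedSampling

/-! The coordinates are hashed to the leaves of a binary tree and the vector is rounded from the
root downwards. A node of weight `s` holds an integer count that rounds `s` up or down; at the root
it is the ceiling of `s - u` with `u` uniform. Let `p` be the fractional part of `s`. A heavy node
gives its left child, of weight `sl`, the ceiling of `sl - u'`, where `u'` is uniform on `[0, p]` if
the count rounds up and on `[p, 1]` if it rounds down. As the count rounds up with probability `p`,
`u'` is uniform on `[0, 1]` overall, so both children again hold unbiased roundings, and the
marginals follow by induction (`integral_split`, `expect_nodeLeft`, `expect_leafCount`). Counts are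
conserved, so the sample has the size of the root count.

For the stretch, raise one coordinate by `ε`. The splits are monotone in the weights and in the
counts, so each heavy node on the path from the leaf to the root adds at most `2ε` to the expected
number of disagreements (`cost_mixture_le`). Paying this on every level would give a factor `log n`.
Therefore nodes of weight at most a threshold `T < 1` give their whole count to the winner of a race
of exponential clocks, and such a subtree costs `2ε` in total (`cost_small`, `expect_winner`). The
threshold is random, so a given node crosses it with probability `O(ε)`.

It remains to bound how many levels pay. The top `log k + O(1)` levels are charged in full. A node
of height `g` further down pays only if other weight is hashed to the same block, and that weight
has expectation `O(k * 2 ^ g / 2 ^ D)`, a geometric series (`expect_collision_le`,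
`sum_expect_levelBound_le`). A coordinate that is heavy by itself costs nothing while it is alone
below a node (`cost_alone`), but tiny companions would spoil this. Hence a random cut sends large
and small coordinates to different halves of the tree: every companion of a large coordinate is then
large, and a heavy node with companions always carries other weight at least `1/4`
(`one_le_levelBound`). Crossing the cut has probability `O(ε)` and expected cost `O(log k)`. Two
arbitrary vectors are compared through their coordinatewise minimum, changing one coordinate at a
time.

On the machine the tree has `O(n)` nodes and is traversed once upwards (sums, maximal priorities,
ceilings) and once downwards (counts), which takes work `O(n)` and depth `O(log n)`. Since reals
cannot be rounded to words, the ceilings of the node weights are carried along as words, each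
obtained from earlier ones by one comparison (`ceil_add_sub_one`, `ceil_of_near`). -/

namespace CorrelatedSampling

/-! ### Rounding on a binary tree

Nodes are numbered as in a heap: the children of `v` are `2 * v` and `2 * v + 1`, and the leaves
below a node `v` of height `h` are the `q` with `q / 2 ^ h = v`. -/

/-- The sum of `f` over the leaves below the node `v` of height `h`. -/
noncomputable def nodeSum (f : ℕ → ℝ) : ℕ → ℕ → ℝ
  | 0, v => f v
  | h + 1, v => nodeSum f h (2 * v) + nodeSum f h (2 * v + 1)

/-- The maximum of `f` over the leaves below the node `v` of height `h`. -/
noncomputable def nodeMax (f : ℕ → ℝ) : ℕ → ℕ → ℝ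
  | 0, v => f v
  | h + 1, v => max (nodeMax f h (2 * v)) (nodeMax f h (2 * v + 1))

/-- The uniform variable of node `v`, with the value `1` replaced by `0`. -/
noncomputable def nodeUnif (ω : Seed) (v : ℕ) : ℝ :=
  if (ω (v + 3) : ℝ) < 1 then (ω (v + 3) : ℝ) else 0

/-- The exponential variable of leaf `q`, with the value `0` replaced by `1`. -/
noncomputable def clock (ω : Seed) (q : ℕ) : ℝ :=
  if 0 < - Real.log (ω (q + 3) : ℝ) then - Real.log (ω (q + 3) : ℝ) else 1

/-- The number whose ceiling a node with count `N` passes to its left child, when the children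
have weights `sl` and `sr`. -/
noncomputable def splitPoint (u sl sr N : ℝ) : ℝ :=
  sl + min (N - (sl + sr)) 0 - (1 - |N - (sl + sr)|) * u

/-- The count of the left child of a node with count `N`. Nodes of weight at most `T` give
everything to the child with the larger priority. -/
noncomputable def leftCount (T u sl sr rl rr : ℝ) (N : ℕ) : ℕ :=
  if sl + sr ≤ T then (if rr ≤ rl then N else 0) else min N ⌈splitPoint u sl sr N⌉₊

/-- The priorities of the leaves. -/
noncomputable def priority (w : ℕ → ℝ) (ω : Seed) (q : ℕ) : ℝ := w q / clock ω q

/-- The count of the left child of the node `v` of height `h + 1`. -/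
noncomputable def nodeLeft (w : ℕ → ℝ) (T : ℝ) (ω : Seed) (h v N : ℕ) : ℕ :=
  leftCount T (nodeUnif ω v) (nodeSum w h (2 * v)) (nodeSum w h (2 * v + 1))
    (nodeMax (priority w ω) h (2 * v)) (nodeMax (priority w ω) h (2 * v + 1)) N

/-- The count that leaf `q` receives from the node `v` of height `h` when that has count `N`. -/
noncomputable def leafCount (w : ℕ → ℝ) (T : ℝ) (ω : Seed) : ℕ → ℕ → ℕ → ℕ → ℕ
  | 0, _, N, _ => N
  | h + 1, v, N, q =>
    if q / 2 ^ h = 2 * v then leafCount w T ω h (2 * v) (nodeLeft w T ω h v N) q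
    else leafCount w T ω h (2 * v + 1) (N - nodeLeft w T ω h v N) q

theorem div_two_pow_succ (q h : ℕ) : q / 2 ^ (h + 1) = q / 2 ^ h / 2 := by
  rw [pow_succ, Nat.div_div_eq_div_mul]

theorem below_left {q h v : ℕ} (hq : q / 2 ^ h = 2 * v) : q / 2 ^ (h + 1) = v := by
  rw [div_two_pow_succ, hq]; omega

theorem below_right {q h v : ℕ} (hq : q / 2 ^ h = 2 * v + 1) : q / 2 ^ (h + 1) = v := by
  rw [div_two_pow_succ, hq]; omega

theorem below_cases {q h v : ℕ} (hq : q / 2 ^ (h + 1) = v) :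
    q / 2 ^ h = 2 * v ∨ q / 2 ^ h = 2 * v + 1 := by
  rw [div_two_pow_succ] at hq; omega

theorem nodeSum_congr {f g : ℕ → ℝ} {h v : ℕ} (hfg : ∀ q, q / 2 ^ h = v → f q = g q) :
    nodeSum f h v = nodeSum g h v := by
  induction h generalizing v with
  | zero => exact hfg v (by simp)
  | succ h ih =>
    simp only [nodeSum]
    rw [ih fun q hq => hfg q (below_left hq), ih fun q hq => hfg q (below_right hq)]

theorem nodeMax_congr {f g : ℕ → ℝ} {h v : ℕ} (hfg : ∀ q, q / 2 ^ h = v → f q = g q) :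
    nodeMax f h v = nodeMax g h v := by
  induction h generalizing v with
  | zero => exact hfg v (by simp)
  | succ h ih =>
    simp only [nodeMax]
    rw [ih fun q hq => hfg q (below_left hq), ih fun q hq => hfg q (below_right hq)]

theorem nodeSum_mono {f g : ℕ → ℝ} {h v : ℕ} (hfg : ∀ q, q / 2 ^ h = v → f q ≤ g q) :
    nodeSum f h v ≤ nodeSum g h v := by
  induction h generalizing v with
  | zero => exact hfg v (by simp)
  | succ h ih =>
    exact add_le_add (ih fun q hq => hfg q (below_left hq)) (ih fun q hq => hfg q (below_right hq))

theorem nodeSum_add (f g : ℕ → ℝ) (h v : ℕ) :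
    nodeSum (fun q => f q + g q) h v = nodeSum f h v + nodeSum g h v := by
  induction h generalizing v with
  | zero => rfl
  | succ h ih => simp only [nodeSum, ih]; ring

theorem nodeSum_mul (c : ℝ) (f : ℕ → ℝ) (h v : ℕ) :
    nodeSum (fun q => c * f q) h v = c * nodeSum f h v := by
  induction h generalizing v with
  | zero => rfl
  | succ h ih => simp only [nodeSum, ih]; ring

theorem nodeSum_zero (h v : ℕ) : nodeSum (fun _ => 0) h v = 0 := by
  induction h generalizing v with
  | zero => rfl
  | succ h ih => simp [nodeSum, ih]

theorem nodeSum_nonneg {f : ℕ → ℝ} {h v : ℕ} (hf : ∀ q, 0 ≤ f q) : 0 ≤ nodeSum f h v := by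
  rw [← nodeSum_zero h v]; exact nodeSum_mono fun q _ => hf q

theorem nodeSum_eq_sum (f : ℕ → ℝ) (h v : ℕ) :
    nodeSum f h v = ∑ j ∈ Finset.range (2 ^ h), f (v * 2 ^ h + j) := by
  induction h generalizing v with
  | zero => simp [nodeSum]
  | succ h ih =>
    rw [nodeSum, ih, ih, pow_succ, mul_two, Finset.sum_range_add]
    congr 1
    · exact Finset.sum_congr rfl fun j _ => by congr 1; ring
    · exact Finset.sum_congr rfl fun j _ => by congr 1; ring

theorem nodeSum_update (w : ℕ → ℝ) {q : ℕ} (hq : w q = 0) (t : ℝ) (h v : ℕ) :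
    nodeSum (Function.update w q t) h v = nodeSum w h v + if q / 2 ^ h = v then t else 0 := by
  induction h generalizing v with
  | zero =>
    simp only [nodeSum, pow_zero, Nat.div_one]
    by_cases hv : v = q
    · subst hv; simp [hq]
    · simp [hv, Ne.symm hv]
  | succ h ih =>
    simp only [nodeSum, ih, div_two_pow_succ]
    by_cases h1 : q / 2 ^ h = 2 * v
    · simp [h1]; ring
    · by_cases h2 : q / 2 ^ h = 2 * v + 1
      · have : (2 * v + 1) / 2 = v := by omega
        simp [h2, this]; ring
      · have : ¬ q / 2 ^ h / 2 = v := by omega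
        simp [h1, h2, this]

theorem le_nodeSum {f : ℕ → ℝ} (hf : ∀ q, 0 ≤ f q) {q h v : ℕ} (hq : q / 2 ^ h = v) :
    f q ≤ nodeSum f h v := by
  induction h generalizing v with
  | zero => rw [pow_zero, Nat.div_one] at hq; subst hq; rfl
  | succ h ih =>
    have h1 := nodeSum_nonneg (h := h) (v := 2 * v) hf
    have h2 := nodeSum_nonneg (h := h) (v := 2 * v + 1) hf
    rcases below_cases hq with h0 | h0 <;> have := ih h0 <;> simp only [nodeSum] <;> linarith

/-- Two families of counts for the same leaves: the number of disagreements. -/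
noncomputable def cost (w w' : ℕ → ℝ) (T : ℝ) (ω : Seed) (h v N N' : ℕ) : ℝ :=
  nodeSum (fun q => |(leafCount w T ω h v N q : ℝ) - leafCount w' T ω h v N' q|) h v

/-- Stated for an arbitrary `G` so that one recursion serves both the cost (`cost_succ`) and the
conservation of the total count (`nodeSum_leafCount`). -/
theorem nodeSum_leafCount_succ (G : ℕ → ℕ → ℝ) (w w' : ℕ → ℝ) (T : ℝ) (ω : Seed)
    (h v N N' : ℕ) :
    nodeSum (fun q => G (leafCount w T ω (h + 1) v N q) (leafCount w' T ω (h + 1) v N' q))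
      (h + 1) v =
    nodeSum (fun q => G (leafCount w T ω h (2 * v) (nodeLeft w T ω h v N) q)
      (leafCount w' T ω h (2 * v) (nodeLeft w' T ω h v N') q)) h (2 * v) +
    nodeSum (fun q => G (leafCount w T ω h (2 * v + 1) (N - nodeLeft w T ω h v N) q)
      (leafCount w' T ω h (2 * v + 1) (N' - nodeLeft w' T ω h v N') q)) h (2 * v + 1) := by
  rw [nodeSum]
  congr 1
  · exact nodeSum_congr fun q hq => by simp [leafCount, hq]
  · exact nodeSum_congr fun q hq => by simp [leafCount, hq]

theorem cost_succ (w w' : ℕ → ℝ) (T : ℝ) (ω : Seed) (h v N N' : ℕ) :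
    cost w w' T ω (h + 1) v N N' =
      cost w w' T ω h (2 * v) (nodeLeft w T ω h v N) (nodeLeft w' T ω h v N') +
      cost w w' T ω h (2 * v + 1) (N - nodeLeft w T ω h v N) (N' - nodeLeft w' T ω h v N') :=
  nodeSum_leafCount_succ (fun a b => |(a : ℝ) - b|) w w' T ω h v N N'

theorem cost_nonneg (w w' : ℕ → ℝ) (T : ℝ) (ω : Seed) (h v N N' : ℕ) :
    0 ≤ cost w w' T ω h v N N' := nodeSum_nonneg fun _ => abs_nonneg _

theorem cost_self (w : ℕ → ℝ) (T : ℝ) (ω : Seed) (h v N : ℕ) : cost w w T ω h v N N = 0 := by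
  simp [cost, nodeSum_zero]

/-- `cost` is an `ℓ₁` distance between two families of leaf counts, so a change of the weights and a
change of the starting count can be paid for separately. -/
theorem cost_triangle (w w' w'' : ℕ → ℝ) (T : ℝ) (ω : Seed) (h v N N' N'' : ℕ) :
    cost w w'' T ω h v N N'' ≤ cost w w' T ω h v N N' + cost w' w'' T ω h v N' N'' := by
  unfold cost
  rw [← nodeSum_add]
  exact nodeSum_mono fun q _ => abs_sub_le _ _ _

theorem cost_comm (w w' : ℕ → ℝ) (T : ℝ) (ω : Seed) (h v N N' : ℕ) :
    cost w w' T ω h v N N' = cost w' w T ω h v N' N := by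
  unfold cost
  exact nodeSum_congr fun q _ => abs_sub_comm _ _

/-- The rounding is local: it reads only weights, clocks and uniforms below the node. A change of
one leaf therefore matters only along its path to the root. -/
theorem leafCount_congr {w w' : ℕ → ℝ} {T : ℝ} {ω : Seed} {h v : ℕ}
    (hw : ∀ q, q / 2 ^ h = v → w q = w' q) {q : ℕ} (hq : q / 2 ^ h = v) (N : ℕ) :
    leafCount w T ω h v N q = leafCount w' T ω h v N q := by
  induction h generalizing v N with
  | zero => rfl
  | succ h ih =>
    have hl : nodeLeft w T ω h v N = nodeLeft w' T ω h v N := by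
      unfold nodeLeft
      rw [nodeSum_congr fun q hq => hw q (below_left hq),
        nodeSum_congr fun q hq => hw q (below_right hq),
        nodeMax_congr (f := priority w ω) (g := priority w' ω) (v := 2 * v) fun q hq => by
          unfold priority; rw [hw q (below_left hq)],
        nodeMax_congr (f := priority w ω) (g := priority w' ω) (v := 2 * v + 1) fun q hq => by
          unfold priority; rw [hw q (below_right hq)]]
    rcases below_cases hq with h0 | h0
    · simp only [leafCount, h0, if_true, hl]
      exact ih (fun q hq => hw q (below_left hq)) h0 _
    · have hne : ¬ (2 * v + 1 = 2 * v) := by omega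
      simp only [leafCount, h0, hne, if_false, hl]
      exact ih (fun q hq => hw q (below_right hq)) h0 _

theorem cost_congr {w₁ w₂ w₁' w₂' : ℕ → ℝ} {T : ℝ} {ω : Seed} {h v : ℕ}
    (h1 : ∀ q, q / 2 ^ h = v → w₁ q = w₂ q) (h2 : ∀ q, q / 2 ^ h = v → w₁' q = w₂' q)
    (N N' : ℕ) : cost w₁ w₁' T ω h v N N' = cost w₂ w₂' T ω h v N N' := by
  unfold cost
  exact nodeSum_congr fun q hq => by rw [leafCount_congr h1 hq, leafCount_congr h2 hq]

theorem nodeUnif_mem (ω : Seed) (v : ℕ) : 0 ≤ nodeUnif ω v ∧ nodeUnif ω v < 1 := by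
  unfold nodeUnif
  split_ifs with h
  · exact ⟨(ω (v + 3)).2.1, h⟩
  · norm_num

theorem clock_pos (ω : Seed) (q : ℕ) : 0 < clock ω q := by
  unfold clock; split_ifs with h <;> [exact h; norm_num]

theorem priority_nonneg {w : ℕ → ℝ} (hw : ∀ q, 0 ≤ w q) (ω : Seed) (q : ℕ) :
    0 ≤ priority w ω q := div_nonneg (hw q) (clock_pos ω q).le

theorem nodeMax_nonneg {f : ℕ → ℝ} (hf : ∀ q, 0 ≤ f q) (h v : ℕ) : 0 ≤ nodeMax f h v := by
  induction h generalizing v with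
  | zero => exact hf v
  | succ h ih => exact le_max_of_le_left (ih _)

/-- Clocks are positive, so a priority is positive exactly when its weight is. This prevents a light
node from handing a unit to a child of weight zero. -/
theorem nodeMax_pos_iff {w : ℕ → ℝ} (hw : ∀ q, 0 ≤ w q) (ω : Seed) (h v : ℕ) :
    0 < nodeMax (priority w ω) h v ↔ 0 < nodeSum w h v := by
  induction h generalizing v with
  | zero => exact div_pos_iff_of_pos_right (clock_pos ω v)
  | succ h ih =>
    simp only [nodeMax, nodeSum, lt_max_iff, ih]
    have h1 := nodeSum_nonneg (h := h) (v := 2 * v) hw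
    have h2 := nodeSum_nonneg (h := h) (v := 2 * v + 1) hw
    constructor
    · rintro (h3 | h3) <;> linarith
    · intro h3
      by_contra! h4
      linarith

theorem leftCount_le (T u sl sr rl rr : ℝ) (N : ℕ) : leftCount T u sl sr rl rr N ≤ N := by
  unfold leftCount
  split_ifs
  · exact le_rfl
  · exact Nat.zero_le _
  · exact min_le_left _ _

theorem leafCount_le (w : ℕ → ℝ) (T : ℝ) (ω : Seed) (h v N q : ℕ) :
    leafCount w T ω h v N q ≤ N := by
  induction h generalizing v N with
  | zero => rfl
  | succ h ih =>
    simp only [leafCount]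
    split_ifs
    · exact (ih _ _).trans (leftCount_le ..)
    · exact (ih _ _).trans (Nat.sub_le _ _)

end CorrelatedSampling

namespace CorrelatedSampling

/-! ### Admissible counts -/

section Split

variable {u sl sr N : ℝ}

/-- This and the next five bounds place the split point in the unit intervals below `sl` and below
`N - sr`. Its ceiling then rounds `sl`, and what remains rounds `sr`. The strict versions require `u
< 1`, which is why `nodeUnif` replaces the value `1`. -/
theorem splitPoint_le (hu : 0 ≤ u) (hN : |N - (sl + sr)| ≤ 1) : splitPoint u sl sr N ≤ sl := by
  unfold splitPoint
  have h1 := min_le_right (N - (sl + sr)) 0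
  have h2 := mul_nonneg (sub_nonneg.2 hN) hu
  linarith

theorem le_splitPoint (hu' : u ≤ 1) (hN : |N - (sl + sr)| ≤ 1) :
    sl - 1 ≤ splitPoint u sl sr N := by
  unfold splitPoint
  have h2 := mul_le_mul_of_nonneg_left hu' (sub_nonneg.2 hN)
  rcases le_total 0 (N - (sl + sr)) with h | h
  · rw [min_eq_right h]; rw [abs_of_nonneg h] at h2 ⊢; linarith
  · rw [min_eq_left h]; rw [abs_of_nonpos h] at h2 ⊢; linarith

theorem lt_splitPoint (hu' : u < 1) (hN : -1 < N - (sl + sr)) (hN' : N - (sl + sr) ≤ 1) :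
    sl - 1 < splitPoint u sl sr N := by
  unfold splitPoint
  rcases le_total 0 (N - (sl + sr)) with h | h
  · rw [min_eq_right h, abs_of_nonneg h]
    rcases eq_or_lt_of_le h with h0 | h0
    · rw [← h0]; linarith
    · nlinarith
  · rw [min_eq_left h, abs_of_nonpos h]; nlinarith

theorem splitPoint_le' (hu : 0 ≤ u) (hN : |N - (sl + sr)| ≤ 1) : splitPoint u sl sr N ≤ N - sr := by
  unfold splitPoint
  have h2 := mul_nonneg (sub_nonneg.2 hN) hu
  rcases le_total 0 (N - (sl + sr)) with h | h
  · rw [min_eq_right h]; linarith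
  · rw [min_eq_left h]; linarith

theorem le_splitPoint' (hu' : u ≤ 1) (hN : |N - (sl + sr)| ≤ 1) :
    N - sr - 1 ≤ splitPoint u sl sr N := by
  unfold splitPoint
  have h2 := mul_le_mul_of_nonneg_left hu' (sub_nonneg.2 hN)
  rcases le_total 0 (N - (sl + sr)) with h | h
  · rw [min_eq_right h]; rw [abs_of_nonneg h] at h2 ⊢; linarith
  · rw [min_eq_left h]; rw [abs_of_nonpos h] at h2 ⊢; linarith

theorem lt_splitPoint' (hu' : u < 1) (hN : -1 ≤ N - (sl + sr)) (hN' : N - (sl + sr) < 1) :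
    N - sr - 1 < splitPoint u sl sr N := by
  unfold splitPoint
  rcases le_total 0 (N - (sl + sr)) with h | h
  · rw [min_eq_right h, abs_of_nonneg h]; nlinarith
  · rw [min_eq_left h, abs_of_nonpos h]
    rcases eq_or_lt_of_le h with h0 | h0
    · rw [h0]; linarith
    · nlinarith

end Split

/-- A count for a node of weight `s` that rounds `s` up or down. -/
def Admissible (s : ℝ) (N : ℕ) : Prop := |(N : ℝ) - s| < 1

theorem Admissible.zero {N : ℕ} (h : Admissible 0 N) : N = 0 := by
  unfold Admissible at h
  rw [sub_zero, Nat.abs_cast] at h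
  exact_mod_cast Nat.lt_one_iff.1 (by exact_mod_cast h)

section LeftCount

variable {T u sl sr rl rr : ℝ} {N : ℕ}

/-- The truncation at `N` in `leftCount` is inactive here, because the split point is at most `N -
sr`; it only serves to make `leftCount_le` unconditional. -/
theorem leftCount_big (hu : 0 ≤ u) (hr : 0 ≤ sr) (hN : |N - (sl + sr)| ≤ 1) (h : T < sl + sr) :
    leftCount T u sl sr rl rr N = ⌈splitPoint u sl sr N⌉₊ := by
  rw [leftCount, if_neg (not_le.2 h)]
  exact min_eq_right (Nat.ceil_le.2 ((splitPoint_le' hu hN).trans (by linarith)))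

/-- At a heavy node this is the position of the split point. A light node has weight below one,
hence count `0` or `1`, and a unit goes to a child of positive weight, for which both roundings are
admissible. -/
theorem admissible_leftCount (hT : T < 1) (hu : 0 ≤ u) (hu' : u < 1) (hl : 0 ≤ sl) (hr : 0 ≤ sr)
    (hrl : 0 ≤ rl) (hrl' : 0 < rl ↔ 0 < sl) (hrr' : 0 < rr ↔ 0 < sr)
    (hN : Admissible (sl + sr) N) :
    Admissible sl (leftCount T u sl sr rl rr N) ∧
      Admissible sr (N - leftCount T u sl sr rl rr N) := by
  have hle := leftCount_le T u sl sr rl rr N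
  unfold Admissible at *
  rw [Nat.cast_sub hle]
  obtain ⟨h1, h2⟩ := abs_lt.1 hN
  rcases lt_or_ge T (sl + sr) with hbig | hs
  · rw [leftCount_big hu hr hN.le hbig]
    have a1 := splitPoint_le (sl := sl) (sr := sr) hu hN.le
    have a2 := lt_splitPoint (sl := sl) (sr := sr) hu' h1 h2.le
    have a3 := splitPoint_le' (sl := sl) (sr := sr) hu hN.le
    have a4 := lt_splitPoint' (sl := sl) (sr := sr) hu' h1.le h2
    have a5 : (⌈splitPoint u sl sr N⌉₊ : ℝ) < splitPoint u sl sr N + 1 :=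
      Nat.ceil_lt_add_one_of_gt_neg_one (by linarith)
    have a6 := Nat.le_ceil (splitPoint u sl sr N)
    rw [abs_lt, abs_lt]; refine ⟨⟨?_, ?_⟩, ?_, ?_⟩ <;> linarith
  rw [leftCount, if_pos hs]; split_ifs with hlr
  · have hN2 : N < 2 := by exact_mod_cast (show (N : ℝ) < 2 by linarith)
    rcases Nat.lt_succ_iff.1 hN2 |>.eq_or_lt with h | h
    · subst h
      -- The left priority is the larger one; if it vanished, both children would have weight zero
      -- and the count `1` would not be admissible.
      have : 0 < sl := by
        rw [← hrl']
        by_contra! h0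
        have : ¬ 0 < sl := by rw [← hrl']; exact not_lt.2 h0
        have : ¬ 0 < sr := by rw [← hrr']; exact not_lt.2 (hlr.trans h0)
        push_cast at *
        linarith
      rw [abs_lt, abs_lt]; push_cast; refine ⟨⟨?_, ?_⟩, ?_, ?_⟩ <;> linarith
    · have : N = 0 := by omega
      subst this
      rw [abs_lt, abs_lt]; push_cast; refine ⟨⟨?_, ?_⟩, ?_, ?_⟩ <;> linarith
  · have hN2 : N < 2 := by exact_mod_cast (show (N : ℝ) < 2 by linarith)
    rcases Nat.lt_succ_iff.1 hN2 |>.eq_or_lt with h | h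
    · subst h
      have : 0 < sr := by
        rw [← hrr']; linarith
      rw [abs_lt, abs_lt]; push_cast; refine ⟨⟨?_, ?_⟩, ?_, ?_⟩ <;> linarith
    · have : N = 0 := by omega
      subst this
      rw [abs_lt, abs_lt]; push_cast; refine ⟨⟨?_, ?_⟩, ?_, ?_⟩ <;> linarith

/-- The counts that a node passes to its children when its own count grows by one. -/
theorem leftCount_succ (hT : T < 1) (hu : 0 ≤ u) (hu' : u ≤ 1) (hl : 0 ≤ sl) (hr : 0 ≤ sr)
    (hN : (N : ℝ) ≤ sl + sr) (hN' : sl + sr ≤ N + 1) :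
    ((leftCount T u sl sr rl rr (N + 1) = leftCount T u sl sr rl rr N + 1 ∧
      N + 1 - leftCount T u sl sr rl rr (N + 1) = N - leftCount T u sl sr rl rr N ∧
      (leftCount T u sl sr rl rr N : ℝ) ≤ sl ∧ sl ≤ leftCount T u sl sr rl rr N + 1) ∨
    (leftCount T u sl sr rl rr (N + 1) = leftCount T u sl sr rl rr N ∧
      N + 1 - leftCount T u sl sr rl rr (N + 1) = N - leftCount T u sl sr rl rr N + 1 ∧
      ((N - leftCount T u sl sr rl rr N : ℕ) : ℝ) ≤ sr ∧
      sr ≤ ((N - leftCount T u sl sr rl rr N : ℕ) : ℝ) + 1)) := by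
  rcases lt_or_ge T (sl + sr) with hbig | hs
  swap; rw [leftCount, if_pos hs, leftCount, if_pos hs]; split_ifs with hlr
  · have : N = 0 := Nat.lt_one_iff.1 (by exact_mod_cast (show (N : ℝ) < 1 by linarith))
    subst this
    left; refine ⟨rfl, by simp, by simpa using hl, by push_cast at *; linarith⟩
  · have : N = 0 := Nat.lt_one_iff.1 (by exact_mod_cast (show (N : ℝ) < 1 by linarith))
    subst this
    right; refine ⟨rfl, by simp, by simpa using hr, by push_cast at *; linarith⟩
  · have e1 : |((N + 1 : ℕ) : ℝ) - (sl + sr)| ≤ 1 := by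
      rw [abs_le]; push_cast; constructor <;> linarith
    have e0 : |(N : ℝ) - (sl + sr)| ≤ 1 := by
      rw [abs_le]; constructor <;> linarith
    rw [leftCount_big hu hr e1 hbig, leftCount_big hu hr e0 hbig]
    have f1 : splitPoint u sl sr (N + 1 : ℕ) = sl - (sl + sr - N) * u := by
      unfold splitPoint
      rw [min_eq_right (by push_cast; linarith), abs_of_nonneg (by push_cast; linarith)]
      push_cast; ring
    have f0 : splitPoint u sl sr N = sl - (sl + sr - N) - (1 - (sl + sr - N)) * u := by
      unfold splitPoint
      rw [min_eq_left (by linarith), abs_of_nonpos (by linarith)]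
      ring
    have g1 := splitPoint_le hu e1
    have g2 := le_splitPoint hu' e0
    have g3 := splitPoint_le' hu e0
    have g4 := le_splitPoint' hu' e1
    have g5 := splitPoint_le' hu e1
    have g6 := splitPoint_le hu e0
    set h1 := splitPoint u sl sr (N + 1 : ℕ)
    set h0 := splitPoint u sl sr N
    -- With `p = sl + sr - N`, the difference `h1 - h0` equals `p * (1 - u) + (1 - p) * u`, which
    -- lies in `[0, 1]`; so the ceilings differ by zero or one.
    have h01 : h0 ≤ h1 := by rw [f1, f0]; nlinarith
    have h10 : h1 ≤ h0 + 1 := by rw [f1, f0]; nlinarith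
    have m1 : ⌈h0⌉₊ ≤ ⌈h1⌉₊ := Nat.ceil_mono h01
    have m2 : ⌈h1⌉₊ ≤ ⌈h0⌉₊ + 1 := by
      refine Nat.ceil_le.2 ?_
      push_cast; linarith [Nat.le_ceil h0]
    have m3 : ⌈h0⌉₊ ≤ N := Nat.ceil_le.2 (by linarith)
    have c0 := Nat.le_ceil h0
    have c1 := Nat.le_ceil h1
    rcases m1.eq_or_lt with he | hlt
    · right
      refine ⟨he.symm, by omega, ?_, ?_⟩
      · rw [Nat.cast_sub m3, he]; push_cast at g4; linarith
      · rw [Nat.cast_sub m3]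
        rcases le_or_gt h0 0 with hz | hz
        · rw [Nat.ceil_eq_zero.2 hz]; push_cast; linarith
        · have := Nat.ceil_lt_add_one hz.le; linarith
    · left
      have he : ⌈h1⌉₊ = ⌈h0⌉₊ + 1 := by omega
      have hlt' : (⌈h0⌉₊ : ℝ) < h1 := Nat.lt_ceil.1 hlt
      refine ⟨he, by omega, ?_, ?_⟩ <;> linarith

end LeftCount

theorem admissible_nodeLeft {w : ℕ → ℝ} (hw : ∀ q, 0 ≤ w q) {T : ℝ} (hT : T < 1) (ω : Seed)
    {h v N : ℕ} (hN : Admissible (nodeSum w (h + 1) v) N) :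
    Admissible (nodeSum w h (2 * v)) (nodeLeft w T ω h v N) ∧
      Admissible (nodeSum w h (2 * v + 1)) (N - nodeLeft w T ω h v N) ∧
      nodeLeft w T ω h v N ≤ N := by
  have h1 := nodeMax_nonneg (priority_nonneg hw ω) h
  have h2 : ∀ v, 0 ≤ nodeSum w h v := fun v => nodeSum_nonneg hw
  obtain ⟨h3, h4⟩ := nodeUnif_mem ω v
  obtain ⟨a, b⟩ := admissible_leftCount hT h3 h4 (h2 _) (h2 _) (h1 (2 * v))
    (nodeMax_pos_iff hw ω h _) (nodeMax_pos_iff hw ω h _) hN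
  exact ⟨a, b, leftCount_le ..⟩

theorem admissible_leafCount {w : ℕ → ℝ} (hw : ∀ q, 0 ≤ w q) {T : ℝ} (hT : T < 1) (ω : Seed)
    {h v N : ℕ} (hN : Admissible (nodeSum w h v) N) {q : ℕ} (hq : q / 2 ^ h = v) :
    Admissible (w q) (leafCount w T ω h v N q) := by
  induction h generalizing v N with
  | zero => rw [pow_zero, Nat.div_one] at hq; subst hq; exact hN
  | succ h ih =>
    obtain ⟨a, b, _⟩ := admissible_nodeLeft hw hT ω hN
    rcases below_cases hq with h0 | h0
    · simp only [leafCount, h0, if_true]; exact ih a h0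
    · have hne : ¬ (2 * v + 1 = 2 * v) := by omega
      simp only [leafCount, h0, hne, if_false]; exact ih b h0

theorem nodeSum_leafCount {w : ℕ → ℝ} (hw : ∀ q, 0 ≤ w q) {T : ℝ} (hT : T < 1) (ω : Seed)
    {h v N : ℕ} (hN : Admissible (nodeSum w h v) N) :
    nodeSum (fun q => (leafCount w T ω h v N q : ℝ)) h v = N := by
  induction h generalizing v N with
  | zero => rfl
  | succ h ih =>
    obtain ⟨a, b, c⟩ := admissible_nodeLeft hw hT ω hN
    rw [nodeSum_leafCount_succ (fun a _ => (a : ℝ)) w w T ω h v N N, ih a, ih b, Nat.cast_sub c]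
    ring

/-- By `leftCount_succ` an extra unit goes to exactly one child and leaves the count of the other
unchanged, so it runs down a single path and ends in one leaf. -/
theorem cost_succ_self_le {w : ℕ → ℝ} (hw : ∀ q, 0 ≤ w q) {T : ℝ} (hT : T < 1) (ω : Seed)
    {h v N : ℕ} (hN : (N : ℝ) ≤ nodeSum w h v) (hN' : nodeSum w h v ≤ N + 1) :
    cost w w T ω h v (N + 1) N ≤ 1 := by
  induction h generalizing v N with
  | zero => simp [cost, nodeSum, leafCount]
  | succ h ih =>
    have h2 : ∀ v, 0 ≤ nodeSum w h v := fun v => nodeSum_nonneg hw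
    obtain ⟨h3, h4⟩ := nodeUnif_mem ω v
    rw [cost_succ]
    rcases leftCount_succ (rl := nodeMax (priority w ω) h (2 * v))
      (rr := nodeMax (priority w ω) h (2 * v + 1)) hT h3 h4.le (h2 _) (h2 _) hN hN' with
      ⟨a, b, c, d⟩ | ⟨a, b, c, d⟩
    · change nodeLeft w T ω h v (N + 1) = nodeLeft w T ω h v N + 1 at a
      change N + 1 - nodeLeft w T ω h v (N + 1) = N - nodeLeft w T ω h v N at b
      rw [b, a, cost_self, add_zero]
      exact ih c d
    · change nodeLeft w T ω h v (N + 1) = nodeLeft w T ω h v N at a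
      change N + 1 - nodeLeft w T ω h v (N + 1) = N - nodeLeft w T ω h v N + 1 at b
      rw [b, a, cost_self, zero_add]
      exact ih c d

end CorrelatedSampling

namespace CorrelatedSampling

/-! ### Monotonicity of the splits in the weight of one leaf -/

section Flip

variable {T u sl sr sl' sr' rl rr rl' rr' : ℝ} {m M N : ℕ}

/-- Writing `p = s - m`, this formula and `splitPoint_floor` shift `sl` by `p * u` and by `p + (1 -
p) * u`: the two counts use the complementary parts `[0, p]` and `[p, 1]` of one uniform shift. -/
theorem splitPoint_ceil {s : ℝ} (hs : s = sl + sr) (h : s ≤ m + 1) :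
    splitPoint u sl sr (m + 1 : ℕ) = sl - (s - m) * u := by
  subst hs
  unfold splitPoint
  rw [min_eq_right (by push_cast; linarith), abs_of_nonneg (by push_cast; linarith)]
  push_cast; ring

theorem splitPoint_floor {s : ℝ} (hs : s = sl + sr) (h : m ≤ s) :
    splitPoint u sl sr m = sl - ((s - m) + (1 - (s - m)) * u) := by
  subst hs
  unfold splitPoint
  rw [min_eq_left (by linarith), abs_of_nonpos (by linarith)]
  ring

/-- The effect of an increase of the weight of the left child on a large node. -/
theorem leftCount_flip_left (hT : T < sl + sr) (hu : 0 ≤ u) (hu' : u < 1)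
    (hr : 0 ≤ sr) (hss : sl < sl') (hm : m ≤ sl + sr) (hm' : sl' + sr ≤ m + 1)
    (hM : M ≤ sl) (hM' : sl' ≤ M + 1) (hN : N = m ∨ N = m + 1) :
    M ≤ leftCount T u sl sr rl rr N ∧
    leftCount T u sl sr rl rr N ≤ leftCount T u sl' sr rl' rr' N ∧
    leftCount T u sl' sr rl' rr' N ≤ M + 1 ∧ leftCount T u sl' sr rl' rr' N ≤ N ∧
    (leftCount T u sl' sr rl' rr' N = leftCount T u sl sr rl rr N + 1 →
      ((N - leftCount T u sl' sr rl' rr' N : ℕ) : ℝ) ≤ sr ∧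
      sr ≤ ((N - leftCount T u sl' sr rl' rr' N : ℕ) : ℝ) + 1) := by
  have hd : |(N : ℝ) - (sl + sr)| ≤ 1 := by
    rw [abs_le]; rcases hN with rfl | rfl <;> push_cast <;> constructor <;> linarith
  have hd' : |(N : ℝ) - (sl' + sr)| ≤ 1 := by
    rw [abs_le]; rcases hN with rfl | rfl <;> push_cast <;> constructor <;> linarith
  have hd1 : -1 < (N : ℝ) - (sl + sr) := by
    rcases hN with rfl | rfl <;> push_cast <;> linarith
  have hle := leftCount_le T u sl' sr rl' rr' N
  rw [leftCount_big hu hr hd' (by linarith)] at hle ⊢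
  rw [leftCount_big hu hr hd hT]
  have g0 := lt_splitPoint (sl := sl) (sr := sr) hu' hd1 (abs_le.1 hd).2
  have g1 := splitPoint_le hu hd'
  have g2 := le_splitPoint' hu'.le hd
  have g3 := splitPoint_le' hu hd'
  -- As a function of the left weight the split point has slope `u` for the lower count and `1 - u`
  -- for the upper one.
  have hh : splitPoint u sl sr N ≤ splitPoint u sl' sr N := by
    rcases hN with rfl | rfl
    · rw [splitPoint_floor rfl hm, splitPoint_floor rfl (by linarith)]; nlinarith
    · rw [splitPoint_ceil rfl (by linarith), splitPoint_ceil rfl hm']; nlinarith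
  set x := splitPoint u sl sr N
  set x' := splitPoint u sl' sr N
  have c := Nat.le_ceil x
  have c' := Nat.le_ceil x'
  refine ⟨?_, Nat.ceil_mono hh, Nat.ceil_le.2 (by push_cast; linarith), hle, fun h => ?_⟩
  · have : (M : ℝ) < (⌈x⌉₊ + 1 : ℕ) := by push_cast; linarith
    exact Nat.lt_succ_iff.1 (by exact_mod_cast this)
  · have h1 : (⌈x⌉₊ : ℝ) < x' := Nat.lt_ceil.1 (by omega)
    rw [Nat.cast_sub hle, h]
    push_cast
    constructor <;> linarith

/-- The effect of an increase of the weight of the right child on a large node. -/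
theorem leftCount_flip_right (hT : T < sl + sr) (hu : 0 ≤ u) (hu' : u < 1) (hl : 0 ≤ sl)
    (hr : 0 ≤ sr) (hss : sr < sr') (hm : m ≤ sl + sr) (hm' : sl + sr' ≤ m + 1)
    (hM : M ≤ sr) (hM' : sr' ≤ M + 1) (hN : N = m ∨ N = m + 1) :
    M ≤ N - leftCount T u sl sr rl rr N ∧
    N - leftCount T u sl sr rl rr N ≤ N - leftCount T u sl sr' rl' rr' N ∧
    N - leftCount T u sl sr' rl' rr' N ≤ M + 1 ∧ leftCount T u sl sr rl rr N ≤ N ∧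
    leftCount T u sl sr' rl' rr' N ≤ leftCount T u sl sr rl rr N ∧
    (N - leftCount T u sl sr' rl' rr' N = N - leftCount T u sl sr rl rr N + 1 →
      (leftCount T u sl sr' rl' rr' N : ℝ) ≤ sl ∧
      sl ≤ (leftCount T u sl sr' rl' rr' N : ℝ) + 1) := by
  have hd : |(N : ℝ) - (sl + sr)| ≤ 1 := by
    rw [abs_le]; rcases hN with rfl | rfl <;> push_cast <;> constructor <;> linarith
  have hd' : |(N : ℝ) - (sl + sr')| ≤ 1 := by
    rw [abs_le]; rcases hN with rfl | rfl <;> push_cast <;> constructor <;> linarith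
  have hd1 : -1 < (N : ℝ) - (sl + sr) := by
    rcases hN with rfl | rfl <;> push_cast <;> linarith
  have hle := leftCount_le T u sl sr rl rr N
  have hle' := leftCount_le T u sl sr' rl' rr' N
  have hr' : 0 ≤ sr' := by linarith
  rw [leftCount_big hu hr hd hT] at hle ⊢
  rw [leftCount_big hu hr' hd' (by linarith)] at hle' ⊢
  have g0 := lt_splitPoint (sl := sl) (sr := sr) hu' hd1 (abs_le.1 hd).2
  have g1 := splitPoint_le hu hd
  have hd2 : (N : ℝ) - (sl + sr') < 1 := by
    rcases hN with rfl | rfl <;> push_cast <;> linarith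
  have g2 := lt_splitPoint' (sl := sl) (sr := sr') hu' (abs_le.1 hd').1 hd2
  have g3 := splitPoint_le' hu hd
  have g4 := le_splitPoint hu'.le hd'
  -- As a function of the right weight the split point has slope `u - 1` for the lower count and
  -- `-u` for the upper one.
  have hh : splitPoint u sl sr' N ≤ splitPoint u sl sr N := by
    rcases hN with rfl | rfl
    · rw [splitPoint_floor rfl hm, splitPoint_floor rfl (by linarith)]; nlinarith
    · rw [splitPoint_ceil rfl hm', splitPoint_ceil rfl (by linarith)]; nlinarith
  set x := splitPoint u sl sr N
  set x' := splitPoint u sl sr' N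
  have c := Nat.le_ceil x
  have c' := Nat.le_ceil x'
  have c1 : (⌈x⌉₊ : ℝ) < x + 1 := Nat.ceil_lt_add_one_of_gt_neg_one (by linarith)
  have hmono : ⌈x'⌉₊ ≤ ⌈x⌉₊ := Nat.ceil_mono hh
  refine ⟨?_, by omega, ?_, hle, hmono, fun h => ?_⟩
  · have : (M : ℝ) < (N - ⌈x⌉₊ + 1 : ℕ) := by push_cast [Nat.cast_sub hle]; linarith
    exact Nat.lt_succ_iff.1 (by exact_mod_cast this)
  · have : ((N - ⌈x'⌉₊ : ℕ) : ℝ) < (M + 2 : ℕ) := by push_cast [Nat.cast_sub hle']; linarith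
    exact Nat.lt_succ_iff.1 (by exact_mod_cast this)
  · have h1 : (⌈x'⌉₊ : ℝ) < x := Nat.lt_ceil.1 (by omega)
    have h2 : ⌈x⌉₊ = ⌈x'⌉₊ + 1 := by omega
    refine ⟨by linarith, by linarith⟩

end Flip

/-- Changing the weight of a leaf below the left child of a large node. -/
theorem cost_le_left {w w' : ℕ → ℝ} (hw : ∀ q, 0 ≤ w q) (hw' : ∀ q, 0 ≤ w' q) {T : ℝ} (hT : T < 1)
    (ω : Seed) {h v m M N : ℕ} (hr : ∀ q, q / 2 ^ h = 2 * v + 1 → w q = w' q)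
    (hbig : T < nodeSum w (h + 1) v) (hss : nodeSum w h (2 * v) < nodeSum w' h (2 * v))
    (hm : m ≤ nodeSum w (h + 1) v) (hm' : nodeSum w' (h + 1) v ≤ m + 1)
    (hM : M ≤ nodeSum w h (2 * v)) (hM' : nodeSum w' h (2 * v) ≤ M + 1)
    (hN : N = m ∨ N = m + 1) :
    M ≤ nodeLeft w T ω h v N ∧ nodeLeft w T ω h v N ≤ nodeLeft w' T ω h v N ∧
    nodeLeft w' T ω h v N ≤ M + 1 ∧
    cost w w' T ω (h + 1) v N N ≤
      cost w w' T ω h (2 * v) (nodeLeft w T ω h v N) (nodeLeft w T ω h v N) +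
        2 * ((nodeLeft w' T ω h v N : ℝ) - nodeLeft w T ω h v N) := by
  obtain ⟨h3, h4⟩ := nodeUnif_mem ω v
  have h2 : ∀ v, 0 ≤ nodeSum w h v := fun v => nodeSum_nonneg hw
  have hsr : nodeSum w' h (2 * v + 1) = nodeSum w h (2 * v + 1) :=
    nodeSum_congr fun q hq => (hr q hq).symm
  have hm'' := hm'
  rw [nodeSum, hsr] at hm''
  obtain ⟨a1, a2, a3, a4, a5⟩ := leftCount_flip_left (T := T)
    (rl := nodeMax (priority w ω) h (2 * v)) (rr := nodeMax (priority w ω) h (2 * v + 1))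
    (rl' := nodeMax (priority w' ω) h (2 * v)) (rr' := nodeMax (priority w' ω) h (2 * v + 1))
    hbig h3 h4 (h2 _) hss hm hm'' hM hM' hN
  have e : leftCount T (nodeUnif ω v) (nodeSum w' h (2 * v)) (nodeSum w h (2 * v + 1))
    (nodeMax (priority w' ω) h (2 * v)) (nodeMax (priority w' ω) h (2 * v + 1)) N =
      nodeLeft w' T ω h v N := by rw [nodeLeft, hsr]
  rw [e] at a2 a3 a4 a5
  change M ≤ nodeLeft w T ω h v N at a1
  change nodeLeft w T ω h v N ≤ nodeLeft w' T ω h v N at a2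
  change nodeLeft w' T ω h v N = nodeLeft w T ω h v N + 1 → _ at a5
  refine ⟨a1, a2, a3, ?_⟩
  rw [cost_succ, cost_congr (w₁ := w) (w₂ := w') hr (fun _ _ => rfl)]
  -- Below the left child, first change the weights with the count fixed, then the count. If a unit
  -- moves between the children, each of them pays at most one by `cost_succ_self_le`; this is the
  -- factor two.
  have t1 := cost_triangle w w' w' T ω h (2 * v) (nodeLeft w T ω h v N) (nodeLeft w T ω h v N)
    (nodeLeft w' T ω h v N)
  have hcase : nodeLeft w' T ω h v N = nodeLeft w T ω h v N ∨
      nodeLeft w' T ω h v N = nodeLeft w T ω h v N + 1 := by omega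
  rcases hcase with hc | hc
  · rw [hc, cost_self] at t1 ⊢
    linarith
  · obtain ⟨b1, b2⟩ := a5 hc
    rw [← hsr] at b1 b2
    have t2 := cost_succ_self_le hw' hT ω b1 b2
    have t3 := cost_succ_self_le hw' hT ω (h := h) (v := 2 * v) (N := nodeLeft w T ω h v N)
      (by have : nodeLeft w T ω h v N = M := by omega
          rw [this]; linarith)
      (by have : nodeLeft w T ω h v N = M := by omega
          rw [this]; linarith)
    rw [cost_comm, ← hc] at t3
    have : N - nodeLeft w T ω h v N = N - nodeLeft w' T ω h v N + 1 := by omega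
    rw [this]
    have : (nodeLeft w' T ω h v N : ℝ) = nodeLeft w T ω h v N + 1 := by exact_mod_cast hc
    linarith

/-- Changing the weight of a leaf below the right child of a large node. -/
theorem cost_le_right {w w' : ℕ → ℝ} (hw : ∀ q, 0 ≤ w q) (hw' : ∀ q, 0 ≤ w' q) {T : ℝ} (hT : T < 1)
    (ω : Seed) {h v m M N : ℕ} (hr : ∀ q, q / 2 ^ h = 2 * v → w q = w' q)
    (hbig : T < nodeSum w (h + 1) v) (hss : nodeSum w h (2 * v + 1) < nodeSum w' h (2 * v + 1))
    (hm : m ≤ nodeSum w (h + 1) v) (hm' : nodeSum w' (h + 1) v ≤ m + 1)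
    (hM : M ≤ nodeSum w h (2 * v + 1)) (hM' : nodeSum w' h (2 * v + 1) ≤ M + 1)
    (hN : N = m ∨ N = m + 1) :
    M ≤ N - nodeLeft w T ω h v N ∧ nodeLeft w' T ω h v N ≤ nodeLeft w T ω h v N ∧
    nodeLeft w T ω h v N ≤ N ∧
    N - nodeLeft w' T ω h v N ≤ M + 1 ∧
    cost w w' T ω (h + 1) v N N ≤
      cost w w' T ω h (2 * v + 1) (N - nodeLeft w T ω h v N) (N - nodeLeft w T ω h v N) +
        2 * ((nodeLeft w T ω h v N : ℝ) - nodeLeft w' T ω h v N) := by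
  obtain ⟨h3, h4⟩ := nodeUnif_mem ω v
  have h2 : ∀ v, 0 ≤ nodeSum w h v := fun v => nodeSum_nonneg hw
  have hsr : nodeSum w' h (2 * v) = nodeSum w h (2 * v) :=
    nodeSum_congr fun q hq => (hr q hq).symm
  have hm'' := hm'
  rw [nodeSum, hsr] at hm''
  obtain ⟨a1, a2, a3, a4, a5, a6⟩ := leftCount_flip_right (T := T)
    (rl := nodeMax (priority w ω) h (2 * v)) (rr := nodeMax (priority w ω) h (2 * v + 1))
    (rl' := nodeMax (priority w' ω) h (2 * v)) (rr' := nodeMax (priority w' ω) h (2 * v + 1))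
    hbig h3 h4 (h2 _) (h2 _) hss hm hm'' hM hM' hN
  have e : leftCount T (nodeUnif ω v) (nodeSum w h (2 * v)) (nodeSum w' h (2 * v + 1))
    (nodeMax (priority w' ω) h (2 * v)) (nodeMax (priority w' ω) h (2 * v + 1)) N =
      nodeLeft w' T ω h v N := by rw [nodeLeft, hsr]
  rw [e] at a2 a3 a5 a6
  change M ≤ N - nodeLeft w T ω h v N at a1
  change N - nodeLeft w T ω h v N ≤ N - nodeLeft w' T ω h v N at a2
  change nodeLeft w T ω h v N ≤ N at a4
  change nodeLeft w' T ω h v N ≤ nodeLeft w T ω h v N at a5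
  change N - nodeLeft w' T ω h v N = N - nodeLeft w T ω h v N + 1 → _ at a6
  refine ⟨a1, a5, a4, a3, ?_⟩
  rw [cost_succ, cost_congr (w₁ := w) (w₂ := w') hr (fun _ _ => rfl) (nodeLeft w T ω h v N)]
  have t1 := cost_triangle w w' w' T ω h (2 * v + 1) (N - nodeLeft w T ω h v N)
    (N - nodeLeft w T ω h v N) (N - nodeLeft w' T ω h v N)
  have hcase : N - nodeLeft w' T ω h v N = N - nodeLeft w T ω h v N ∨
      N - nodeLeft w' T ω h v N = N - nodeLeft w T ω h v N + 1 := by omega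
  rcases hcase with hc | hc
  · have hc' : nodeLeft w' T ω h v N = nodeLeft w T ω h v N := by omega
    rw [hc', cost_self] at t1 ⊢
    linarith
  · obtain ⟨b1, b2⟩ := a6 hc
    rw [← hsr] at b1 b2
    have t2 := cost_succ_self_le hw' hT ω b1 b2
    have t3 := cost_succ_self_le hw' hT ω (h := h) (v := 2 * v + 1) (N := N - nodeLeft w T ω h v N)
      (by have : N - nodeLeft w T ω h v N = M := by omega
          rw [this]; linarith)
      (by have : N - nodeLeft w T ω h v N = M := by omega
          rw [this]; linarith)
    rw [cost_comm, ← hc] at t3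
    have h5 : nodeLeft w T ω h v N = nodeLeft w' T ω h v N + 1 := by omega
    have h6 : (nodeLeft w T ω h v N : ℝ) = nodeLeft w' T ω h v N + 1 := by exact_mod_cast h5
    rw [← h5] at t2
    linarith

/-! ### Light nodes -/

/-- The leaf that wins below the node `v` of height `h`. -/
noncomputable def winner (w : ℕ → ℝ) (ω : Seed) : ℕ → ℕ → ℕ
  | 0, v => v
  | h + 1, v =>
    if nodeMax (priority w ω) h (2 * v + 1) ≤ nodeMax (priority w ω) h (2 * v) then
      winner w ω h (2 * v) else winner w ω h (2 * v + 1)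

theorem winner_below (w : ℕ → ℝ) (ω : Seed) (h v : ℕ) : winner w ω h v / 2 ^ h = v := by
  induction h generalizing v with
  | zero => simp [winner]
  | succ h ih =>
    unfold winner; split_ifs
    · exact below_left (ih _)
    · exact below_right (ih _)

theorem leafCount_zero (w : ℕ → ℝ) (T : ℝ) (ω : Seed) (h v q : ℕ) :
    leafCount w T ω h v 0 q = 0 := Nat.le_zero.1 (leafCount_le ..)

/-- With nonnegative weights every descendant of a light node is light as well, so the whole count
follows the maximal priority down to one leaf. -/
theorem leafCount_small {w : ℕ → ℝ} (hw : ∀ q, 0 ≤ w q) {T : ℝ} (ω : Seed) {h v N q : ℕ}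
    (hs : nodeSum w h v ≤ T) (hq : q / 2 ^ h = v) :
    leafCount w T ω h v N q = if q = winner w ω h v then N else 0 := by
  induction h generalizing v N with
  | zero =>
    rw [pow_zero, Nat.div_one] at hq
    simp [leafCount, winner, hq]
  | succ h ih =>
    have h2 : ∀ v, 0 ≤ nodeSum w h v := fun v => nodeSum_nonneg hw
    have hN : nodeLeft w T ω h v N = if nodeMax (priority w ω) h (2 * v + 1) ≤
        nodeMax (priority w ω) h (2 * v) then N else 0 := if_pos hs
    rw [nodeSum] at hs
    have hl : nodeSum w h (2 * v) ≤ T := by linarith [h2 (2 * v + 1)]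
    have hr : nodeSum w h (2 * v + 1) ≤ T := by linarith [h2 (2 * v)]
    have b1 := winner_below w ω h (2 * v)
    have b2 := winner_below w ω h (2 * v + 1)
    rcases below_cases hq with h0 | h0
    · simp only [leafCount, h0, if_true, hN, winner]
      split_ifs with h3 h4 h4
      · rw [ih hl h0, if_pos h4]
      · rw [ih hl h0, if_neg h4]
      · rw [h4, b2] at h0; omega
      · exact leafCount_zero ..
    · have hne : ¬ (2 * v + 1 = 2 * v) := by omega
      simp only [leafCount, h0, hne, if_false, hN, winner]
      split_ifs with h3 h4 h4
      · rw [h4, b1] at h0; omega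
      · rw [Nat.sub_self]; exact leafCount_zero ..
      · rw [Nat.sub_zero, ih hr h0, if_pos h4]
      · rw [Nat.sub_zero, ih hr h0, if_neg h4]

/-- Increasing the weight of one leaf can only make that leaf the winner. -/
theorem winner_mono {w w' : ℕ → ℝ} {i : ℕ} (hi : w i ≤ w' i) (hne : ∀ q, q ≠ i → w q = w' q)
    (ω : Seed) (h v : ℕ) :
    (nodeMax (priority w' ω) h v = nodeMax (priority w ω) h v ∧
      winner w' ω h v = winner w ω h v) ∨
    (nodeMax (priority w ω) h v ≤ nodeMax (priority w' ω) h v ∧ winner w' ω h v = i) := by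
  induction h generalizing v with
  | zero =>
    by_cases hv : v = i
    · subst hv
      exact Or.inr ⟨div_le_div_of_nonneg_right hi (clock_pos ω v).le, rfl⟩
    · exact Or.inl ⟨by simp [nodeMax, priority, hne v hv], rfl⟩
  | succ h ih =>
    -- Off the path of `i` the second alternative is impossible, since a winner lies below its node.
    have key : ∀ v, i / 2 ^ h ≠ v → nodeMax (priority w' ω) h v = nodeMax (priority w ω) h v ∧
        winner w' ω h v = winner w ω h v := by
      intro v hv
      rcases ih v with h1 | ⟨_, h1⟩
      · exact h1
      · exact absurd (h1 ▸ winner_below w' ω h v) hv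
    simp only [nodeMax, winner]
    by_cases hl : i / 2 ^ h = 2 * v
    · obtain ⟨e1, e2⟩ := key (2 * v + 1) (by omega)
      rw [e1, e2]
      rcases ih (2 * v) with ⟨f1, f2⟩ | ⟨f1, f2⟩
      · rw [f1, f2]; exact Or.inl ⟨rfl, rfl⟩
      · by_cases hc : nodeMax (priority w ω) h (2 * v + 1) ≤ nodeMax (priority w' ω) h (2 * v)
        · rw [if_pos hc]; exact Or.inr ⟨max_le_max f1 le_rfl, f2⟩
        · rw [if_neg hc, if_neg (fun h => hc (h.trans f1))]
          push Not at hc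
          exact Or.inl ⟨by rw [max_eq_right hc.le, max_eq_right (f1.trans hc.le)], rfl⟩
    · obtain ⟨e1, e2⟩ := key (2 * v) (Ne.intro hl)
      rw [e1, e2]
      rcases ih (2 * v + 1) with ⟨f1, f2⟩ | ⟨f1, f2⟩
      · rw [f1, f2]; exact Or.inl ⟨rfl, rfl⟩
      · by_cases hc : nodeMax (priority w' ω) h (2 * v + 1) ≤ nodeMax (priority w ω) h (2 * v)
        · rw [if_pos hc, if_pos (f1.trans hc)]
          exact Or.inl ⟨by rw [max_eq_left hc, max_eq_left (f1.trans hc)], rfl⟩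
        · rw [if_neg hc]; exact Or.inr ⟨max_le_max le_rfl f1, f2⟩

end CorrelatedSampling

namespace CorrelatedSampling

/-! ### Expectations over the seed -/

instance : IsProbabilityMeasure seedMeasure := by unfold seedMeasure; infer_instance

/-- The expectation over the seed. -/
noncomputable def expect (F : Seed → ℝ) : ℝ := ∫ ω, F ω ∂seedMeasure

/-- Bounded measurable functions of the seed. -/
structure BddMeas (F : Seed → ℝ) : Prop where
  measurable : Measurable F
  bdd : ∃ C, ∀ ω, |F ω| ≤ C

namespace BddMeas

variable {F G : Seed → ℝ}

theorem integrable (hF : BddMeas F) : Integrable F seedMeasure := by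
  obtain ⟨C, hC⟩ := hF.bdd
  exact Integrable.of_bound hF.measurable.aestronglyMeasurable C (ae_of_all _ hC)

theorem const (c : ℝ) : BddMeas fun _ => c := ⟨measurable_const, |c|, fun _ => le_rfl⟩

theorem add (hF : BddMeas F) (hG : BddMeas G) : BddMeas fun ω => F ω + G ω := by
  obtain ⟨C, hC⟩ := hF.bdd
  obtain ⟨D, hD⟩ := hG.bdd
  exact ⟨hF.measurable.add hG.measurable, C + D,
    fun ω => (abs_add_le _ _).trans (add_le_add (hC ω) (hD ω))⟩

theorem neg (hF : BddMeas F) : BddMeas fun ω => - F ω := by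
  obtain ⟨C, hC⟩ := hF.bdd
  exact ⟨hF.measurable.neg, C, fun ω => by rw [abs_neg]; exact hC ω⟩

theorem sub (hF : BddMeas F) (hG : BddMeas G) : BddMeas fun ω => F ω - G ω := by
  simpa [sub_eq_add_neg] using hF.add hG.neg

theorem mul (hF : BddMeas F) (hG : BddMeas G) : BddMeas fun ω => F ω * G ω := by
  obtain ⟨C, hC⟩ := hF.bdd
  obtain ⟨D, hD⟩ := hG.bdd
  refine ⟨hF.measurable.mul hG.measurable, C * D, fun ω => ?_⟩
  rw [abs_mul]
  exact mul_le_mul (hC ω) (hD ω) (abs_nonneg _) ((abs_nonneg _).trans (hC ω))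

theorem const_mul (c : ℝ) (hF : BddMeas F) : BddMeas fun ω => c * F ω := (const c).mul hF

theorem sum {ι : Type*} (s : Finset ι) {F : ι → Seed → ℝ} (hF : ∀ i ∈ s, BddMeas (F i)) :
    BddMeas fun ω => ∑ i ∈ s, F i ω := by
  classical
  induction s using Finset.induction_on with
  | empty => simpa using const 0
  | insert i s hi ih =>
    simp only [Finset.sum_insert hi]
    exact (hF i (by simp)).add (ih fun j hj => hF j (by simp [hj]))

theorem nodeSum {F : ℕ → Seed → ℝ} (hF : ∀ q, BddMeas (F q)) (h v : ℕ) :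
    BddMeas fun ω => nodeSum (fun q => F q ω) h v := by
  induction h generalizing v with
  | zero => exact hF v
  | succ h ih => exact (ih _).add (ih _)

theorem abs (hF : BddMeas F) : BddMeas fun ω => |F ω| := by
  obtain ⟨C, hC⟩ := hF.bdd
  refine ⟨?_, C, fun ω => by rw [abs_abs]; exact hC ω⟩
  simpa [Real.norm_eq_abs] using hF.measurable.norm

theorem indicator {p : Seed → Prop} [DecidablePred p] (hp : MeasurableSet {ω | p ω}) :
    BddMeas fun ω => if p ω then 1 else 0 :=
  ⟨Measurable.ite hp measurable_const measurable_const, 1, fun ω => by split_ifs <;> simp⟩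

end BddMeas

section Expect

variable {F G : Seed → ℝ}

theorem expect_const (c : ℝ) : expect (fun _ => c) = c := by simp [expect]

theorem expect_add (hF : BddMeas F) (hG : BddMeas G) :
    expect (fun ω => F ω + G ω) = expect F + expect G := integral_add hF.integrable hG.integrable

theorem expect_sub (hF : BddMeas F) (hG : BddMeas G) :
    expect (fun ω => F ω - G ω) = expect F - expect G := integral_sub hF.integrable hG.integrable

theorem expect_const_mul (c : ℝ) (F : Seed → ℝ) :
    expect (fun ω => c * F ω) = c * expect F := integral_const_mul c F

theorem expect_mono (hF : BddMeas F) (hG : BddMeas G) (h : ∀ ω, F ω ≤ G ω) :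
    expect F ≤ expect G := integral_mono hF.integrable hG.integrable h

theorem expect_nonneg (h : ∀ ω, 0 ≤ F ω) : 0 ≤ expect F := integral_nonneg h

theorem expect_sum {ι : Type*} (s : Finset ι) {F : ι → Seed → ℝ} (hF : ∀ i ∈ s, BddMeas (F i)) :
    expect (fun ω => ∑ i ∈ s, F i ω) = ∑ i ∈ s, expect (F i) :=
  integral_finsetSum s fun i hi => (hF i hi).integrable

theorem expect_nodeSum {F : ℕ → Seed → ℝ} (hF : ∀ q, BddMeas (F q)) (h v : ℕ) :
    expect (fun ω => nodeSum (fun q => F q ω) h v) = nodeSum (fun q => expect (F q)) h v := by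
  induction h generalizing v with
  | zero => rfl
  | succ h ih =>
    simp only [nodeSum]
    rw [expect_add (BddMeas.nodeSum hF h _) (BddMeas.nodeSum hF h _), ih, ih]

/-! ### Conditioning on a part of the seed -/

open Classical in
/-- Take the entries in `J` from the first seed and the others from the second one. -/
noncomputable def mergeSeed (J : Set ℕ) (ω ω' : Seed) : Seed := fun j => if j ∈ J then ω j else ω' j

theorem mergeSeed_of_mem {J : Set ℕ} (ω ω' : Seed) {j : ℕ} (hj : j ∈ J) :
    mergeSeed J ω ω' j = ω j := if_pos hj

theorem mergeSeed_of_notMem {J : Set ℕ} (ω ω' : Seed) {j : ℕ} (hj : j ∉ J) :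
    mergeSeed J ω ω' j = ω' j := if_neg hj

theorem measurable_mergeSeed (J : Set ℕ) :
    Measurable fun p : Seed × Seed => mergeSeed J p.1 p.2 := by
  refine measurable_pi_lambda _ fun j => ?_
  by_cases hj : j ∈ J
  · simp only [mergeSeed, hj, if_true]; fun_prop
  · simp only [mergeSeed, hj, if_false]; fun_prop

/-- A box splits into its conditions on the entries in `J` and those on the other entries, and the
product measure of a box is the product of the two. Through `expect_merge` this becomes
conditioning: the outer seed supplies the entries in `J`, the inner one the rest. -/
theorem measurePreserving_mergeSeed (J : Set ℕ) :
    MeasurePreserving (fun p : Seed × Seed => mergeSeed J p.1 p.2)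
      (seedMeasure.prod seedMeasure) seedMeasure := by
  classical
  refine ⟨measurable_mergeSeed J, Measure.eq_infinitePi _ fun s t ht => ?_⟩
  rw [Measure.map_apply (measurable_mergeSeed J) (MeasurableSet.pi s.countable_toSet
    fun i _ => ht i)]
  have : (fun p : Seed × Seed => mergeSeed J p.1 p.2) ⁻¹' (Set.pi s t) =
      (Set.pi (s.filter (· ∈ J) : Finset ℕ) t) ×ˢ (Set.pi (s.filter (· ∉ J) : Finset ℕ) t) := by
    ext p
    simp only [Set.mem_preimage, Set.mem_pi, Set.mem_prod, Finset.coe_filter, Set.mem_ofPred_eq,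
      Finset.mem_coe]
    constructor
    · intro h
      refine ⟨fun i hi => ?_, fun i hi => ?_⟩
      · have := h i hi.1
        rwa [mergeSeed_of_mem _ _ hi.2] at this
      · have := h i hi.1
        rwa [mergeSeed_of_notMem _ _ hi.2] at this
    · intro h i hi
      by_cases hj : i ∈ J
      · rw [mergeSeed_of_mem _ _ hj]; exact h.1 i ⟨hi, hj⟩
      · rw [mergeSeed_of_notMem _ _ hj]; exact h.2 i ⟨hi, hj⟩
  rw [this, Measure.prod_prod]
  unfold seedMeasure
  rw [Measure.infinitePi_pi _ fun i _ => ht i, Measure.infinitePi_pi _ fun i _ => ht i,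
    Finset.prod_filter_mul_prod_filter_not]

theorem expect_merge (J : Set ℕ) (hF : BddMeas F) :
    expect F = expect fun ω' => expect fun ω => F (mergeSeed J ω' ω) := by
  have hm := measurePreserving_mergeSeed J
  obtain ⟨C, hC⟩ := hF.bdd
  unfold expect
  rw [← hm.map_eq, integral_map hm.measurable.aemeasurable hF.measurable.aestronglyMeasurable,
    integral_prod]
  · rw [hm.map_eq]
  · exact Integrable.of_bound (hF.measurable.comp hm.measurable).aestronglyMeasurable C
      (ae_of_all _ fun p => hC _)

theorem BddMeas.merge_left (hF : BddMeas F) (J : Set ℕ) :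
    BddMeas fun ω' => expect fun ω => F (mergeSeed J ω' ω) := by
  obtain ⟨C, hC⟩ := hF.bdd
  refine ⟨?_, C, fun ω' => ?_⟩
  · have : StronglyMeasurable fun p : Seed × Seed => F (mergeSeed J p.1 p.2) :=
      (hF.measurable.comp (measurable_mergeSeed J)).stronglyMeasurable
    exact this.integral_prod_right.measurable
  · have := norm_integral_le_of_norm_le_const (μ := seedMeasure) (C := C)
      (f := fun ω => F (mergeSeed J ω' ω)) (ae_of_all _ fun ω => hC (mergeSeed J ω' ω))
    simpa [expect] using this

theorem BddMeas.comp_merge (hF : BddMeas F) (J : Set ℕ) (ω' : Seed) :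
    BddMeas fun ω => F (mergeSeed J ω' ω) := by
  obtain ⟨C, hC⟩ := hF.bdd
  exact ⟨hF.measurable.comp ((measurable_mergeSeed J).comp measurable_prodMk_left), C,
    fun ω => hC _⟩

/-- Functions of disjoint parts of the seed are independent. -/
theorem expect_mul (J : Set ℕ) (hF : BddMeas F) (hG : BddMeas G)
    (hFJ : ∀ ω ω', (∀ j ∈ J, ω j = ω' j) → F ω = F ω')
    (hGJ : ∀ ω ω', (∀ j ∉ J, ω j = ω' j) → G ω = G ω') :
    expect (fun ω => F ω * G ω) = expect F * expect G := by
  rw [expect_merge J (hF.mul hG)]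
  have h1 : ∀ ω' ω, F (mergeSeed J ω' ω) = F ω' := fun ω' ω =>
    hFJ _ _ fun j hj => mergeSeed_of_mem _ _ hj
  have h2 : ∀ ω' ω, G (mergeSeed J ω' ω) = G ω := fun ω' ω =>
    hGJ _ _ fun j hj => mergeSeed_of_notMem _ _ hj
  simp only [h1, h2, expect_const_mul]
  simp only [mul_comm _ (expect G), expect_const_mul]

theorem expect_coord (j : ℕ) {g : ℝ → ℝ} (hg : Measurable g) :
    expect (fun ω => g (ω j)) = ∫ x in (0 : ℝ)..1, g x := by
  have h1 : MeasurePreserving (fun ω : Seed => ω j) seedMeasure volume :=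
    measurePreserving_eval_infinitePi _ j
  have h2 := unitInterval.measurePreserving_coe.comp h1
  have h3 : expect (fun ω => g (ω j)) = ∫ x, g x ∂(volume.restrict unitInterval) := by
    rw [← h2.map_eq, integral_map h2.measurable.aemeasurable hg.aestronglyMeasurable]
    rfl
  rw [h3, intervalIntegral.integral_of_le zero_le_one, ← integral_Icc_eq_integral_Ioc]

theorem ae_coord_lt_one (j : ℕ) : ∀ᵐ ω ∂seedMeasure, (ω j : ℝ) < 1 := by
  have h1 : MeasurePreserving (fun ω : Seed => ω j) seedMeasure volume :=
    measurePreserving_eval_infinitePi _ j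
  have h2 : ∀ᵐ t : unitInterval, t ≠ 1 := by simp [ae_iff]
  filter_upwards [h1.quasiMeasurePreserving.ae h2] with ω hω
  exact lt_of_le_of_ne (ω j).2.2 fun h => hω (Subtype.ext h)

/-- The replacement of the value `1` by `0` concerns a null event, so `nodeUnif` is still uniform.
-/
theorem expect_nodeUnif (v : ℕ) {g : ℝ → ℝ} (hg : Measurable g) :
    expect (fun ω => g (nodeUnif ω v)) = ∫ x in (0 : ℝ)..1, g x := by
  rw [← expect_coord (v + 3) hg]
  refine integral_congr_ae ?_
  filter_upwards [ae_coord_lt_one (v + 3)] with ω hω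
  simp [nodeUnif, hω]

end Expect

/-! ### Rounding by a uniform shift -/

theorem measurable_ceil_sub (s : ℝ) : Measurable fun x : ℝ => (⌈s - x⌉₊ : ℝ) :=
  measurable_from_nat.comp (Nat.measurable_ceil.comp (measurable_const.sub measurable_id))

theorem intervalIntegrable_ceil_sub (s a b : ℝ) :
    IntervalIntegrable (fun x : ℝ => (⌈s - x⌉₊ : ℝ)) volume a b := by
  have : Antitone fun x : ℝ => (⌈s - x⌉₊ : ℝ) := fun x y hxy =>
    Nat.cast_le.2 (Nat.ceil_mono (by linarith))
  exact this.intervalIntegrable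

theorem integral_ceil_sub {s : ℝ} (hs : 0 ≤ s) : ∫ x in (0 : ℝ)..1, (⌈s - x⌉₊ : ℝ) = s := by
  have hn := Nat.floor_le hs
  have hn' := Nat.lt_floor_add_one s
  set n := ⌊s⌋₊
  rw [← intervalIntegral.integral_add_adjacent_intervals (b := s - n)
    (intervalIntegrable_ceil_sub _ _ _) (intervalIntegrable_ceil_sub _ _ _)]
  -- The integrand jumps from `n + 1` to `n` where the shift equals the fractional part of `s`.
  have h1 : ∫ x in (0 : ℝ)..(s - n), (⌈s - x⌉₊ : ℝ) = ∫ x in (0 : ℝ)..(s - n), (n + 1 : ℝ) := by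
    refine intervalIntegral.integral_congr_Ioo_of_le (by linarith) fun x hx => ?_
    have : ⌈s - x⌉₊ = n + 1 := (Nat.ceil_eq_iff (by simp)).2 ⟨by simp; linarith [hx.2], by
      push_cast; linarith [hx.1]⟩
    simp [this]
  have h2 : ∫ x in (s - n)..1, (⌈s - x⌉₊ : ℝ) = ∫ x in (s - n)..1, (n : ℝ) := by
    refine intervalIntegral.integral_congr_Ioo_of_le (by linarith) fun x hx => ?_
    have : ⌈s - x⌉₊ = n := by
      apply le_antisymm
      · exact Nat.ceil_le.2 (by linarith [hx.1])
      · have : (n : ℝ) < (⌈s - x⌉₊ + 1 : ℕ) := by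
          push_cast; linarith [Nat.le_ceil (s - x), hx.2]
        exact Nat.lt_succ_iff.1 (by exact_mod_cast this)
    simp [this]
  rw [h1, h2]
  simp
  ring

/-- The two ways to split a node average to the weight of the left child. -/
theorem integral_split {s p : ℝ} (hs : 0 ≤ s) :
    p * (∫ u in (0 : ℝ)..1, (⌈s - p * u⌉₊ : ℝ)) +
      (1 - p) * (∫ u in (0 : ℝ)..1, (⌈s - (p + (1 - p) * u)⌉₊ : ℝ)) = s := by
  have h1 := intervalIntegral.smul_integral_comp_mul_left (a := 0) (b := 1)
    (fun x : ℝ => (⌈s - x⌉₊ : ℝ)) p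
  have h2 := intervalIntegral.smul_integral_comp_add_mul (a := 0) (b := 1)
    (fun x : ℝ => (⌈s - x⌉₊ : ℝ)) (1 - p) p
  simp only [smul_eq_mul] at h1 h2
  rw [h1, h2, mul_zero, mul_one, mul_zero, mul_one, add_zero, add_sub_cancel,
    intervalIntegral.integral_add_adjacent_intervals
      (intervalIntegrable_ceil_sub _ _ _) (intervalIntegrable_ceil_sub _ _ _),
    integral_ceil_sub hs]

/-- The coefficients are the probabilities with which an unbiased count is `m + 1` or `m`. Mixing
with them joins the two partial shifts into one uniform shift, for which the mean ceiling is the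
weight itself. -/
theorem expect_nodeLeft {w : ℕ → ℝ} (hw : ∀ q, 0 ≤ w q) {T : ℝ} {h v m : ℕ}
    (hbig : T < nodeSum w (h + 1) v) (hm : m ≤ nodeSum w (h + 1) v)
    (hm' : nodeSum w (h + 1) v ≤ m + 1) :
    (nodeSum w (h + 1) v - m) * expect (fun ω => (nodeLeft w T ω h v (m + 1) : ℝ)) +
      (m + 1 - nodeSum w (h + 1) v) * expect (fun ω => (nodeLeft w T ω h v m : ℝ)) =
    nodeSum w h (2 * v) := by
  have hs : 0 ≤ nodeSum w h (2 * v) := nodeSum_nonneg hw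
  set s := nodeSum w (h + 1) v
  have e1 : ∀ ω, (nodeLeft w T ω h v (m + 1) : ℝ) =
      (fun u : ℝ => (⌈nodeSum w h (2 * v) - (s - m) * u⌉₊ : ℝ)) (nodeUnif ω v) := fun ω => by
    rw [nodeLeft, leftCount_big (nodeUnif_mem ω v).1 (nodeSum_nonneg hw) ?_ hbig,
      splitPoint_ceil rfl hm']
    · rfl
    · change |((m + 1 : ℕ) : ℝ) - s| ≤ 1
      rw [abs_le]; push_cast; constructor <;> linarith
  have e0 : ∀ ω, (nodeLeft w T ω h v m : ℝ) =
      (fun u : ℝ => (⌈nodeSum w h (2 * v) - ((s - m) + (1 - (s - m)) * u)⌉₊ : ℝ))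
        (nodeUnif ω v) := fun ω => by
    rw [nodeLeft, leftCount_big (nodeUnif_mem ω v).1 (nodeSum_nonneg hw) ?_ hbig,
      splitPoint_floor rfl hm]
    · rfl
    · change |(m : ℝ) - s| ≤ 1
      rw [abs_le]; constructor <;> linarith
  have f1 := expect_nodeUnif v ((measurable_ceil_sub (nodeSum w h (2 * v))).comp
    (f := fun u : ℝ => (s - m) * u) (by fun_prop))
  have f0 := expect_nodeUnif v ((measurable_ceil_sub (nodeSum w h (2 * v))).comp
    (f := fun u : ℝ => (s - m) + (1 - (s - m)) * u) (by fun_prop))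
  simp only [Function.comp_def] at f1 f0
  simp only [e1, e0]
  rw [f1, f0]
  have := integral_split (p := s - m) hs
  rw [show (m : ℝ) + 1 - s = 1 - (s - m) by ring]
  exact this

end CorrelatedSampling

namespace CorrelatedSampling

/-! ### Measurability and dependence on the seed -/

theorem measurable_nodeUnif (v : ℕ) : Measurable fun ω => nodeUnif ω v := by
  unfold nodeUnif
  exact Measurable.ite (measurableSet_lt (by fun_prop) measurable_const) (by fun_prop)
    measurable_const

theorem measurable_clock (q : ℕ) : Measurable fun ω => clock ω q := by
  unfold clock
  have : Measurable fun ω : Seed => - Real.log (ω (q + 3) : ℝ) := by fun_prop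
  exact Measurable.ite (measurableSet_lt measurable_const this) this measurable_const

section Measurability

variable {w : Seed → ℕ → ℝ} {T : Seed → ℝ}

theorem measurable_priority (hw : ∀ q, Measurable fun ω => w ω q) (q : ℕ) :
    Measurable fun ω => priority (w ω) ω q := (hw q).div (measurable_clock q)

theorem measurable_nodeSum {f : Seed → ℕ → ℝ} (hf : ∀ q, Measurable fun ω => f ω q) (h v : ℕ) :
    Measurable fun ω => nodeSum (f ω) h v := by
  induction h generalizing v with
  | zero => exact hf v
  | succ h ih => exact (ih _).add (ih _)

theorem measurable_nodeMax {f : Seed → ℕ → ℝ} (hf : ∀ q, Measurable fun ω => f ω q) (h v : ℕ) :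
    Measurable fun ω => nodeMax (f ω) h v := by
  induction h generalizing v with
  | zero => exact hf v
  | succ h ih => exact (ih _).max (ih _)

theorem measurable_nodeLeft (hw : ∀ q, Measurable fun ω => w ω q) (hT : Measurable T)
    {N : Seed → ℕ} (hN : Measurable N) (h v : ℕ) :
    Measurable fun ω => nodeLeft (w ω) (T ω) ω h v (N ω) := by
  unfold nodeLeft leftCount
  have h1 := measurable_nodeSum hw h
  have h2 := measurable_nodeMax (measurable_priority hw) h
  have h3 := measurable_nodeUnif v
  have hN' : Measurable fun ω => (N ω : ℝ) := measurable_from_nat.comp hN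
  have hd : Measurable fun ω => (N ω : ℝ) - (nodeSum (w ω) h (2 * v) +
    nodeSum (w ω) h (2 * v + 1)) := hN'.sub ((h1 _).add (h1 _))
  refine Measurable.ite (measurableSet_le ((h1 _).add (h1 _)) hT)
    (Measurable.ite (measurableSet_le (h2 _) (h2 _)) hN measurable_const)
    (hN.min (Nat.measurable_ceil.comp ?_))
  unfold splitPoint
  refine ((h1 _).add (hd.min measurable_const)).sub ((measurable_const.sub ?_).mul h3)
  simpa [Real.norm_eq_abs] using hd.norm

theorem measurable_leafCount (hw : ∀ q, Measurable fun ω => w ω q) (hT : Measurable T)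
    {N : Seed → ℕ} (hN : Measurable N) (h v q : ℕ) :
    Measurable fun ω => leafCount (w ω) (T ω) ω h v (N ω) q := by
  induction h generalizing v N with
  | zero => exact hN
  | succ h ih =>
    have h1 := measurable_nodeLeft hw hT hN h v
    simp only [leafCount]
    by_cases hq : q / 2 ^ h = 2 * v
    · simp only [hq, if_true]; exact ih h1 _
    · simp only [hq, if_false]; exact ih (hN.sub h1) _

theorem measurable_winner (hw : ∀ q, Measurable fun ω => w ω q) (h v : ℕ) :
    Measurable fun ω => winner (w ω) ω h v := by
  induction h generalizing v with
  | zero => exact measurable_const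
  | succ h ih =>
    have h2 := measurable_nodeMax (measurable_priority hw) h
    exact Measurable.ite (measurableSet_le (h2 _) (h2 _)) (ih _) (ih _)

end Measurability

theorem BddMeas.of_nat {F : Seed → ℕ} (hF : Measurable F) {C : ℕ} (hC : ∀ ω, F ω ≤ C) :
    BddMeas fun ω => (F ω : ℝ) :=
  ⟨measurable_from_nat.comp hF, C, fun ω => by rw [Nat.abs_cast]; exact_mod_cast hC ω⟩

theorem bddMeas_leafCount (w : ℕ → ℝ) (T : ℝ) (h v N q : ℕ) :
    BddMeas fun ω => (leafCount w T ω h v N q : ℝ) :=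
  BddMeas.of_nat (measurable_leafCount (w := fun _ => w) (T := fun _ => T) (N := fun _ => N)
    (fun _ => measurable_const) measurable_const measurable_const h v q) fun ω => leafCount_le w T ω h v N q

theorem bddMeas_nodeLeft (w : ℕ → ℝ) (T : ℝ) (h v N : ℕ) :
    BddMeas fun ω => (nodeLeft w T ω h v N : ℝ) :=
  BddMeas.of_nat (measurable_nodeLeft (w := fun _ => w) (T := fun _ => T) (N := fun _ => N)
    (fun _ => measurable_const) measurable_const measurable_const h v) fun _ => leftCount_le ..

theorem bddMeas_cost (w w' : ℕ → ℝ) (T : ℝ) (h v N N' : ℕ) :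
    BddMeas fun ω => cost w w' T ω h v N N' :=
  BddMeas.nodeSum (fun q => ((bddMeas_leafCount w T h v N q).sub
    (bddMeas_leafCount w' T h v N' q)).abs) h v

theorem bddMeas_winner (w : ℕ → ℝ) (h v q : ℕ) :
    BddMeas fun ω => if q = winner w ω h v then (1 : ℝ) else 0 := by
  refine BddMeas.indicator ?_
  have := measurable_winner (w := fun _ => w) (fun _ => measurable_const) h v
  exact measurableSet_eq_fun measurable_const this

section SeedCongr

variable {ω ω' : Seed}

theorem le_of_div_two_pow {q h v : ℕ} (hq : q / 2 ^ h = v) : v ≤ q := hq ▸ Nat.div_le_self _ _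

/-- In heap numbering every descendant of `v` has number at least `v`, so the part of the tree below
`v` reads only seed entries from `v + 3` onwards. -/
theorem nodeMax_congr_seed {w : ℕ → ℝ} {h v : ℕ} (hω : ∀ j, v + 3 ≤ j → ω j = ω' j) :
    nodeMax (priority w ω) h v = nodeMax (priority w ω') h v := by
  refine nodeMax_congr fun q hq => ?_
  have := le_of_div_two_pow hq
  unfold priority clock
  rw [hω _ (by omega)]

theorem leafCount_congr_seed {w : ℕ → ℝ} {T : ℝ} {h v : ℕ} (hω : ∀ j, v + 3 ≤ j → ω j = ω' j)
    (N q : ℕ) : leafCount w T ω h v N q = leafCount w T ω' h v N q := by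
  induction h generalizing v N with
  | zero => rfl
  | succ h ih =>
    have hN : nodeLeft w T ω h v N = nodeLeft w T ω' h v N := by
      unfold nodeLeft nodeUnif
      rw [hω _ le_rfl, nodeMax_congr_seed fun j hj => hω j (by omega),
        nodeMax_congr_seed fun j hj => hω j (by omega)]
    simp only [leafCount, hN]
    rw [ih fun j hj => hω j (by omega), ih fun j hj => hω j (by omega)]

theorem cost_congr_seed {w w' : ℕ → ℝ} {T : ℝ} {h v : ℕ} (hω : ∀ j, v + 3 ≤ j → ω j = ω' j)
    (N N' : ℕ) : cost w w' T ω h v N N' = cost w w' T ω' h v N N' :=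
  nodeSum_congr fun q _ => by rw [leafCount_congr_seed hω, leafCount_congr_seed hω]

/-- A heavy node ignores the priorities: its split uses a single seed entry and is therefore
independent of everything that happens below its children. -/
theorem nodeLeft_congr_seed {w : ℕ → ℝ} {T : ℝ} {h v : ℕ} (hbig : T < nodeSum w (h + 1) v)
    (hω : ω (v + 3) = ω' (v + 3)) (N : ℕ) : nodeLeft w T ω h v N = nodeLeft w T ω' h v N := by
  rw [nodeSum] at hbig
  unfold nodeLeft leftCount nodeUnif
  rw [hω, if_neg (not_le.2 hbig), if_neg (not_le.2 hbig)]

end SeedCongr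

/-- Averaging over a count `K` with two possible values that is independent of `Q`. -/
theorem expect_two_values {v M : ℕ} {K : Seed → ℕ} {Q : ℕ → Seed → ℝ}
    (hK : BddMeas fun ω => (K ω : ℝ)) (hQ : ∀ N, BddMeas (Q N))
    (hKv : ∀ ω ω' : Seed, ω v = ω' v → K ω = K ω')
    (hQv : ∀ N, ∀ ω ω' : Seed, (∀ j ≠ v, ω j = ω' j) → Q N ω = Q N ω')
    (hKM : ∀ ω, M ≤ K ω ∧ K ω ≤ M + 1) :
    BddMeas (fun ω => Q (K ω) ω) ∧ expect (fun ω => Q (K ω) ω) =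
      (expect (fun ω => (K ω : ℝ)) - M) * expect (Q (M + 1)) +
        (M + 1 - expect (fun ω => (K ω : ℝ))) * expect (Q M) := by
  -- On two consecutive values, evaluation at `K` is linear interpolation; by independence only the
  -- mean of `K` then enters.
  have h1 : ∀ ω, Q (K ω) ω = ((K ω : ℝ) - M) * Q (M + 1) ω + (M + 1 - (K ω : ℝ)) * Q M ω := by
    intro ω
    have : K ω = M ∨ K ω = M + 1 := by have := hKM ω; omega
    rcases this with h | h <;> rw [h] <;> push_cast <;> ring
  have h2 := hK.sub (BddMeas.const M)
  have h3 := (BddMeas.const (M + 1)).sub hK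
  simp only [h1]
  refine ⟨(h2.mul (hQ _)).add (h3.mul (hQ _)), ?_⟩
  rw [expect_add (h2.mul (hQ _)) (h3.mul (hQ _)), expect_mul {v} h2 (hQ _) ?_ ?_,
    expect_mul {v} h3 (hQ _) ?_ ?_, expect_sub hK (BddMeas.const _),
    expect_sub (BddMeas.const _) hK, expect_const, expect_const]
  · intro ω ω' h; rw [hKv ω ω' (h v rfl)]
  · intro ω ω' h; exact hQv _ _ _ fun j hj => h j hj
  · intro ω ω' h; rw [hKv ω ω' (h v rfl)]
  · intro ω ω' h; exact hQv _ _ _ fun j hj => h j hj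

/-! ### The exponential clocks -/

theorem nodeMax_lt {f : ℕ → ℝ} {h v : ℕ} {c : ℝ} (hf : ∀ q, q / 2 ^ h = v → f q < c) :
    nodeMax f h v < c := by
  induction h generalizing v with
  | zero => exact hf v (by simp)
  | succ h ih =>
    exact max_lt (ih fun q hq => hf q (below_left hq)) (ih fun q hq => hf q (below_right hq))

theorem le_nodeMax (f : ℕ → ℝ) {h v q : ℕ} (hq : q / 2 ^ h = v) : f q ≤ nodeMax f h v := by
  induction h generalizing v with
  | zero => rw [pow_zero, Nat.div_one] at hq; subst hq; rfl
  | succ h ih =>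
    rcases below_cases hq with h0 | h0
    · exact (ih h0).trans (le_max_left _ _)
    · exact (ih h0).trans (le_max_right _ _)

theorem winner_eq {w : ℕ → ℝ} {ω : Seed} {h v q : ℕ} (hq : q / 2 ^ h = v)
    (hlt : ∀ j, j / 2 ^ h = v → j ≠ q → priority w ω j < priority w ω q) :
    winner w ω h v = q := by
  induction h generalizing v with
  | zero => rw [pow_zero, Nat.div_one] at hq; exact hq.symm
  | succ h ih =>
    rw [winner]
    rcases below_cases hq with h0 | h0
    · have h1 : nodeMax (priority w ω) h (2 * v + 1) < priority w ω q :=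
        nodeMax_lt fun j hj => hlt j (below_right hj) (by rintro rfl; omega)
      rw [if_pos (h1.le.trans (le_nodeMax _ h0))]
      exact ih h0 fun j hj => hlt j (below_left hj)
    · have h1 : nodeMax (priority w ω) h (2 * v) < priority w ω q :=
        nodeMax_lt fun j hj => hlt j (below_left hj) (by rintro rfl; omega)
      rw [if_neg (not_le.2 (h1.trans_le (le_nodeMax _ h0)))]
      exact ih h0 fun j hj => hlt j (below_right hj)

theorem nodeSum_single (a : ℕ) (c : ℝ) (h v : ℕ) :
    nodeSum (fun q => if q = a then c else 0) h v = if a / 2 ^ h = v then c else 0 := by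
  have := nodeSum_update (fun _ => 0) (q := a) rfl c h v
  rw [nodeSum_zero, zero_add] at this
  rw [← this]
  congr 1
  ext q
  simp [Function.update_apply]

theorem le_nodeSum' {f : ℕ → ℝ} {q h v : ℕ} (hf : ∀ q, q / 2 ^ h = v → 0 ≤ f q)
    (hq : q / 2 ^ h = v) : f q ≤ nodeSum f h v := by
  have := nodeSum_single q (f q) h v
  rw [if_pos hq] at this
  rw [← this]
  refine nodeSum_mono fun j hj => ?_
  split_ifs with h0
  · rw [h0]
  · exact hf j hj

/-- The leaves below the node `v` of height `h`. -/
def leaves (h v : ℕ) : Finset ℕ := Finset.Ico (v * 2 ^ h) ((v + 1) * 2 ^ h)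

theorem mem_leaves {h v q : ℕ} : q ∈ leaves h v ↔ q / 2 ^ h = v := by
  rw [leaves, Finset.mem_Ico, Nat.div_eq_iff (by positivity), add_mul, one_mul]
  have : 0 < 2 ^ h := by positivity
  omega

theorem nodeSum_eq_sum_leaves (f : ℕ → ℝ) (h v : ℕ) : nodeSum f h v = ∑ q ∈ leaves h v, f q := by
  rw [nodeSum_eq_sum, leaves, Finset.sum_Ico_eq_sum_range]
  congr 2
  rw [add_mul, one_mul, Nat.add_sub_cancel_left]

theorem volume_unitInterval_Ioo {c : ℝ} (h0 : 0 ≤ c) (h1 : c ≤ 1) :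
    (volume : Measure unitInterval) {t | 0 < (t : ℝ) ∧ (t : ℝ) < c} = ENNReal.ofReal c := by
  have := unitInterval.volume_Ioo 0 ⟨c, h0, h1⟩
  rw [show ((⟨c, h0, h1⟩ : unitInterval) : ℝ) - ((0 : unitInterval) : ℝ) = c by simp] at this
  rw [← this]
  rfl

/-- The comparison of priorities, rewritten for the underlying uniforms: once the uniform of `q` is
fixed at `x`, a competitor `j` loses if its own uniform is below `x ^ (w j / w q)`, an event whose
probability is that power. -/
theorem priority_lt {w : ℕ → ℝ} {ω : Seed} {j q : ℕ} (hq : 0 < w q) (hj : 0 ≤ w j)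
    (h0 : 0 < (ω (q + 3) : ℝ)) (h1 : (ω (q + 3) : ℝ) < 1) (h2 : 0 < (ω (j + 3) : ℝ))
    (h3 : (ω (j + 3) : ℝ) < (ω (q + 3) : ℝ) ^ (w j / w q)) :
    priority w ω j < priority w ω q := by
  have h4 : (ω (j + 3) : ℝ) < 1 :=
    h3.trans_le (Real.rpow_le_one h0.le h1.le (div_nonneg hj hq.le))
  have h5 := Real.log_neg h0 h1
  have h6 := Real.log_neg h2 h4
  have h7 := Real.log_lt_log h2 h3
  rw [Real.log_rpow h0] at h7
  unfold priority clock
  rw [if_pos (by linarith), if_pos (by linarith), div_lt_div_iff₀ (by linarith) (by linarith)]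
  have h8 : w q * Real.log (ω (j + 3)) < w q * (w j / w q * Real.log (ω (q + 3))) :=
    mul_lt_mul_of_pos_left h7 hq
  rw [← mul_assoc, mul_div_cancel₀ _ hq.ne'] at h8
  linarith

/-- Given that the uniform of `q` is `x`, all competitors lose with probability `x ^ a`, the product
of the individual powers, and the integral of `x ^ a` is `1 / (a + 1) = w q / nodeSum w h v`. Ties
and boundary values are discarded, so this is only a lower bound; `expect_winner` upgrades it. -/
theorem le_expect_winner {w : ℕ → ℝ} (hw : ∀ q, 0 ≤ w q) {h v q : ℕ} (hq : q / 2 ^ h = v)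
    (hpos : 0 < w q) :
    w q / nodeSum w h v ≤ expect fun ω => if q = winner w ω h v then 1 else 0 := by
  classical
  set a : ℝ := (nodeSum w h v - w q) / w q with ha
  have hsq := le_nodeSum hw hq
  have ha0 : 0 ≤ a := div_nonneg (by linarith) hpos.le
  set g : ℝ → ℝ := fun x => if 0 < x ∧ x < 1 then x ^ a else 0 with hg
  have hgm : Measurable g := Measurable.ite (measurableSet_Ioo) (by fun_prop) measurable_const
  have hgb : ∀ x, |g x| ≤ 1 := by
    intro x
    simp only [hg]
    split_ifs with h0
    · rw [abs_of_nonneg (Real.rpow_nonneg h0.1.le _)]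
      exact Real.rpow_le_one h0.1.le h0.2.le ha0
    · simp
  have h1 : expect (fun ω => g (ω (q + 3))) = w q / nodeSum w h v := by
    rw [expect_coord (q + 3) hgm, intervalIntegral.integral_congr_Ioo_of_le (g := fun x => x ^ a)
      zero_le_one (fun x hx => by simp only [hg]; exact if_pos hx),
      integral_rpow (Or.inl (by linarith)), Real.one_rpow, Real.zero_rpow (by linarith), sub_zero,
      show a + 1 = nodeSum w h v / w q by rw [ha]; field_simp; ring, one_div_div]
  have hF := bddMeas_winner w h v q
  rw [← h1, expect_merge {q + 3} hF]
  refine expect_mono ⟨hgm.comp (by fun_prop), 1, fun ω => hgb _⟩ (hF.merge_left _) fun ω' => ?_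
  by_cases hx : 0 < (ω' (q + 3) : ℝ) ∧ (ω' (q + 3) : ℝ) < 1
  swap
  · simp only [hg]
    rw [if_neg hx]
    exact expect_nonneg fun ω => by split_ifs <;> norm_num
  set x : ℝ := (ω' (q + 3) : ℝ)
  set L := (leaves h v).erase q
  -- Indexed by seed entries, not by leaves; entry `i` belongs to leaf `i - 3`.
  set t : ℕ → Set unitInterval := fun i => {u | 0 < (u : ℝ) ∧ (u : ℝ) < x ^ (w (i - 3) / w q)}
  have ht : ∀ i, MeasurableSet (t i) := fun i =>
    (measurableSet_lt measurable_const measurable_subtype_coe).inter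
      (measurableSet_lt measurable_subtype_coe measurable_const)
  set B : Set Seed := Set.pi (L.map (addRightEmbedding 3) : Finset ℕ) t
  have hB : MeasurableSet B := MeasurableSet.pi (Finset.countable_toSet _) fun i _ => ht i
  have hvol : seedMeasure B = ENNReal.ofReal (x ^ a) := by
    have hr : ∀ j, 0 ≤ w j / w q := fun j => div_nonneg (hw j) hpos.le
    unfold seedMeasure
    have hv : ∀ j, volume (t (addRightEmbedding 3 j)) = ENNReal.ofReal (x ^ (w j / w q)) :=
      fun j => volume_unitInterval_Ioo (c := x ^ (w j / w q))
        (Real.rpow_nonneg hx.1.le _) (Real.rpow_le_one hx.1.le hx.2.le (hr j))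
    rw [Measure.infinitePi_pi _ fun i _ => ht i, Finset.prod_map,
      Finset.prod_congr rfl fun j _ => hv j,
      ← ENNReal.ofReal_prod_of_nonneg fun j _ => Real.rpow_nonneg hx.1.le _,
      ← Real.rpow_sum_of_pos hx.1, ← Finset.sum_div]
    congr 3
    rw [nodeSum_eq_sum_leaves, ← Finset.sum_erase_add _ _ (mem_leaves.2 hq), add_sub_cancel_right]
  have h2 : expect (fun ω => if ω ∈ B then 1 else 0) = x ^ a := by
    have : (fun ω => if ω ∈ B then (1 : ℝ) else 0) = B.indicator 1 := by
      ext ω; simp [Set.indicator_apply]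
    rw [this, expect, integral_indicator_one hB, measureReal_def, hvol,
      ENNReal.toReal_ofReal (Real.rpow_nonneg hx.1.le _)]
  have h3 : g x = x ^ a := if_pos hx
  change g x ≤ _
  rw [h3, ← h2]
  refine expect_mono (BddMeas.indicator hB) (hF.comp_merge _ _) fun ω => ?_
  by_cases hω : ω ∈ B
  · rw [if_pos hω, if_pos]
    refine (winner_eq hq fun j hj hjq => ?_).symm
    have e1 : mergeSeed {q + 3} ω' ω (q + 3) = ω' (q + 3) := mergeSeed_of_mem _ _ rfl
    have e2 : mergeSeed {q + 3} ω' ω (j + 3) = ω (j + 3) :=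
      mergeSeed_of_notMem _ _ (by simpa using hjq)
    have e3 := hω (j + 3) (by simpa [L] using ⟨mem_leaves.2 hj, hjq⟩)
    simp only [t, Set.mem_ofPred_eq, Nat.add_sub_cancel] at e3
    apply priority_lt hpos (hw j)
    · rw [e1]; exact hx.1
    · rw [e1]; exact hx.2
    · rw [e2]; exact e3.1
    · rw [e1, e2]; exact e3.2
  · rw [if_neg hω]; split_ifs <;> norm_num

/-- The clocks select each leaf with probability proportional to its weight. -/
theorem expect_winner {w : ℕ → ℝ} (hw : ∀ q, 0 ≤ w q) {h v q : ℕ} (hq : q / 2 ^ h = v)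
    (hs : 0 < nodeSum w h v) :
    (expect fun ω => if q = winner w ω h v then 1 else 0) = w q / nodeSum w h v := by
  set f : ℕ → ℝ := fun q => expect fun ω => if q = winner w ω h v then 1 else 0
  have h1 : nodeSum f h v = 1 := by
    rw [← expect_nodeSum (fun q => bddMeas_winner w h v q)]
    refine Eq.trans (congrArg expect (funext fun ω => ?_)) (expect_const 1)
    have := nodeSum_single (winner w ω h v) 1 h v
    rw [if_pos (winner_below w ω h v)] at this
    exact this
  -- The winning probabilities and the claimed values both sum to one, so nonnegative differences
  -- must all vanish.
  have h2 : ∀ q, q / 2 ^ h = v → 0 ≤ f q + -1 * (w q / nodeSum w h v) := by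
    intro q hq
    rcases (hw q).eq_or_lt with h0 | h0
    · rw [← h0, zero_div, mul_zero, add_zero]
      exact expect_nonneg fun ω => by split_ifs <;> norm_num
    · have := le_expect_winner hw hq h0
      simp only [f]; linarith
  have h3 : nodeSum (fun q => f q + -1 * (w q / nodeSum w h v)) h v = 0 := by
    rw [nodeSum_add, nodeSum_mul, h1]
    have : nodeSum (fun q => w q / nodeSum w h v) h v = 1 := by
      simp only [div_eq_inv_mul]
      rw [nodeSum_mul, inv_mul_cancel₀ hs.ne']
    rw [this]; ring
  have h4 := le_nodeSum' h2 hq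
  have h5 := h2 q hq
  simp only [f] at h3 h4 h5
  linarith

end CorrelatedSampling

namespace CorrelatedSampling

/-! ### Marginals -/

/-- Supplies the two possible values required by `expect_two_values`. Admissibility would not
suffice: `N = m + 1` is allowed even when the weight is exactly `m`, a case that enters the mixtures
with coefficient zero. -/
theorem nodeLeft_range {w : ℕ → ℝ} (hw : ∀ q, 0 ≤ w q) {T : ℝ} (ω : Seed) {h v m N : ℕ}
    (hbig : T < nodeSum w (h + 1) v) (hm : m ≤ nodeSum w (h + 1) v)
    (hm' : nodeSum w (h + 1) v < m + 1) (hN : N = m ∨ N = m + 1) :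
    (⌊nodeSum w h (2 * v)⌋₊ ≤ nodeLeft w T ω h v N ∧
      nodeLeft w T ω h v N ≤ ⌊nodeSum w h (2 * v)⌋₊ + 1) ∧
    (⌊nodeSum w h (2 * v + 1)⌋₊ ≤ N - nodeLeft w T ω h v N ∧
      N - nodeLeft w T ω h v N ≤ ⌊nodeSum w h (2 * v + 1)⌋₊ + 1) := by
  have h2 : ∀ v, 0 ≤ nodeSum w h v := fun v => nodeSum_nonneg hw
  obtain ⟨h3, h4⟩ := nodeUnif_mem ω v
  have hl := h2 (2 * v)
  have hr := h2 (2 * v + 1)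
  rw [nodeSum] at hbig hm hm'
  unfold nodeLeft
  set sl := nodeSum w h (2 * v)
  set sr := nodeSum w h (2 * v + 1)
  have hd : |(N : ℝ) - (sl + sr)| ≤ 1 := by
    rw [abs_le]; rcases hN with rfl | rfl <;> push_cast <;> constructor <;> linarith
  have hd1 : -1 < (N : ℝ) - (sl + sr) := by
    rcases hN with rfl | rfl <;> push_cast <;> linarith
  have hle := leftCount_le T (nodeUnif ω v) sl sr (nodeMax (priority w ω) h (2 * v))
    (nodeMax (priority w ω) h (2 * v + 1)) N
  rw [leftCount_big h3 hr hd hbig] at hle ⊢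
  have a1 := splitPoint_le (sl := sl) (sr := sr) h3 hd
  have a2 := lt_splitPoint (sl := sl) (sr := sr) h4 hd1 (abs_le.1 hd).2
  have a3 := splitPoint_le' (sl := sl) (sr := sr) h3 hd
  have a4 := le_splitPoint' (sl := sl) (sr := sr) h4.le hd
  set x := splitPoint (nodeUnif ω v) sl sr N
  have a5 : (⌈x⌉₊ : ℝ) < x + 1 := Nat.ceil_lt_add_one_of_gt_neg_one (by linarith)
  have a6 := Nat.le_ceil x
  have b1 := Nat.floor_le hl
  have b2 := Nat.lt_floor_add_one sl
  have b3 := Nat.floor_le hr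
  have b4 := Nat.lt_floor_add_one sr
  refine ⟨⟨?_, ?_⟩, ?_, ?_⟩
  · exact Nat.lt_succ_iff.1 (by exact_mod_cast (show (⌊sl⌋₊ : ℝ) < (⌈x⌉₊ + 1 : ℕ) by
      push_cast; linarith))
  · exact Nat.ceil_le.2 (by push_cast; linarith)
  · exact Nat.lt_succ_iff.1 (by exact_mod_cast (show (⌊sr⌋₊ : ℝ) < (N - ⌈x⌉₊ + 1 : ℕ) by
      push_cast [Nat.cast_sub hle]; linarith))
  · exact Nat.lt_succ_iff.1 (by exact_mod_cast
      (show ((N - ⌈x⌉₊ : ℕ) : ℝ) < (⌊sr⌋₊ + 1 + 1 : ℕ) by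
        push_cast [Nat.cast_sub hle]; linarith))

theorem nodeLeft_le (w : ℕ → ℝ) (T : ℝ) (ω : Seed) (h v N : ℕ) : nodeLeft w T ω h v N ≤ N :=
  leftCount_le ..

theorem bddMeas_sub_nodeLeft (w : ℕ → ℝ) (T : ℝ) (h v N : ℕ) :
    BddMeas fun ω => ((N - nodeLeft w T ω h v N : ℕ) : ℝ) := by
  simp only [Nat.cast_sub (nodeLeft_le w T _ h v N)]
  exact (BddMeas.const N).sub (bddMeas_nodeLeft w T h v N)

theorem expect_sub_nodeLeft (w : ℕ → ℝ) (T : ℝ) (h v N : ℕ) :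
    expect (fun ω => ((N - nodeLeft w T ω h v N : ℕ) : ℝ)) =
      N - expect (fun ω => (nodeLeft w T ω h v N : ℝ)) := by
  simp only [Nat.cast_sub (nodeLeft_le w T _ h v N)]
  rw [expect_sub (BddMeas.const _) (bddMeas_nodeLeft w T h v N), expect_const]

theorem agree_above {v c : ℕ} (hc : v < c) {ω ω' : Seed} (h : ∀ j ≠ v + 3, ω j = ω' j) :
    ∀ j, c + 3 ≤ j → ω j = ω' j := fun j hj => h j (by omega)

/-- A heavy node turns an unbiased count into unbiased counts of its children, independently of the
randomness below them. A light node has a unit with probability equal to its weight `s` and passes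
it to leaf `q` with probability `w q / s`. The hypothesis `1 ≤ v` makes the children have larger
numbers than `v`, as independence requires. -/
theorem expect_leafCount {w : ℕ → ℝ} (hw : ∀ q, 0 ≤ w q) {T : ℝ} (hT : T < 1) {h v m q : ℕ}
    (hv : 1 ≤ v) (hm : m ≤ nodeSum w h v) (hm' : nodeSum w h v < m + 1) (hq : q / 2 ^ h = v) :
    (nodeSum w h v - m) * expect (fun ω => (leafCount w T ω h v (m + 1) q : ℝ)) +
      (m + 1 - nodeSum w h v) * expect (fun ω => (leafCount w T ω h v m q : ℝ)) = w q := by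
  induction h generalizing v m with
  | zero =>
    rw [pow_zero, Nat.div_one] at hq
    subst hq
    simp only [leafCount, expect_const, nodeSum]
    push_cast; ring
  | succ h ih =>
    rcases le_or_gt (nodeSum w (h + 1) v) T with hs | hbig
    · have : m = 0 := Nat.lt_one_iff.1 (by exact_mod_cast (show (m : ℝ) < 1 by linarith))
      subst this
      have e1 : ∀ ω, (leafCount w T ω (h + 1) v (0 + 1) q : ℝ) =
          if q = winner w ω (h + 1) v then 1 else 0 := fun ω => by
        rw [leafCount_small hw ω hs hq]; split_ifs <;> simp
      simp only [e1, leafCount_zero]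
      rcases (nodeSum_nonneg (h := h + 1) (v := v) hw).eq_or_lt with h0 | h0
      · have := le_nodeSum hw hq
        have := hw q
        rw [← h0, expect_const]; push_cast; linarith
      · rw [expect_winner hw hq h0, expect_const]
        push_cast; field_simp; ring
    · have hE := expect_nodeLeft hw hbig hm hm'.le
      have hr1 := fun ω => nodeLeft_range hw ω hbig hm hm' (Or.inr rfl)
      have hr0 := fun ω => nodeLeft_range hw ω hbig hm hm' (Or.inl rfl)
      have hf : ∀ v, (⌊nodeSum w h v⌋₊ : ℝ) ≤ nodeSum w h v := fun v =>
        Nat.floor_le (nodeSum_nonneg hw)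
      have hf' : ∀ v, nodeSum w h v < (⌊nodeSum w h v⌋₊ : ℝ) + 1 := fun v =>
        Nat.lt_floor_add_one _
      rcases below_cases hq with h0 | h0
      · have IH := ih (v := 2 * v) (by omega) (hf _) (hf' _) h0
        have k := fun N (hr : ∀ ω, ⌊nodeSum w h (2 * v)⌋₊ ≤ nodeLeft w T ω h v N ∧ _) =>
          (expect_two_values (v := v + 3)
          (Q := fun N ω => (leafCount w T ω h (2 * v) N q : ℝ)) (bddMeas_nodeLeft w T h v N)
          (fun N => bddMeas_leafCount w T h (2 * v) N q)
          (fun ω ω' e => nodeLeft_congr_seed hbig e N)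
          (fun N ω ω' e => by
            simp only [leafCount_congr_seed (agree_above (show v < 2 * v by omega) e)]) hr).2
        have e1 := k (m + 1) fun ω => (hr1 ω).1
        have e0 := k m fun ω => (hr0 ω).1
        simp only [leafCount, h0, if_true]
        rw [e1, e0]
        -- Both mixtures are affine in the mean count of the child with the same slope, the
        -- difference of the two conditional expectations; `hE` evaluates the mixed mean.
        linear_combination (expect (fun ω => (leafCount w T ω h (2 * v)
          (⌊nodeSum w h (2 * v)⌋₊ + 1) q : ℝ)) - expect (fun ω => (leafCount w T ω h (2 * v)
          ⌊nodeSum w h (2 * v)⌋₊ q : ℝ))) * hE + IH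
      · have hne : ¬ (2 * v + 1 = 2 * v) := by omega
        have IH := ih (v := 2 * v + 1) (by omega) (hf _) (hf' _) h0
        have k := fun N (hr : ∀ ω, ⌊nodeSum w h (2 * v + 1)⌋₊ ≤ N - nodeLeft w T ω h v N ∧ _) =>
          (expect_two_values (v := v + 3)
          (Q := fun N ω => (leafCount w T ω h (2 * v + 1) N q : ℝ)) (bddMeas_sub_nodeLeft w T h v N)
          (fun N => bddMeas_leafCount w T h (2 * v + 1) N q)
          (fun ω ω' e => by rw [nodeLeft_congr_seed hbig e N])
          (fun N ω ω' e => by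
            simp only [leafCount_congr_seed (agree_above (show v < 2 * v + 1 by omega) e)]) hr).2
        have e1 := k (m + 1) fun ω => (hr1 ω).2
        have e0 := k m fun ω => (hr0 ω).2
        simp only [expect_sub_nodeLeft] at e1 e0
        simp only [leafCount, h0, hne, if_false]
        rw [e1, e0]
        have hs : nodeSum w (h + 1) v = nodeSum w h (2 * v) + nodeSum w h (2 * v + 1) := rfl
        push_cast
        linear_combination (-1) * (expect (fun ω => (leafCount w T ω h (2 * v + 1)
          (⌊nodeSum w h (2 * v + 1)⌋₊ + 1) q : ℝ)) - expect (fun ω => (leafCount w T ω h (2 * v + 1)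
          ⌊nodeSum w h (2 * v + 1)⌋₊ q : ℝ))) * hE + IH + (expect (fun ω =>
          (leafCount w T ω h (2 * v + 1) (⌊nodeSum w h (2 * v + 1)⌋₊ + 1) q : ℝ)) -
          expect (fun ω => (leafCount w T ω h (2 * v + 1)
          ⌊nodeSum w h (2 * v + 1)⌋₊ q : ℝ))) * hs

/-! ### Changing the weight of one leaf -/

/-- If all other leaves have weight zero, a leaf receives the count of the node. -/
theorem leafCount_alone {w : ℕ → ℝ} (hw : ∀ q, 0 ≤ w q) {T : ℝ} (ω : Seed)
    {h v N i : ℕ} (hi : i / 2 ^ h = v) (h0 : ∀ q, q / 2 ^ h = v → q ≠ i → w q = 0)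
    (hN : (-1 : ℝ) ≤ N - w i) (hN' : N - w i < 1) {q : ℕ} (hq : q / 2 ^ h = v) :
    leafCount w T ω h v N q = if q = i then N else 0 := by
  induction h generalizing v with
  | zero => rw [pow_zero, Nat.div_one] at hi hq; rw [if_pos (hq.trans hi.symm)]; rfl
  | succ h ih =>
    obtain ⟨h3, h4⟩ := nodeUnif_mem ω v
    have hd : |(N : ℝ) - w i| ≤ 1 := abs_le.2 ⟨hN, hN'.le⟩
    have alone : ∀ c, i / 2 ^ h = c → (∀ q, q / 2 ^ h = c → q ≠ i → w q = 0) →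
        nodeSum w h c = w i := by
      intro c hc hz
      rw [nodeSum_congr (g := fun q => if q = i then w i else 0), nodeSum_single, if_pos hc]
      intro q hq
      split_ifs with e
      · rw [e]
      · exact hz q hq e
    have none : ∀ c, i / 2 ^ h ≠ c → (∀ q, q / 2 ^ h = c → q ≠ i → w q = 0) →
        nodeSum w h c = 0 := by
      intro c hc hz
      rw [nodeSum_congr (g := fun _ => 0), nodeSum_zero]
      exact fun q hq => hz q hq (by rintro rfl; exact hc hq)
    have hz1 : ∀ q, q / 2 ^ h = 2 * v → q ≠ i → w q = 0 := fun q hq => h0 q (below_left hq)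
    have hz2 : ∀ q, q / 2 ^ h = 2 * v + 1 → q ≠ i → w q = 0 := fun q hq => h0 q (below_right hq)
    have hne : ¬ (2 * v + 1 = 2 * v) := by omega
    rcases below_cases hi with hi' | hi'
    · have s1 := alone _ hi' hz1
      have s2 := none (2 * v + 1) (by omega) hz2
      have hl : nodeLeft w T ω h v N = N := by
        unfold nodeLeft
        rcases le_or_gt (nodeSum w h (2 * v) + nodeSum w h (2 * v + 1)) T with hs | hs
        · rw [leftCount, if_pos hs, if_pos]
          have := (nodeMax_pos_iff hw ω h (2 * v + 1)).not.2 (by rw [s2]; exact lt_irrefl _)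
          exact (not_lt.1 this).trans (nodeMax_nonneg (priority_nonneg hw ω) _ _)
        · have hd' : |(N : ℝ) - (nodeSum w h (2 * v) + nodeSum w h (2 * v + 1))| ≤ 1 := by
            rw [s1, s2, add_zero]; exact hd
          rw [leftCount_big h3 s2.ge hd' hs]
          apply le_antisymm
          · refine Nat.ceil_le.2 ((splitPoint_le' h3 hd').trans (by rw [s2, sub_zero]))
          · have := lt_splitPoint' (sl := nodeSum w h (2 * v)) (sr := nodeSum w h (2 * v + 1)) h4
              (N := N) (by rw [s1, s2, add_zero]; exact hN) (by rw [s1, s2, add_zero]; exact hN')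
            have h5 := Nat.le_ceil (splitPoint (nodeUnif ω v) (nodeSum w h (2 * v))
              (nodeSum w h (2 * v + 1)) N)
            rw [s2, sub_zero] at this
            rw [s2] at h5 ⊢
            have h6 : (N : ℝ) < (⌈splitPoint (nodeUnif ω v) (nodeSum w h (2 * v)) 0 N⌉₊ + 1 :
                ℕ) := by
              push_cast; linarith
            exact Nat.lt_succ_iff.1 (by exact_mod_cast h6)
      rcases below_cases hq with hq' | hq'
      · simp only [leafCount, hq', if_true, hl]
        exact ih hi' hz1 hq'
      · simp only [leafCount, hq', hne, if_false, hl, Nat.sub_self]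
        rw [leafCount_zero, if_neg]
        rintro rfl; omega
    · have s1 := none (2 * v) (by omega) hz1
      have s2 := alone _ hi' hz2
      have hl : nodeLeft w T ω h v N = 0 := by
        unfold nodeLeft
        rcases le_or_gt (nodeSum w h (2 * v) + nodeSum w h (2 * v + 1)) T with hs | hs
        · rw [leftCount, if_pos hs]
          split_ifs with hm
          · by_contra hN0
            have : (1 : ℝ) ≤ N := by exact_mod_cast Nat.one_le_iff_ne_zero.2 hN0
            have := (nodeMax_pos_iff hw ω h (2 * v + 1)).2 (by rw [s2]; linarith)
            have := (nodeMax_pos_iff hw ω h (2 * v)).1 (this.trans_le hm)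
            linarith
          · rfl
        · have hd' : |(N : ℝ) - (nodeSum w h (2 * v) + nodeSum w h (2 * v + 1))| ≤ 1 := by
            rw [s1, s2, zero_add]; exact hd
          rw [leftCount_big h3 (s2 ▸ hw i) hd' hs]
          exact Nat.ceil_eq_zero.2 ((splitPoint_le h3 hd').trans s1.le)
      rcases below_cases hq with hq' | hq'
      · simp only [leafCount, hq', if_true, hl]
        rw [leafCount_zero, if_neg]
        rintro rfl; omega
      · simp only [leafCount, hq', hne, if_false, hl, Nat.sub_zero]
        exact ih hi' hz2 hq'

theorem cost_zero (w w' : ℕ → ℝ) (T : ℝ) (ω : Seed) (h v : ℕ) : cost w w' T ω h v 0 0 = 0 := by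
  simp [cost, leafCount_zero, nodeSum_zero]

theorem cost_le_add {w w' : ℕ → ℝ} (hw : ∀ q, 0 ≤ w q) (hw' : ∀ q, 0 ≤ w' q) {T : ℝ} (hT : T < 1)
    (ω : Seed) {h v N N' : ℕ} (hN : Admissible (nodeSum w h v) N)
    (hN' : Admissible (nodeSum w' h v) N') : cost w w' T ω h v N N' ≤ N + N' := by
  rw [← nodeSum_leafCount hw hT ω hN, ← nodeSum_leafCount hw' hT ω hN', ← nodeSum_add, cost]
  exact nodeSum_mono fun q _ => (abs_sub _ _).trans (by simp)

/-- The change of the winner when the weight of leaf `i` increases. -/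
theorem cost_small {w w' : ℕ → ℝ} (hw : ∀ q, 0 ≤ w q) (hw' : ∀ q, 0 ≤ w' q) {i : ℕ}
    (hi : w i ≤ w' i) (hne : ∀ q, q ≠ i → w q = w' q) {T : ℝ} (ω : Seed) {h v : ℕ}
    (hs : nodeSum w h v ≤ T) (hs' : nodeSum w' h v ≤ T) :
    cost w w' T ω h v 1 1 ≤ 2 * ((if i = winner w' ω h v then 1 else 0) -
      (if i = winner w ω h v then 1 else 0)) := by
  have e : cost w w' T ω h v 1 1 = nodeSum (fun q => |(if q = winner w ω h v then (1 : ℝ) else 0) -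
      (if q = winner w' ω h v then 1 else 0)|) h v :=
    nodeSum_congr fun q hq => by
      rw [leafCount_small hw ω hs hq, leafCount_small hw' ω hs' hq]
      push_cast; rfl
  rw [e]
  rcases winner_mono hi hne ω h v with ⟨_, h1⟩ | ⟨_, h1⟩
  · simp [h1, nodeSum_zero]
  · rw [h1, if_pos rfl]
    by_cases h2 : i = winner w ω h v
    · simp [← h2, nodeSum_zero]
    · rw [if_neg h2]
      calc _ ≤ nodeSum (fun q => (if q = winner w ω h v then (1 : ℝ) else 0) +
              (if q = i then 1 else 0)) h v :=
            nodeSum_mono fun q _ => by split_ifs <;> norm_num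
        _ ≤ 2 * (1 - 0) := by
            rw [nodeSum_add, nodeSum_single, nodeSum_single]
            split_ifs <;> norm_num

end CorrelatedSampling

namespace CorrelatedSampling

/-- Pointwise, one more unit raises the left count by zero or one. The bounds control the error made
in `cost_mixture_le` by mixing the new counts with the old coefficients. -/
theorem expect_nodeLeft_mono {w : ℕ → ℝ} (hw : ∀ q, 0 ≤ w q) {T : ℝ} (hT : T < 1) {h v m : ℕ}
    (hm : m ≤ nodeSum w (h + 1) v) (hm' : nodeSum w (h + 1) v ≤ m + 1) :
    expect (fun ω => (nodeLeft w T ω h v m : ℝ)) ≤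
      expect (fun ω => (nodeLeft w T ω h v (m + 1) : ℝ)) ∧
    expect (fun ω => (nodeLeft w T ω h v (m + 1) : ℝ)) ≤
      expect (fun ω => (nodeLeft w T ω h v m : ℝ)) + 1 := by
  have h2 : ∀ v, 0 ≤ nodeSum w h v := fun v => nodeSum_nonneg hw
  have key : ∀ ω, nodeLeft w T ω h v m ≤ nodeLeft w T ω h v (m + 1) ∧
      nodeLeft w T ω h v (m + 1) ≤ nodeLeft w T ω h v m + 1 := by
    intro ω
    obtain ⟨h3, h4⟩ := nodeUnif_mem ω v
    rcases leftCount_succ (rl := nodeMax (priority w ω) h (2 * v))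
      (rr := nodeMax (priority w ω) h (2 * v + 1)) hT h3 h4.le (h2 _) (h2 _) hm hm' with
      ⟨a, _⟩ | ⟨a, _⟩
    · exact ⟨(Nat.le_succ _).trans a.ge, a.le⟩
    · exact ⟨a.ge, a.le.trans (Nat.le_succ _)⟩
  have b := bddMeas_nodeLeft w T h v
  refine ⟨expect_mono (b m) (b (m + 1)) fun ω => by exact_mod_cast (key ω).1, ?_⟩
  refine (expect_mono (b (m + 1)) ((b m).add (BddMeas.const 1)) fun ω => by
    exact_mod_cast (key ω).2).trans ?_
  rw [expect_add (b m) (BddMeas.const 1), expect_const]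

/-- The contribution of a node to the bound on the expected cost, when its weight changes
from `s` to `s'`. -/
noncomputable def nodeCharge (T s s' : ℝ) : ℝ :=
  2 * (s' - s) + 2 * if s ≤ T ∧ T < s' then 1 else 0

theorem nodeCharge_nonneg {T s s' : ℝ} (h : s ≤ s') : 0 ≤ nodeCharge T s s' := by
  unfold nodeCharge; split_ifs <;> linarith

theorem agree_update (w : ℕ → ℝ) {i : ℕ} (t t' : ℝ) {h c : ℕ} (hc : i / 2 ^ h ≠ c) :
    ∀ q, q / 2 ^ h = c → Function.update w i t q = Function.update w i t' q := by
  rintro q hq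
  have : q ≠ i := by rintro rfl; exact hc hq
  simp [this]

theorem update_nonneg {w : ℕ → ℝ} (hw : ∀ q, 0 ≤ w q) (i : ℕ) {t : ℝ} (ht : 0 ≤ t) :
    ∀ q, 0 ≤ Function.update w i t q := by
  intro q
  rw [Function.update_apply]
  split_ifs <;> [exact ht; exact hw q]

section Path

variable {w : ℕ → ℝ} {i : ℕ} {t t' T : ℝ}

theorem nodeSum_path (hi : w i = 0) (t : ℝ) (g : ℕ) :
    nodeSum (Function.update w i t) g (i / 2 ^ g) = nodeSum w g (i / 2 ^ g) + t := by
  rw [nodeSum_update w hi, if_pos rfl]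

/-- A leaf that carries all the weight below a node takes the whole count, whatever its weight is.
This is why a node without other weight needs no charge, even when it is heavy. -/
theorem cost_alone (hw : ∀ q, 0 ≤ w q) (ht : 0 ≤ t) (ht' : 0 ≤ t') (ω : Seed)
    {h N : ℕ} (h0 : nodeSum w h (i / 2 ^ h) = 0) (hN : (-1 : ℝ) ≤ N - t) (hN1 : N - t < 1)
    (hN' : (-1 : ℝ) ≤ N - t') (hN1' : N - t' < 1) :
    cost (Function.update w i t) (Function.update w i t') T ω h (i / 2 ^ h) N N = 0 := by
  have hz : ∀ s, ∀ q, q / 2 ^ h = i / 2 ^ h → q ≠ i → Function.update w i s q = 0 := by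
    intro s q hq hqi
    rw [Function.update_of_ne hqi]
    exact le_antisymm (h0 ▸ le_nodeSum hw hq) (hw q)
  rw [cost, ← nodeSum_zero h (i / 2 ^ h)]
  refine nodeSum_congr fun q hq => ?_
  rw [leafCount_alone (update_nonneg hw i ht) ω rfl (hz t) (by simpa using hN) (by simpa using hN1)
    hq, leafCount_alone (update_nonneg hw i ht') ω rfl (hz t') (by simpa using hN')
    (by simpa using hN1') hq, sub_self, abs_zero]

/-- The expected cost below a node on the path from a leaf to the root, when the weight of that
leaf increases and no weight on the path crosses an integer. -/
theorem cost_mixture_le (hw : ∀ q, 0 ≤ w q) (hi : w i = 0) (ht : 0 ≤ t) (htt : t < t')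
    (hT : T < 1) {b : ℕ → ℝ} (hb : ∀ g, 0 ≤ b g) {H : ℕ}
    (hb1 : ∀ g, g ≤ H → 0 < nodeSum w g (i / 2 ^ g) → T < nodeSum w g (i / 2 ^ g) + t' → 1 ≤ b g)
    {m : ℕ → ℕ} (hm : ∀ g, g ≤ H → (m g : ℝ) ≤ nodeSum w g (i / 2 ^ g) + t ∧
      nodeSum w g (i / 2 ^ g) + t' ≤ m g + 1) {h : ℕ} (hh : h ≤ H) (hv : 1 ≤ i / 2 ^ h) :
    (nodeSum w h (i / 2 ^ h) + t - m h) * expect (fun ω => cost (Function.update w i t)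
        (Function.update w i t') T ω h (i / 2 ^ h) (m h + 1) (m h + 1)) +
      (m h + 1 - (nodeSum w h (i / 2 ^ h) + t)) * expect (fun ω => cost (Function.update w i t)
        (Function.update w i t') T ω h (i / 2 ^ h) (m h) (m h)) ≤
    ∑ g ∈ Finset.range h, b (g + 1) * nodeCharge T (nodeSum w (g + 1) (i / 2 ^ (g + 1)) + t)
      (nodeSum w (g + 1) (i / 2 ^ (g + 1)) + t') + 2 * (t' - t) := by
  have ht' : 0 ≤ t' := ht.trans htt.le
  have hW := update_nonneg hw i ht
  have hW' := update_nonneg hw i ht'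
  have hWW : Function.update w i t i ≤ Function.update w i t' i := by simpa using htt.le
  have hne : ∀ q, q ≠ i → Function.update w i t q = Function.update w i t' q := fun q hq => by
    simp [hq]
  have hch : ∀ g : ℕ, 0 ≤ b (g + 1) * nodeCharge T (nodeSum w (g + 1) (i / 2 ^ (g + 1)) + t)
      (nodeSum w (g + 1) (i / 2 ^ (g + 1)) + t') := fun g =>
    mul_nonneg (hb _) (nodeCharge_nonneg (by linarith))
  induction h with
  | zero =>
    have : ∀ ω N, cost (Function.update w i t) (Function.update w i t') T ω 0 (i / 2 ^ 0) N N = 0 :=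
      fun ω N => by simp [cost, nodeSum, leafCount]
    simp only [this, expect_const]
    simp; exact htt.le
  | succ h ih =>
    have hsum : 0 ≤ ∑ g ∈ Finset.range h, b (g + 1) *
        nodeCharge T (nodeSum w (g + 1) (i / 2 ^ (g + 1)) + t)
        (nodeSum w (g + 1) (i / 2 ^ (g + 1)) + t') := Finset.sum_nonneg fun g _ => hch g
    rw [Finset.sum_range_succ]
    have hpos := hch h
    obtain ⟨m1, m2⟩ := hm (h + 1) hh
    have p1 := nodeSum_path hi t (h + 1)
    have p2 := nodeSum_path hi t' (h + 1)
    have hS0 : 0 ≤ nodeSum w (h + 1) (i / 2 ^ (h + 1)) := nodeSum_nonneg hw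
    -- If the leaf is alone below this node, the whole subtree costs nothing.
    rcases hS0.eq_or_lt with hS | hS
    · have c0 : expect (fun ω => cost (Function.update w i t) (Function.update w i t') T ω (h + 1)
          (i / 2 ^ (h + 1)) (m (h + 1)) (m (h + 1))) = 0 := by
        rw [← expect_const 0]
        refine congrArg expect (funext fun ω => ?_)
        refine cost_alone hw ht ht' ω hS.symm ?_ ?_ ?_ ?_ <;> linarith
      rw [← hS] at m1 m2 ⊢
      rw [c0, mul_zero, add_zero]
      -- For an integral weight the upper count exceeds it by a full unit and `cost_alone` does not
      -- apply, but then its coefficient is zero.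
      rcases (show (0 : ℝ) ≤ 0 + t - m (h + 1) by linarith).eq_or_lt with hp | hp
      · rw [← hp, zero_mul]; rw [← hS] at hpos; linarith
      · have c1 : expect (fun ω => cost (Function.update w i t) (Function.update w i t') T ω (h + 1)
            (i / 2 ^ (h + 1)) (m (h + 1) + 1) (m (h + 1) + 1)) = 0 := by
          rw [← expect_const 0]
          refine congrArg expect (funext fun ω => ?_)
          refine cost_alone hw ht ht' ω hS.symm ?_ ?_ ?_ ?_ <;> push_cast <;> linarith
        rw [c1, mul_zero]; rw [← hS] at hpos; linarith
    set s := nodeSum w (h + 1) (i / 2 ^ (h + 1)) + t with hs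
    set s' := nodeSum w (h + 1) (i / 2 ^ (h + 1)) + t' with hs'
    set v := i / 2 ^ (h + 1) with hvdef
    rcases le_or_gt s T with hsmall | hbig
    · have hm0 : m (h + 1) = 0 :=
        Nat.lt_one_iff.1 (by exact_mod_cast (show (m (h + 1) : ℝ) < 1 by linarith))
      rw [hm0] at m1 m2 ⊢
      simp only [cost_zero, expect_const, mul_zero, add_zero, zero_add, Nat.cast_zero, sub_zero]
        at m2 ⊢
      rcases le_or_gt s' T with hsmall' | hbig'
      · have k1 := expect_mono (bddMeas_cost _ _ T (h + 1) v 1 1) (BddMeas.const_mul 2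
          ((bddMeas_winner (Function.update w i t') (h + 1) v i).sub
          (bddMeas_winner (Function.update w i t) (h + 1) v i)))
          (fun ω => cost_small hW hW' hWW hne ω (p1.le.trans hsmall) (p2.le.trans hsmall'))
        rw [expect_const_mul, expect_sub (bddMeas_winner _ (h + 1) v i)
          (bddMeas_winner _ (h + 1) v i), expect_winner hW rfl (by rw [p1]; linarith),
          expect_winner hW' rfl (by rw [p2]; linarith), p1, p2] at k1
        simp only [Function.update_self] at k1
        have k2 := mul_le_mul_of_nonneg_left k1 (show 0 ≤ s by linarith)
        -- The node has a unit with probability `s`, and the leaf wins with probability `t / s`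
        -- before and `t' / s'` after the change. As `s ≤ s'`, the product `s * (t' / s')` is at
        -- most `t'`.
        have k3 : s * (2 * (t' / s' - t / s)) ≤ 2 * (t' - t) := by
          have : s * (t / s) = t := mul_div_cancel₀ _ (by linarith)
          have : s * (t' / s') ≤ t' := by
            rw [mul_div_assoc', div_le_iff₀ (by linarith)]
            nlinarith
          linarith
        change s * expect _ ≤ s * (2 * (t' / s' - t / s)) at k2
        linarith
      · have k1 := expect_mono (bddMeas_cost (Function.update w i t) (Function.update w i t')
          T (h + 1) v 1 1) (BddMeas.const 2) fun ω => by
          refine (cost_le_add hW hW' hT ω (N := 1) (N' := 1) ?_ ?_).trans (by norm_num)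
          · rw [Admissible, p1, abs_lt]; push_cast; constructor <;> linarith
          · rw [Admissible, p2, abs_lt]; push_cast; constructor <;> linarith
        rw [expect_const] at k1
        -- The node crosses the threshold: the trivial bound of two disagreements is covered by the
        -- indicator in `nodeCharge`.
        have hb2 := hb1 (h + 1) hh hS hbig'
        have k2 : nodeCharge T s s' ≥ 2 := by
          rw [nodeCharge, if_pos ⟨hsmall, hbig'⟩]; linarith
        have k3 : s * expect (fun ω => cost (Function.update w i t) (Function.update w i t') T ω
            (h + 1) v 1 1) ≤ 1 * 2 := by
          refine mul_le_mul (by linarith) k1 (expect_nonneg fun ω => cost_nonneg ..) (by norm_num)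
        nlinarith
    · have hb2 := hb1 (h + 1) hh hS (by linarith)
      have k2 : nodeCharge T s s' ≥ 2 * (t' - t) := by
        rw [nodeCharge, if_neg (fun h => absurd h.1 (not_le.2 hbig))]; linarith
      have k3 : 2 * (t' - t) ≤ b (h + 1) * nodeCharge T s s' := by nlinarith
      obtain ⟨l1, l2⟩ := hm h (by omega)
      have q1 := nodeSum_path hi t h
      have q2 := nodeSum_path hi t' h
      have hv' : 1 ≤ i / 2 ^ h := by
        have := div_two_pow_succ i h
        omega
      have IH := ih (by omega) hv'
      have E1 := expect_nodeLeft hW (h := h) (v := v) (p1 ▸ hbig) (p1 ▸ m1) (by rw [p1]; linarith)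
      have E2 := expect_nodeLeft hW' (h := h) (v := v) (T := T) (m := m (h + 1))
        (by rw [p2]; linarith) (by rw [p2]; linarith) (by rw [p2]; linarith)
      obtain ⟨mo1, mo2⟩ := expect_nodeLeft_mono hW' hT (h := h) (v := v) (m := m (h + 1))
        (by rw [p2]; linarith) (by rw [p2]; linarith)
      have B := bddMeas_nodeLeft (Function.update w i t) T h v
      have B' := bddMeas_nodeLeft (Function.update w i t') T h v
      have hp : 0 ≤ s - m (h + 1) := by linarith
      have hp' : 0 ≤ m (h + 1) + 1 - s := by linarith
      rw [p1] at E1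
      rw [p2] at E2
      rcases below_cases hvdef.symm with h0 | h0
      · rw [h0] at q1 q2 l1 l2 IH
        have key := fun ω N => cost_le_left hW hW' hT ω (h := h) (v := v) (m := m (h + 1))
          (M := m h) (N := N) (agree_update w t t' (by rw [h0]; omega))
          (p1 ▸ hbig) (by rw [q1, q2]; linarith) (p1 ▸ m1) (p2 ▸ m2) (q1 ▸ l1) (q2 ▸ l2)
        have tv := fun N hN => expect_two_values (v := v + 3) (M := m h)
          (Q := fun N ω => cost (Function.update w i t) (Function.update w i t') T ω h (2 * v) N N)
          (B N) (fun N => bddMeas_cost _ _ T h (2 * v) N N)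
          (fun ω ω' e => nodeLeft_congr_seed (p1 ▸ hbig) e N)
          (fun N ω ω' e => cost_congr_seed (agree_above (show v < 2 * v by omega) e) N N)
          (fun ω => ⟨(key ω N hN).1, (key ω N hN).2.1.trans (key ω N hN).2.2.1⟩)
        have main := fun N hN => expect_mono (bddMeas_cost _ _ T (h + 1) v N N)
          ((tv N hN).1.add (BddMeas.const_mul 2 ((B' N).sub (B N)))) fun ω => (key ω N hN).2.2.2
        have main' := fun N hN => (main N hN).trans_eq (by
          rw [expect_add (tv N hN).1 (BddMeas.const_mul 2 ((B' N).sub (B N))), (tv N hN).2,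
            expect_const_mul, expect_sub (B' N) (B N)])
        have M1 := mul_le_mul_of_nonneg_left (main' (m (h + 1) + 1) (Or.inr rfl)) hp
        have M0 := mul_le_mul_of_nonneg_left (main' (m (h + 1)) (Or.inl rfl)) hp'
        rw [q1] at E1
        rw [q2] at E2
        have hss : s' = s + (t' - t) := by rw [hs, hs']; ring
        -- The new left counts are mixed with the coefficients for `s` instead of `s'`, which
        -- changes the mean by `(t' - t) * (x1' - x0')`. By `mo1` this correction only lowers the
        -- bound `2 * (t' - t)`.
        have e3 := mul_nonneg (sub_nonneg.2 htt.le) (sub_nonneg.2 mo1)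
        refine (add_le_add M1 M0).trans ?_
        generalize expect (fun ω => (nodeLeft (Function.update w i t) T ω h v (m (h + 1) + 1) : ℝ))
          = x1 at *
        generalize expect (fun ω => (nodeLeft (Function.update w i t) T ω h v (m (h + 1)) : ℝ))
          = x0 at *
        generalize expect (fun ω => (nodeLeft (Function.update w i t') T ω h v (m (h + 1) + 1) : ℝ))
          = x1' at *
        generalize expect (fun ω => (nodeLeft (Function.update w i t') T ω h v (m (h + 1)) : ℝ))
          = x0' at *
        generalize expect (fun ω => cost (Function.update w i t) (Function.update w i t') T ω h
          (2 * v) (m h + 1) (m h + 1)) = c1 at *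
        generalize expect (fun ω => cost (Function.update w i t) (Function.update w i t') T ω h
          (2 * v) (m h) (m h)) = c0 at *
        rw [hss] at E2
        have e4 : (s - m (h + 1)) * ((x1 - m h) * c1 + (m h + 1 - x1) * c0 + 2 * (x1' - x1)) +
            (m (h + 1) + 1 - s) * ((x0 - m h) * c1 + (m h + 1 - x0) * c0 + 2 * (x0' - x0)) =
            ((nodeSum w h (2 * v) + t - m h) * c1 + (m h + 1 - (nodeSum w h (2 * v) + t)) * c0) +
            2 * ((t' - t) - (t' - t) * (x1' - x0')) := by
          linear_combination (c1 - c0 - 2) * E1 + 2 * E2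
        linarith
      · have h0' : i / 2 ^ h ≠ 2 * v := by omega
        rw [h0] at q1 q2 l1 l2 IH
        have key := fun ω N => cost_le_right hW hW' hT ω (h := h) (v := v) (m := m (h + 1))
          (M := m h) (N := N) (agree_update w t t' h0')
          (p1 ▸ hbig) (by rw [q1, q2]; linarith) (p1 ▸ m1) (p2 ▸ m2) (q1 ▸ l1) (q2 ▸ l2)
        have tv := fun N hN => expect_two_values (v := v + 3) (M := m h)
          (Q := fun N ω => cost (Function.update w i t) (Function.update w i t') T ω h
            (2 * v + 1) N N)
          (bddMeas_sub_nodeLeft _ T h v N) (fun N => bddMeas_cost _ _ T h (2 * v + 1) N N)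
          (fun ω ω' e => by rw [nodeLeft_congr_seed (p1 ▸ hbig) e N])
          (fun N ω ω' e => cost_congr_seed (agree_above (show v < 2 * v + 1 by omega) e) N N)
          (fun ω => ⟨(key ω N hN).1, by
            have := (key ω N hN).2.1
            have := (key ω N hN).2.2.2.1
            omega⟩)
        have main := fun N hN => expect_mono (bddMeas_cost _ _ T (h + 1) v N N)
          ((tv N hN).1.add (BddMeas.const_mul 2 ((B N).sub (B' N)))) fun ω => (key ω N hN).2.2.2.2
        have main' := fun N hN => (main N hN).trans_eq (by
          rw [expect_add (tv N hN).1 (BddMeas.const_mul 2 ((B N).sub (B' N))), (tv N hN).2,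
            expect_const_mul, expect_sub (B N) (B' N), expect_sub_nodeLeft])
        have M1 := mul_le_mul_of_nonneg_left (main' (m (h + 1) + 1) (Or.inr rfl)) hp
        have M0 := mul_le_mul_of_nonneg_left (main' (m (h + 1)) (Or.inl rfl)) hp'
        have hss : s' = s + (t' - t) := by rw [hs, hs']; ring
        have hsl : nodeSum (Function.update w i t) h (2 * v) =
            s - (nodeSum w h (2 * v + 1) + t) := by
          have hp1 := p1
          rw [nodeSum, q1] at hp1
          linarith
        have hsl' : nodeSum (Function.update w i t') h (2 * v) =
            s - (nodeSum w h (2 * v + 1) + t) := by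
          rw [← hsl]; exact (nodeSum_congr (agree_update w t t' h0')).symm
        rw [hsl] at E1
        rw [hsl'] at E2
        -- Here the mean left weight is unchanged, and the additional cost is twice the correction
        -- `(t' - t) * (x1' - x0')` alone, where `x1' - x0' ≤ 1` by `mo2`.
        have e3 := mul_nonneg (sub_nonneg.2 htt.le) (sub_nonneg.2 mo2)
        refine (add_le_add M1 M0).trans ?_
        generalize expect (fun ω => (nodeLeft (Function.update w i t) T ω h v (m (h + 1) + 1) : ℝ))
          = x1 at *
        generalize expect (fun ω => (nodeLeft (Function.update w i t) T ω h v (m (h + 1)) : ℝ))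
          = x0 at *
        generalize expect (fun ω => (nodeLeft (Function.update w i t') T ω h v (m (h + 1) + 1) : ℝ))
          = x1' at *
        generalize expect (fun ω => (nodeLeft (Function.update w i t') T ω h v (m (h + 1)) : ℝ))
          = x0' at *
        generalize expect (fun ω => cost (Function.update w i t) (Function.update w i t') T ω h
          (2 * v + 1) (m h + 1) (m h + 1)) = c1 at *
        generalize expect (fun ω => cost (Function.update w i t) (Function.update w i t') T ω h
          (2 * v + 1) (m h) (m h)) = c0 at *
        rw [hss] at E2
        push_cast
        have e4 : (s - m (h + 1)) * ((m (h + 1) + 1 - x1 - m h) * c1 +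
              (m h + 1 - (m (h + 1) + 1 - x1)) * c0 + 2 * (x1 - x1')) +
            (m (h + 1) + 1 - s) * ((m (h + 1) - x0 - m h) * c1 +
              (m h + 1 - (m (h + 1) - x0)) * c0 + 2 * (x0 - x0')) =
            ((nodeSum w h (2 * v + 1) + t - m h) * c1 +
              (m h + 1 - (nodeSum w h (2 * v + 1) + t)) * c0) + 2 * ((t' - t) * (x1' - x0')) := by
          linear_combination (-c1 + c0 + 2) * E1 - 2 * E2
        linarith

end Path

end CorrelatedSampling

namespace CorrelatedSampling

/-! ### The whole tree -/

/-- The count of the root of a tree of height `H`. -/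
noncomputable def rootCount (w : ℕ → ℝ) (ω : Seed) (H : ℕ) : ℕ := ⌈nodeSum w H 1 - nodeUnif ω 0⌉₊

/-- The number of disagreements between the roundings of two weight functions. -/
noncomputable def treeCost (w w' : ℕ → ℝ) (T : ℝ) (ω : Seed) (H : ℕ) : ℝ :=
  cost w w' T ω H 1 (rootCount w ω H) (rootCount w' ω H)

theorem admissible_rootCount {w : ℕ → ℝ} (hw : ∀ q, 0 ≤ w q) (ω : Seed) (H : ℕ) :
    Admissible (nodeSum w H 1) (rootCount w ω H) := by
  obtain ⟨h3, h4⟩ := nodeUnif_mem ω 0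
  have hs := nodeSum_nonneg (h := H) (v := 1) hw
  have h1 := Nat.le_ceil (nodeSum w H 1 - nodeUnif ω 0)
  have h2 : (⌈nodeSum w H 1 - nodeUnif ω 0⌉₊ : ℝ) < nodeSum w H 1 - nodeUnif ω 0 + 1 :=
    Nat.ceil_lt_add_one_of_gt_neg_one (by linarith)
  rw [Admissible, rootCount, abs_lt]
  constructor <;> linarith

theorem rootCount_range {w : ℕ → ℝ} (hw : ∀ q, 0 ≤ w q) (ω : Seed) {H m : ℕ}
    (hm : m ≤ nodeSum w H 1) (hm' : nodeSum w H 1 ≤ m + 1) :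
    m ≤ rootCount w ω H ∧ rootCount w ω H ≤ m + 1 := by
  obtain ⟨h3, h4⟩ := nodeUnif_mem ω 0
  have h1 := (abs_lt.1 (admissible_rootCount hw ω H)).1
  constructor
  · exact Nat.lt_succ_iff.1 (by exact_mod_cast (show (m : ℝ) < (rootCount w ω H + 1 : ℕ) by
      push_cast; linarith))
  · exact Nat.ceil_le.2 (by push_cast; linarith)

theorem measurable_rootCount {w : Seed → ℕ → ℝ} (hw : ∀ q, Measurable fun ω => w ω q) (H : ℕ) :
    Measurable fun ω => rootCount (w ω) ω H :=
  Nat.measurable_ceil.comp ((measurable_nodeSum hw H 1).sub (measurable_nodeUnif 0))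

theorem bddMeas_rootCount {w : ℕ → ℝ} (hw : ∀ q, 0 ≤ w q) (H : ℕ) :
    BddMeas fun ω => (rootCount w ω H : ℝ) :=
  BddMeas.of_nat (measurable_rootCount (w := fun _ => w) (fun _ => measurable_const) H)
    (C := ⌊nodeSum w H 1⌋₊ + 1) fun ω => (rootCount_range hw ω (Nat.floor_le (nodeSum_nonneg hw))
      (Nat.lt_floor_add_one _).le).2

theorem expect_rootCount {w : ℕ → ℝ} (hw : ∀ q, 0 ≤ w q) (H : ℕ) :
    expect (fun ω => (rootCount w ω H : ℝ)) = nodeSum w H 1 := by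
  rw [← integral_ceil_sub (nodeSum_nonneg hw (h := H) (v := 1)),
    ← expect_nodeUnif 0 (measurable_ceil_sub _)]
  rfl

/-- The root count reads only seed entry `3`, while the tree below node `1` reads entries from `4`
onwards. -/
theorem expect_rootCount_split {w : ℕ → ℝ} (hw : ∀ q, 0 ≤ w q) {H m : ℕ}
    (hm : m ≤ nodeSum w H 1) (hm' : nodeSum w H 1 ≤ m + 1) {Q : ℕ → Seed → ℝ}
    (hQ : ∀ N, BddMeas (Q N))
    (hQv : ∀ N, ∀ ω ω' : Seed, (∀ j, 1 + 3 ≤ j → ω j = ω' j) → Q N ω = Q N ω') :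
    BddMeas (fun ω => Q (rootCount w ω H) ω) ∧ expect (fun ω => Q (rootCount w ω H) ω) =
      (nodeSum w H 1 - m) * expect (Q (m + 1)) + (m + 1 - nodeSum w H 1) * expect (Q m) := by
  have := expect_two_values (v := 0 + 3) (bddMeas_rootCount hw H) hQ
    (fun ω ω' e => by unfold rootCount nodeUnif; rw [e])
    (fun N ω ω' e => hQv N ω ω' (agree_above Nat.zero_lt_one e))
    (fun ω => rootCount_range hw ω hm hm')
  rwa [expect_rootCount hw] at this

theorem expect_leafCount_root {w : ℕ → ℝ} (hw : ∀ q, 0 ≤ w q) {T : ℝ} (hT : T < 1) {H q : ℕ}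
    (hq : q / 2 ^ H = 1) :
    expect (fun ω => (leafCount w T ω H 1 (rootCount w ω H) q : ℝ)) = w q := by
  have h1 := Nat.floor_le (nodeSum_nonneg (h := H) (v := 1) hw)
  have h2 := Nat.lt_floor_add_one (nodeSum w H 1)
  rw [(expect_rootCount_split hw h1 h2.le (fun N => bddMeas_leafCount w T H 1 N q)
    fun N ω ω' e => by rw [leafCount_congr_seed e]).2]
  exact expect_leafCount hw hT le_rfl h1 h2 hq

theorem treeCost_comm (w w' : ℕ → ℝ) (T : ℝ) (ω : Seed) (H : ℕ) :
    treeCost w w' T ω H = treeCost w' w T ω H := cost_comm ..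

theorem treeCost_triangle (w w' w'' : ℕ → ℝ) (T : ℝ) (ω : Seed) (H : ℕ) :
    treeCost w w'' T ω H ≤ treeCost w w' T ω H + treeCost w' w'' T ω H := cost_triangle ..

theorem measurable_treeCost {w w' : Seed → ℕ → ℝ} {T : Seed → ℝ}
    (hw : ∀ q, Measurable fun ω => w ω q) (hw' : ∀ q, Measurable fun ω => w' ω q)
    (hT : Measurable T) (H : ℕ) : Measurable fun ω => treeCost (w ω) (w' ω) (T ω) ω H := by
  unfold treeCost cost
  refine measurable_nodeSum (fun q => ?_) H 1
  have h1 : Measurable fun ω => (leafCount (w ω) (T ω) ω H 1 (rootCount (w ω) ω H) q : ℝ) :=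
    measurable_from_nat.comp (measurable_leafCount hw hT (measurable_rootCount hw H) H 1 q)
  have h2 : Measurable fun ω => (leafCount (w' ω) (T ω) ω H 1 (rootCount (w' ω) ω H) q : ℝ) :=
    measurable_from_nat.comp (measurable_leafCount hw' hT (measurable_rootCount hw' H) H 1 q)
  simpa [Real.norm_eq_abs] using (h1.sub h2).norm

theorem treeCost_le {w w' : ℕ → ℝ} (hw : ∀ q, 0 ≤ w q) (hw' : ∀ q, 0 ≤ w' q) {T : ℝ} (hT : T < 1)
    (ω : Seed) (H : ℕ) : treeCost w w' T ω H ≤ nodeSum w H 1 + nodeSum w' H 1 + 2 := by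
  have h1 := admissible_rootCount hw ω H
  have h2 := admissible_rootCount hw' ω H
  have := cost_le_add hw hw' hT ω h1 h2
  rw [Admissible, abs_lt] at h1 h2
  unfold treeCost
  linarith

theorem bddMeas_treeCost {w w' : ℕ → ℝ} (hw : ∀ q, 0 ≤ w q) (hw' : ∀ q, 0 ≤ w' q) {T : ℝ}
    (hT : T < 1) (H : ℕ) : BddMeas fun ω => treeCost w w' T ω H :=
  ⟨measurable_treeCost (w := fun _ => w) (w' := fun _ => w') (T := fun _ => T)
    (fun _ => measurable_const) (fun _ => measurable_const) measurable_const H,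
    _, fun ω => by
      rw [abs_of_nonneg (by exact cost_nonneg ..)]; exact treeCost_le hw hw' hT ω H⟩

theorem treeCost_congr_seed {ω ω' : Seed} (hω : ∀ j, 3 ≤ j → ω j = ω' j) (w w' : ℕ → ℝ) (T : ℝ)
    (H : ℕ) : treeCost w w' T ω H = treeCost w w' T ω' H := by
  unfold treeCost rootCount nodeUnif
  rw [hω _ (by norm_num), cost_congr_seed fun j hj => hω j (by omega)]

/-- An increasing weight crosses the threshold at most once, so the charge is additive over
consecutive increases. This allows an increase to be cut at the points where a weight on the path
becomes an integer. -/
theorem nodeCharge_add {T s s' s'' : ℝ} (h : s ≤ s') (h' : s' ≤ s'') :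
    nodeCharge T s s' + nodeCharge T s' s'' = nodeCharge T s s'' := by
  unfold nodeCharge
  have e : (if s ≤ T ∧ T < s' then (1 : ℝ) else 0) + (if s' ≤ T ∧ T < s'' then 1 else 0) =
      if s ≤ T ∧ T < s'' then 1 else 0 := by
    rcases le_or_gt s' T with h1 | h1
    · simp [h1, not_lt.2 h1, h.trans h1]
    · simp [h1, not_le.2 h1, h1.trans_le h']
  linarith

section Path

variable {w : ℕ → ℝ} {i : ℕ} {t t' T : ℝ}

/-- The two root counts use the same shift and differ with expectation `t' - t`; the extra unit
costs at most one. This raises the final term of `cost_mixture_le` from `2 * (t' - t)` to `3 * (t' -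
t)`. -/
theorem expect_treeCost_le_of_floor (hw : ∀ q, 0 ≤ w q) (hi : w i = 0) (ht : 0 ≤ t) (htt : t < t')
    (hT : T < 1) {b : ℕ → ℝ} (hb : ∀ g, 0 ≤ b g) {H : ℕ}
    (hb1 : ∀ g, g ≤ H → 0 < nodeSum w g (i / 2 ^ g) → T < nodeSum w g (i / 2 ^ g) + t' → 1 ≤ b g)
    {m : ℕ → ℕ} (hm : ∀ g, g ≤ H → (m g : ℝ) ≤ nodeSum w g (i / 2 ^ g) + t ∧
      nodeSum w g (i / 2 ^ g) + t' ≤ m g + 1) (hiH : i / 2 ^ H = 1) :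
    expect (fun ω => treeCost (Function.update w i t) (Function.update w i t') T ω H) ≤
    ∑ g ∈ Finset.range H, b (g + 1) * nodeCharge T (nodeSum w (g + 1) (i / 2 ^ (g + 1)) + t)
      (nodeSum w (g + 1) (i / 2 ^ (g + 1)) + t') + 3 * (t' - t) := by
  have hW := update_nonneg hw i ht
  have hW' := update_nonneg hw i (ht.trans htt.le)
  have main := cost_mixture_le hw hi ht htt hT hb hb1 hm le_rfl hiH.ge
  obtain ⟨m1, m2⟩ := hm H le_rfl
  have p1 := nodeSum_path hi t H
  have p2 := nodeSum_path hi t' H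
  rw [hiH] at p1 p2 m1 m2 main
  have hm1 : (m H : ℝ) ≤ nodeSum (Function.update w i t) H 1 := p1 ▸ m1
  have hm2 : nodeSum (Function.update w i t) H 1 ≤ m H + 1 := by linarith
  have split := expect_rootCount_split hW hm1 hm2
    (Q := fun N ω => cost (Function.update w i t) (Function.update w i t') T ω H 1 N N)
    (fun N => bddMeas_cost _ _ T H 1 N N) (fun N ω ω' e => cost_congr_seed e N N)
  rw [p1] at split
  have B := bddMeas_rootCount hW H
  have B' := bddMeas_rootCount hW' H
  have key := expect_mono (bddMeas_treeCost hW hW' hT H) (split.1.add (B'.sub B)) fun ω => by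
    have r := rootCount_range hW ω hm1 hm2
    have r' := rootCount_range hW' ω (m := m H) (by linarith) (by linarith)
    have hle : rootCount (Function.update w i t) ω H ≤ rootCount (Function.update w i t') ω H :=
      Nat.ceil_mono (by linarith)
    have tri := cost_triangle (Function.update w i t) (Function.update w i t')
      (Function.update w i t') T ω H 1 (rootCount (Function.update w i t) ω H)
      (rootCount (Function.update w i t) ω H) (rootCount (Function.update w i t') ω H)
    unfold treeCost
    rcases (show rootCount (Function.update w i t') ω H = rootCount (Function.update w i t) ω H ∨
      (rootCount (Function.update w i t) ω H = m H ∧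
        rootCount (Function.update w i t') ω H = m H + 1) by omega) with h | ⟨h, h'⟩
    · rw [h, cost_self] at tri
      rw [h]; linarith
    · rw [h, h'] at tri ⊢
      have := cost_succ_self_le hW' hT ω (h := H) (v := 1) (N := m H) (by linarith) (by linarith)
      rw [cost_comm] at this
      push_cast
      linarith
  rw [expect_add split.1 (B'.sub B), split.2, expect_sub B' B, expect_rootCount hW,
    expect_rootCount hW', p1, p2] at key
  linarith

/-- The expected cost of increasing the weight of one leaf. -/
theorem expect_treeCost_le (hw : ∀ q, 0 ≤ w q) (hi : w i = 0) (ht : 0 ≤ t) (htt : t ≤ t')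
    (ht1 : t' ≤ 1) (hT : T < 1) {b : ℕ → ℝ} (hb : ∀ g, 0 ≤ b g) {H : ℕ}
    (hb1 : ∀ g, g ≤ H → 0 < nodeSum w g (i / 2 ^ g) → T < nodeSum w g (i / 2 ^ g) + t' → 1 ≤ b g)
    (hiH : i / 2 ^ H = 1) :
    expect (fun ω => treeCost (Function.update w i t) (Function.update w i t') T ω H) ≤
    ∑ g ∈ Finset.range H, b (g + 1) * nodeCharge T (nodeSum w (g + 1) (i / 2 ^ (g + 1)) + t)
      (nodeSum w (g + 1) (i / 2 ^ (g + 1)) + t') + 3 * (t' - t) := by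
  classical
  set S : ℕ → ℝ := fun g => nodeSum w g (i / 2 ^ g) with hS
  -- The values of the leaf at which some weight on the path becomes an integer. As the leaf weighs
  -- at most one, each level contributes only its next integer. The induction is on the number of
  -- these values strictly between `t` and `t'`.
  set B : Finset ℝ := (Finset.range (H + 1)).image fun g => ⌊S g⌋₊ + 1 - S g with hB
  induction hc : (B.filter fun x => t < x ∧ x < t').card using Nat.strong_induction_on
    generalizing t t' with
  | _ c ih =>
    rcases htt.eq_or_lt with h0 | h0
    · subst h0
      have : ∀ ω, treeCost (Function.update w i t) (Function.update w i t) T ω H = 0 :=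
        fun ω => cost_self ..
      simp only [this, expect_const]
      rw [sub_self, mul_zero, add_zero]
      exact Finset.sum_nonneg fun g _ => mul_nonneg (hb _) (nodeCharge_nonneg le_rfl)
    by_cases hex : ∃ x ∈ B, t < x ∧ x < t'
    · obtain ⟨x, hxB, hx1, hx2⟩ := hex
      have hlt : ∀ (p : ℝ → Prop) [DecidablePred p], (∀ y, p y → t < y ∧ y < t') → ¬ p x →
          (B.filter p).card < c := by
        intro p _ hp hpx
        rw [← hc]
        refine Finset.card_lt_card (Finset.ssubset_iff_of_subset ?_ |>.2
          ⟨x, Finset.mem_filter.2 ⟨hxB, hx1, hx2⟩, fun h => hpx (Finset.mem_filter.1 h).2⟩)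
        exact fun y hy => by
          rw [Finset.mem_filter] at hy ⊢; exact ⟨hy.1, hp y hy.2⟩
      have i1 := ih _ (hlt (fun y => t < y ∧ y < x) (fun y hy => ⟨hy.1, hy.2.trans hx2⟩)
        fun h => lt_irrefl _ h.2) ht hx1.le (hx2.le.trans ht1)
        (fun g hg h1 h2 => hb1 g hg h1 (by linarith)) rfl
      have i2 := ih _ (hlt (fun y => x < y ∧ y < t') (fun y hy => ⟨hx1.trans hy.1, hy.2⟩)
        fun h => lt_irrefl _ h.1) (ht.trans hx1.le) hx2.le ht1 hb1 rfl
      have hW := update_nonneg hw i ht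
      have hWx := update_nonneg hw i (ht.trans hx1.le)
      have hW' := update_nonneg hw i (ht.trans h0.le)
      have tri := expect_mono (bddMeas_treeCost hW hW' hT H)
        ((bddMeas_treeCost hW hWx hT H).add (bddMeas_treeCost hWx hW' hT H))
        fun ω => treeCost_triangle _ (Function.update w i x) _ T ω H
      rw [expect_add (bddMeas_treeCost hW hWx hT H) (bddMeas_treeCost hWx hW' hT H)] at tri
      have hsum : ∑ g ∈ Finset.range H, b (g + 1) * nodeCharge T (S (g + 1) + t) (S (g + 1) + t') =
          ∑ g ∈ Finset.range H, b (g + 1) * nodeCharge T (S (g + 1) + t) (S (g + 1) + x) +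
          ∑ g ∈ Finset.range H, b (g + 1) * nodeCharge T (S (g + 1) + x) (S (g + 1) + t') := by
        rw [← Finset.sum_add_distrib]
        refine Finset.sum_congr rfl fun g _ => ?_
        rw [← mul_add, nodeCharge_add (by linarith) (by linarith)]
      simp only [hS] at hsum
      rw [hsum]
      linarith
    · push Not at hex
      have hfl : ∀ g, (⌊S g⌋₊ : ℝ) ≤ S g := fun g => Nat.floor_le (nodeSum_nonneg hw)
      have hfl' : ∀ g, S g < (⌊S g⌋₊ : ℝ) + 1 := fun g => Nat.lt_floor_add_one _
      refine expect_treeCost_le_of_floor hw hi ht h0 hT hb hb1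
        (m := fun g => if ⌊S g⌋₊ + 1 - S g ≤ t then ⌊S g⌋₊ + 1 else ⌊S g⌋₊) (fun g hg => ?_) hiH
      change _ ≤ S g + t ∧ S g + t' ≤ _
      have := hfl g
      have := hfl' g
      by_cases hg1 : ⌊S g⌋₊ + 1 - S g ≤ t
      · simp only [hg1, if_true]
        push_cast
        constructor <;> linarith
      · simp only [hg1, if_false]
        have := hex (⌊S g⌋₊ + 1 - S g) (Finset.mem_image.2 ⟨g, by simp; omega, rfl⟩) (by linarith)
        constructor <;> linarith

end Path

end CorrelatedSampling

namespace CorrelatedSampling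

/-! ### Hashing the coordinates to the leaves -/

/-- The leaf of coordinate `i` with value `t`: the hash value of `i` among the leaves for the
values at most `τ` or among those for the values above `τ`. -/
noncomputable def slot (D a : ℕ) (τ t : ℝ) (i : ℕ) : ℕ :=
  2 ^ (D + 1) + (a * i % 2 ^ D + if τ < t then 2 ^ D else 0)

/-- The vector `x` as weights on the leaves. -/
noncomputable def weights {n : ℕ} (D a : ℕ) (τ : ℝ) (x : Fin n → ℝ) (q : ℕ) : ℝ :=
  ∑ i, if slot D a τ (x i) i = q then x i else 0

/-- The set that is sampled with multiplier `a`, threshold `T` and cut `τ`. -/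
noncomputable def sampler {n : ℕ} (D a : ℕ) (T τ : ℝ) (ω : Seed) (x : Fin n → ℝ) :
    Finset (Fin n) :=
  Finset.univ.filter fun i => leafCount (weights D a τ x) T ω (D + 1) 1
    (rootCount (weights D a τ x) ω (D + 1)) (slot D a τ (x i) i) ≠ 0

theorem slot_div (D a : ℕ) (τ t : ℝ) (i : ℕ) : slot D a τ t i / 2 ^ (D + 1) = 1 := by
  have := Nat.mod_lt (a * i) (Nat.two_pow_pos D)
  rw [Nat.div_eq_iff (Nat.two_pow_pos _), slot]
  split_ifs <;> rw [pow_succ] <;> omega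

/-- An odd multiplier is invertible modulo `2 ^ D`, so hashing permutes the leaves of each half and
distinct coordinates never share a leaf. -/
theorem odd_mul_mod_inj {a D i j : ℕ} (ha : Odd a) (hi : i < 2 ^ D) (hj : j < 2 ^ D)
    (h : a * i % 2 ^ D = a * j % 2 ^ D) : i = j := by
  have hc : Nat.gcd (2 ^ D) a = 1 := Nat.Coprime.pow_left _ (Nat.coprime_two_left.2 ha)
  have := Nat.ModEq.cancel_left_of_coprime hc (show a * i ≡ a * j [MOD 2 ^ D] from h)
  rwa [Nat.ModEq, Nat.mod_eq_of_lt hi, Nat.mod_eq_of_lt hj] at this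

section Slots

variable {n D a : ℕ} {τ : ℝ}

theorem slot_hash {t t' : ℝ} {i j : ℕ} (h : slot D a τ t i = slot D a τ t' j) :
    a * i % 2 ^ D = a * j % 2 ^ D := by
  have h1 := Nat.mod_lt (a * i) (Nat.two_pow_pos D)
  have h2 := Nat.mod_lt (a * j) (Nat.two_pow_pos D)
  unfold slot at h
  split_ifs at h <;> omega

theorem slot_inj (hn : n ≤ 2 ^ D) (ha : Odd a) {t t' : ℝ} {i j : Fin n}
    (h : slot D a τ t i = slot D a τ t' j) : i = j :=
  Fin.ext (odd_mul_mod_inj ha (i.2.trans_le hn) (j.2.trans_le hn) (slot_hash h))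

theorem weights_nonneg {x : Fin n → ℝ} (hx : ∀ i, 0 ≤ x i) (q : ℕ) : 0 ≤ weights D a τ x q :=
  Finset.sum_nonneg fun i _ => by split_ifs <;> [exact hx i; exact le_rfl]

theorem weights_slot (hn : n ≤ 2 ^ D) (ha : Odd a) (x : Fin n → ℝ) (i : Fin n) :
    weights D a τ x (slot D a τ (x i) i) = x i := by
  rw [weights, Finset.sum_eq_single i (fun j _ hj => if_neg fun h => hj (slot_inj hn ha h))
    (by simp), if_pos rfl]

theorem weights_eq_zero {x : Fin n → ℝ} {q : ℕ} (h : ∀ i, slot D a τ (x i) i ≠ q) :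
    weights D a τ x q = 0 := Finset.sum_eq_zero fun i _ => if_neg (h i)

theorem weights_le_one (hn : n ≤ 2 ^ D) (ha : Odd a) {x : Fin n → ℝ} (hx : ∀ i, x i ≤ 1) (q : ℕ) :
    weights D a τ x q ≤ 1 := by
  by_cases h : ∃ i, slot D a τ (x i) i = q
  · obtain ⟨i, rfl⟩ := h
    rw [weights_slot hn ha]; exact hx i
  · rw [weights_eq_zero (not_exists.1 h)]; exact zero_le_one

theorem nodeSum_weights (x : Fin n → ℝ) (h v : ℕ) : nodeSum (weights D a τ x) h v =
    ∑ i, if slot D a τ (x i) i / 2 ^ h = v then x i else 0 := by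
  simp only [nodeSum_eq_sum_leaves, weights]
  rw [Finset.sum_comm]
  refine Finset.sum_congr rfl fun i _ => ?_
  simp only [Finset.sum_ite_eq, mem_leaves]

theorem nodeSum_weights_root (x : Fin n → ℝ) :
    nodeSum (weights D a τ x) (D + 1) 1 = ∑ i, x i := by
  rw [nodeSum_weights]; simp only [slot_div, if_true]

/-- Stated relative to the vector with coordinate `i` erased, because a new value may also move `i`
across the cut to a different leaf. -/
theorem weights_update (x : Fin n → ℝ) (i : Fin n) (t : ℝ) :
    weights D a τ (Function.update x i t) = Function.update (weights D a τ (Function.update x i 0))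
      (slot D a τ t i) (weights D a τ (Function.update x i 0) (slot D a τ t i) + t) := by
  ext q
  have e : ∀ s, weights D a τ (Function.update x i s) q = (if slot D a τ s i = q then s else 0) +
      ∑ j ∈ Finset.univ.erase i, if slot D a τ (x j) j = q then x j else 0 := by
    intro s
    rw [weights, ← Finset.add_sum_erase _ _ (Finset.mem_univ i), Function.update_self]
    congr 1
    refine Finset.sum_congr rfl fun j hj => ?_
    rw [Function.update_of_ne (Finset.ne_of_mem_erase hj)]
  by_cases hq : q = slot D a τ t i
  · subst hq
    rw [Function.update_self, e t, e 0, if_pos rfl]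
    simp [add_comm]
  · rw [Function.update_of_ne hq, e t, e 0, if_neg (Ne.symm hq)]
    simp

theorem weights_update_zero (hn : n ≤ 2 ^ D) (ha : Odd a) (x : Fin n → ℝ) (i : Fin n) (t : ℝ) :
    weights D a τ (Function.update x i 0) (slot D a τ t i) = 0 :=
  Finset.sum_eq_zero fun j _ => by
    split_ifs with h
    · rw [slot_inj hn ha h, Function.update_self]
    · rfl

theorem weights_update' (hn : n ≤ 2 ^ D) (ha : Odd a) (x : Fin n → ℝ) (i : Fin n) (t : ℝ) :
    weights D a τ (Function.update x i t) = Function.update (weights D a τ (Function.update x i 0))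
      (slot D a τ t i) t := by
  rw [weights_update, weights_update_zero hn ha, zero_add]

variable {T : ℝ} {x y : Fin n → ℝ}

theorem leafCount_weights_le (hn : n ≤ 2 ^ D) (ha : Odd a) (hT : T < 1)
    (hx : ∀ i, 0 ≤ x i ∧ x i ≤ 1) (ω : Seed) {q : ℕ} (hq : q / 2 ^ (D + 1) = 1) :
    leafCount (weights D a τ x) T ω (D + 1) 1 (rootCount (weights D a τ x) ω (D + 1)) q ≤ 1 := by
  have hw := weights_nonneg (D := D) (a := a) (τ := τ) fun i => (hx i).1
  have h := (abs_lt.1 (admissible_leafCount hw hT ω (admissible_rootCount hw ω (D + 1)) hq)).2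
  have h1 := weights_le_one (τ := τ) hn ha (fun i => (hx i).2) q
  exact Nat.lt_succ_iff.1 (Nat.cast_lt (α := ℝ) |>.1 (by push_cast; linarith))

theorem leafCount_weights_eq_zero (hT : T < 1)
    (hx : ∀ i, 0 ≤ x i) (ω : Seed) {q : ℕ} (hq : q / 2 ^ (D + 1) = 1)
    (h : ∀ i, slot D a τ (x i) i ≠ q) :
    leafCount (weights D a τ x) T ω (D + 1) 1 (rootCount (weights D a τ x) ω (D + 1)) q = 0 := by
  have hw := weights_nonneg (D := D) (a := a) (τ := τ) hx
  have := admissible_leafCount hw hT ω (admissible_rootCount hw ω (D + 1)) hq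
  rw [weights_eq_zero h] at this
  exact this.zero

theorem leafCount_slot (hn : n ≤ 2 ^ D) (ha : Odd a) (hT : T < 1)
    (hx : ∀ i, 0 ≤ x i ∧ x i ≤ 1) (ω : Seed) (i : Fin n) :
    leafCount (weights D a τ x) T ω (D + 1) 1 (rootCount (weights D a τ x) ω (D + 1))
      (slot D a τ (x i) i) = if i ∈ sampler D a T τ ω x then 1 else 0 := by
  have := leafCount_weights_le (τ := τ) hn ha hT hx ω (slot_div D a τ (x i) i)
  simp only [sampler, Finset.mem_filter, Finset.mem_univ, true_and]
  split_ifs <;> omega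

/-- Leaf counts are `0` or `1` since leaf weights are at most one, they vanish on unoccupied leaves,
and their sum is the root count. -/
theorem card_sampler (hn : n ≤ 2 ^ D) (ha : Odd a) (hT : T < 1)
    (hx : ∀ i, 0 ≤ x i ∧ x i ≤ 1) (ω : Seed) :
    (sampler D a T τ ω x).card = rootCount (weights D a τ x) ω (D + 1) := by
  have hw := weights_nonneg (D := D) (a := a) (τ := τ) fun i => (hx i).1
  have h := nodeSum_leafCount hw hT ω (admissible_rootCount hw ω (D + 1))
  rw [nodeSum_eq_sum_leaves] at h
  have inj : Set.InjOn (fun i : Fin n => slot D a τ (x i) i) (Finset.univ : Finset (Fin n)) :=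
    fun i _ j _ e => slot_inj hn ha e
  have hsub : Finset.univ.image (fun i : Fin n => slot D a τ (x i) i) ⊆ leaves (D + 1) 1 := by
    intro q hq
    obtain ⟨i, -, rfl⟩ := Finset.mem_image.1 hq
    exact mem_leaves.2 (slot_div ..)
  rw [← Finset.sum_subset hsub fun q hq hq' => ?_, Finset.sum_image inj] at h
  · rw [Finset.sum_congr rfl fun i _ => by rw [leafCount_slot hn ha hT hx ω i]] at h
    push_cast at h
    rw [Finset.sum_boole] at h
    simpa using h
  · rw [leafCount_weights_eq_zero hT (fun i => (hx i).1) ω (mem_leaves.1 hq)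
      fun i hi => hq' (Finset.mem_image.2 ⟨i, Finset.mem_univ _, hi⟩), Nat.cast_zero]

theorem card_sampler_cases (hn : n ≤ 2 ^ D) (ha : Odd a) (hT : T < 1)
    (hx : ∀ i, 0 ≤ x i ∧ x i ≤ 1) (ω : Seed) :
    (sampler D a T τ ω x).card = ⌊∑ i, x i⌋₊ ∨ (sampler D a T τ ω x).card = ⌈∑ i, x i⌉₊ := by
  rw [card_sampler hn ha hT hx]
  have hw := weights_nonneg (D := D) (a := a) (τ := τ) fun i => (hx i).1
  have h := abs_lt.1 (admissible_rootCount hw ω (D + 1))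
  rw [nodeSum_weights_root] at h
  set N := rootCount (weights D a τ x) ω (D + 1)
  have h1 : ⌊∑ i, x i⌋₊ ≤ N := by
    have := Nat.floor_le (Finset.sum_nonneg fun i (_ : i ∈ Finset.univ) => (hx i).1)
    exact Nat.lt_succ_iff.1 (by exact_mod_cast (show (⌊∑ i, x i⌋₊ : ℝ) < (N + 1 : ℕ) by
      push_cast; linarith))
  have h2 : N ≤ ⌈∑ i, x i⌉₊ := by
    have := Nat.le_ceil (∑ i, x i)
    exact Nat.lt_succ_iff.1 (by exact_mod_cast (show (N : ℝ) < (⌈∑ i, x i⌉₊ + 1 : ℕ) by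
      push_cast; linarith))
  have h3 := Nat.ceil_le_floor_add_one (∑ i, x i)
  omega

/-- Charge each element of the difference to the leaf it occupies for the vector that selects it.
The other rounding has count zero at that leaf, whether the coordinate stayed there unselected or
moved away. Distinct coordinates are charged to distinct leaves. -/
theorem card_symmDiff_sampler (hn : n ≤ 2 ^ D) (ha : Odd a) (hT : T < 1)
    (hx : ∀ i, 0 ≤ x i ∧ x i ≤ 1) (hy : ∀ i, 0 ≤ y i ∧ y i ≤ 1) (ω : Seed) :
    ((symmDiff (sampler D a T τ ω x) (sampler D a T τ ω y)).card : ℝ) ≤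
      treeCost (weights D a τ x) (weights D a τ y) T ω (D + 1) := by
  classical
  have key : ∀ (x y : Fin n → ℝ), (∀ i, 0 ≤ x i ∧ x i ≤ 1) → (∀ i, 0 ≤ y i ∧ y i ≤ 1) →
      ∀ i, i ∈ sampler D a T τ ω x → i ∉ sampler D a T τ ω y →
      leafCount (weights D a τ x) T ω (D + 1) 1 (rootCount (weights D a τ x) ω (D + 1))
        (slot D a τ (x i) i) = 1 ∧
      leafCount (weights D a τ y) T ω (D + 1) 1 (rootCount (weights D a τ y) ω (D + 1))
        (slot D a τ (x i) i) = 0 := by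
    intro x y hx hy i hi hi'
    refine ⟨by rw [leafCount_slot hn ha hT hx, if_pos hi], ?_⟩
    by_cases h : slot D a τ (y i) i = slot D a τ (x i) i
    · rw [← h, leafCount_slot hn ha hT hy, if_neg hi']
    · refine leafCount_weights_eq_zero hT (fun i => (hy i).1) ω (slot_div ..) fun j hj => h ?_
      rw [slot_inj hn ha hj] at hj
      exact hj
  set f : Fin n → ℕ := fun i =>
    if i ∈ sampler D a T τ ω x then slot D a τ (x i) i else slot D a τ (y i) i with hf
  have hfd : ∀ i, f i / 2 ^ (D + 1) = 1 := fun i => by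
    simp only [hf]; split_ifs <;> exact slot_div ..
  have hfi : ∀ i j, f i = f j → i = j := fun i j h => by
    simp only [hf] at h; split_ifs at h <;> exact slot_inj hn ha h
  unfold treeCost cost
  rw [nodeSum_eq_sum_leaves, Finset.card_eq_sum_ones, Nat.cast_sum]
  have hsub : (symmDiff (sampler D a T τ ω x) (sampler D a T τ ω y)).image f ⊆
      leaves (D + 1) 1 := fun q hq => by
    obtain ⟨i, -, rfl⟩ := Finset.mem_image.1 hq
    exact mem_leaves.2 (hfd i)
  refine le_trans ?_ (Finset.sum_le_sum_of_subset_of_nonneg hsub fun _ _ _ => abs_nonneg _)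
  rw [Finset.sum_image fun i _ j _ h => hfi i j h]
  refine Finset.sum_le_sum fun i hi => ?_
  rcases Finset.mem_symmDiff.1 hi with ⟨h1, h2⟩ | ⟨h1, h2⟩
  · simp only [hf, if_pos h1]
    obtain ⟨e1, e2⟩ := key x y hx hy i h1 h2
    rw [e1, e2]; norm_num
  · simp only [hf, if_neg h2]
    obtain ⟨e1, e2⟩ := key y x hy hx i h1 h2
    rw [e1, e2]; norm_num

end Slots

end CorrelatedSampling

namespace CorrelatedSampling

/-! ### The hash function, the threshold and the cut -/

/-- The random number that determines the hash function. -/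
noncomputable def hashIndex (D : ℕ) (ω : Seed) : ℕ :=
  min ⌊((2 ^ D : ℕ) : ℝ) * (ω 0 : ℝ)⌋₊ (2 ^ D - 1)

/-- The multiplier of the hash function. -/
noncomputable def hashMul (D : ℕ) (ω : Seed) : ℕ := 2 * hashIndex D ω + 1

/-- The weight up to which a node is passed to its winner. -/
noncomputable def threshold (ω : Seed) : ℝ := 3 / 4 + (ω 1 : ℝ) / 8

/-- The value that separates small from large coordinates. -/
noncomputable def cut (ω : Seed) : ℝ := 1 / 4 + (ω 2 : ℝ) / 4

theorem hashMul_odd (D : ℕ) (ω : Seed) : Odd (hashMul D ω) := ⟨_, rfl⟩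

theorem threshold_mem (ω : Seed) : 3 / 4 ≤ threshold ω ∧ threshold ω < 1 := by
  have := (ω 1).2.1
  have := (ω 1).2.2
  unfold threshold
  constructor <;> linarith

theorem cut_mem (ω : Seed) : 1 / 4 ≤ cut ω ∧ cut ω ≤ 1 / 2 := by
  have := (ω 2).2.1
  have := (ω 2).2.2
  unfold cut
  constructor <;> linarith

theorem measurable_coord (j : ℕ) : Measurable fun ω : Seed => (ω j : ℝ) :=
  measurable_subtype_coe.comp (measurable_pi_apply j)

theorem measurable_hashIndex (D : ℕ) : Measurable (hashIndex D) :=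
  (Nat.measurable_floor.comp ((measurable_coord 0).const_mul _)).min measurable_const

theorem measurable_hashMul (D : ℕ) : Measurable (hashMul D) :=
  (measurable_from_nat (f := fun r => 2 * r + 1)).comp (measurable_hashIndex D)

theorem measurable_threshold : Measurable threshold :=
  ((measurable_coord 1).div_const _).const_add _

theorem measurable_cut : Measurable cut := ((measurable_coord 2).div_const _).const_add _

theorem measurable_slot (D : ℕ) (t : ℝ) (i : ℕ) :
    Measurable fun ω => slot D (hashMul D ω) (cut ω) t i := by
  unfold slot
  refine measurable_const.add (Measurable.add ?_ ?_)
  · exact (measurable_from_nat (f := fun a => a * i % 2 ^ D)).comp (measurable_hashMul D)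
  · exact Measurable.ite (measurableSet_lt measurable_cut measurable_const) measurable_const
      measurable_const

theorem measurable_weights {n : ℕ} (D : ℕ) (x : Fin n → ℝ) (q : ℕ) :
    Measurable fun ω => weights D (hashMul D ω) (cut ω) x q :=
  Finset.measurable_sum _ fun i _ => Measurable.ite
    (measurableSet_eq_fun (measurable_slot D (x i) i) measurable_const) measurable_const
    measurable_const

theorem expect_interval_le (j : ℕ) {c d : ℝ} (hcd : c ≤ d) :
    expect (fun ω => if c ≤ (ω j : ℝ) ∧ (ω j : ℝ) ≤ d then 1 else 0) ≤ d - c := by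
  have hm : Measurable fun x : ℝ => if c ≤ x ∧ x ≤ d then (1 : ℝ) else 0 :=
    Measurable.ite measurableSet_Icc measurable_const measurable_const
  rw [expect_coord j hm, intervalIntegral.integral_of_le zero_le_one]
  have e : (fun x : ℝ => if c ≤ x ∧ x ≤ d then (1 : ℝ) else 0) =
      (Set.Icc c d).indicator fun _ => 1 := by
    ext x; simp [Set.indicator_apply]
  rw [e, integral_indicator measurableSet_Icc, setIntegral_const, smul_eq_mul, mul_one]
  refine ENNReal.toReal_le_of_le_ofReal (by linarith) ?_
  exact (Measure.restrict_le_self _).trans Real.volume_Icc.le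

theorem BddMeas.indicator_interval (j : ℕ) (c d : ℝ) :
    BddMeas fun ω : Seed => if c ≤ (ω j : ℝ) ∧ (ω j : ℝ) ≤ d then 1 else 0 :=
  BddMeas.indicator (measurable_coord j measurableSet_Icc)

theorem measurableSet_threshold (s s' : ℝ) :
    MeasurableSet {ω | s ≤ threshold ω ∧ threshold ω < s'} :=
  measurable_threshold measurableSet_Ico

theorem measurableSet_cut (s s' : ℝ) : MeasurableSet {ω | s ≤ cut ω ∧ cut ω < s'} :=
  measurable_cut measurableSet_Ico

/-- The threshold is uniform on an interval of length `1/8` and hence has density eight; in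
`expect_cut_le` the interval has length `1/4`. -/
theorem expect_threshold_le {s s' : ℝ} (h : s ≤ s') :
    expect (fun ω => if s ≤ threshold ω ∧ threshold ω < s' then 1 else 0) ≤ 8 * (s' - s) := by
  refine (expect_mono (BddMeas.indicator (measurableSet_threshold s s'))
    (BddMeas.indicator_interval 1 (8 * (s - 3 / 4)) (8 * (s' - 3 / 4))) fun ω => ?_).trans
    ((expect_interval_le 1 (by linarith)).trans (by linarith))
  by_cases h : s ≤ threshold ω ∧ threshold ω < s'
  · rw [if_pos h, if_pos]
    unfold threshold at h
    constructor <;> linarith [h.1, h.2]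
  · rw [if_neg h]; split_ifs <;> norm_num

theorem expect_cut_le {s s' : ℝ} (h : s ≤ s') :
    expect (fun ω => if s ≤ cut ω ∧ cut ω < s' then 1 else 0) ≤ 4 * (s' - s) := by
  refine (expect_mono (BddMeas.indicator (measurableSet_cut s s'))
    (BddMeas.indicator_interval 2 (4 * (s - 1 / 4)) (4 * (s' - 1 / 4))) fun ω => ?_).trans
    ((expect_interval_le 2 (by linarith)).trans (by linarith))
  by_cases h : s ≤ cut ω ∧ cut ω < s'
  · rw [if_pos h, if_pos]
    unfold cut at h
    constructor <;> linarith [h.1, h.2]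
  · rw [if_neg h]; split_ifs <;> norm_num

theorem measurable_nodeCharge {T s s' : Seed → ℝ} (hT : Measurable T) (hs : Measurable s)
    (hs' : Measurable s') : Measurable fun ω => nodeCharge (T ω) (s ω) (s' ω) := by
  unfold nodeCharge
  exact ((hs'.sub hs).const_mul 2).add ((Measurable.ite
    ((measurableSet_le hs hT).inter (measurableSet_lt hT hs')) measurable_const
    measurable_const).const_mul 2)

/-- The constant is `2 + 2 * 8`: the direct charge, and twice the probability of crossing the
threshold. -/
theorem expect_nodeCharge_le {s s' : ℝ} (h : s ≤ s') :
    expect (fun ω => nodeCharge (threshold ω) s s') ≤ 18 * (s' - s) := by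
  have hb := BddMeas.indicator (measurableSet_threshold s s')
  have := expect_threshold_le h
  unfold nodeCharge
  rw [expect_add (.const _) (hb.const_mul 2), expect_const, expect_const_mul]
  linarith

theorem nodeCharge_le {T s s' : ℝ} : nodeCharge T s s' ≤ 2 * (s' - s) + 2 := by
  unfold nodeCharge; split_ifs <;> linarith

theorem expect_hashIndex_le (D r : ℕ) :
    expect (fun ω => if hashIndex D ω = r then 1 else 0) ≤ 1 / 2 ^ D := by
  have hD : (0 : ℝ) < 2 ^ D := by positivity
  refine (expect_mono (BddMeas.indicator (p := fun ω => hashIndex D ω = r)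
      (measurable_hashIndex D (measurableSet_singleton r)))
    (BddMeas.indicator_interval 0 (r / 2 ^ D) ((r + 1) / 2 ^ D)) fun ω => ?_).trans
    ((expect_interval_le 0 (by gcongr; linarith)).trans (by rw [← sub_div]; simp))
  by_cases h : hashIndex D ω = r
  · rw [if_pos h, if_pos]
    have h0 := (ω 0).2.1
    have h1 := (ω 0).2.2
    have hfl := Nat.floor_le (mul_nonneg hD.le h0)
    have hlt := Nat.lt_floor_add_one ((2 : ℝ) ^ D * ω 0)
    unfold hashIndex at h
    push_cast at h
    rw [div_le_iff₀ hD, le_div_iff₀ hD]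
    -- The second case is the endpoint value `1` of the seed entry, which the truncation assigns to
    -- the last index.
    rcases le_or_gt ⌊(2 : ℝ) ^ D * ω 0⌋₊ (2 ^ D - 1) with hc | hc
    · rw [min_eq_left hc] at h
      rw [h] at hfl hlt
      constructor <;> linarith
    · rw [min_eq_right hc.le] at h
      have hp := Nat.two_pow_pos D
      have hc' : ((2 ^ D : ℕ) : ℝ) ≤ ⌊(2 : ℝ) ^ D * ω 0⌋₊ := Nat.cast_le.2 (by omega)
      have hr : (r : ℝ) + 1 = 2 ^ D := by exact_mod_cast (by omega : r + 1 = 2 ^ D)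
      push_cast at hc'
      constructor <;> nlinarith
  · rw [if_neg h]; split_ifs <;> norm_num

theorem expect_hashIndex_mem_le (D : ℕ) (C : Finset ℕ) :
    expect (fun ω => if hashIndex D ω ∈ C then 1 else 0) ≤ C.card / 2 ^ D := by
  have e : ∀ ω, (if hashIndex D ω ∈ C then (1 : ℝ) else 0) =
      ∑ r ∈ C, if hashIndex D ω = r then 1 else 0 := fun ω => by
    rw [Finset.sum_ite_eq]
  simp only [e]
  rw [expect_sum C fun r _ => BddMeas.indicator (p := fun ω => hashIndex D ω = r)
    (measurable_hashIndex D (measurableSet_singleton r))]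
  refine (Finset.sum_le_sum fun r _ => expect_hashIndex_le D r).trans ?_
  rw [Finset.sum_const, nsmul_eq_mul, mul_one_div]

/-- There are at most `2 ^ (g + 1)` odd multipliers for which `z` comes within `2 ^ g` of `0`. -/
theorem card_near_zero_le {D g z : ℕ} (hz : 0 < z) (hzD : z < 2 ^ D) {C : Finset ℕ}
    (hC : ∀ r ∈ C, r < 2 ^ D ∧ ∃ d : ℤ, |d| < 2 ^ g ∧ (2 ^ D : ℤ) ∣ (2 * r + 1) * z - d) :
    C.card ≤ 2 ^ (g + 1) := by
  obtain ⟨e, o, ho, rfl⟩ := Nat.exists_eq_two_pow_mul_odd hz.ne'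
  have heD : e < D := (Nat.pow_lt_pow_iff_right (by norm_num : 1 < 2)).1
    ((Nat.le_mul_of_pos_right _ ho.pos).trans_lt hzD)
  choose! d hd hdvd using fun r hr => (hC r hr).2
  -- An odd multiplier times `z = 2 ^ e * o` with `o` odd is an odd multiple of `2 ^ e`, and `e < D`
  -- preserves this under reduction modulo `2 ^ D`.
  have hodd : ∀ r ∈ C, ∃ y, d r = 2 ^ e * (2 * y + 1) := by
    intro r hr
    obtain ⟨c, hc⟩ := hdvd r hr
    obtain ⟨o', rfl⟩ := ho
    obtain ⟨f, rfl⟩ : ∃ f, D = e + 1 + f := ⟨D - (e + 1), by omega⟩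
    refine ⟨r * (2 * o' + 1) + o' - 2 ^ f * c, ?_⟩
    push_cast at hc
    rw [pow_add, pow_succ] at hc
    linear_combination -hc
  choose! y hy using hodd
  rcases C.eq_empty_or_nonempty with rfl | ⟨r₀, hr₀⟩
  · simp
  have heg : e < g := by
    have h1 := hd r₀ hr₀
    rw [hy r₀ hr₀, abs_mul, abs_of_pos (by positivity)] at h1
    have h2 : (1 : ℤ) ≤ |2 * y r₀ + 1| := Int.one_le_abs (by omega)
    have h3 : (2 : ℤ) ^ e < 2 ^ g := lt_of_le_of_lt (le_mul_of_one_le_right (by positivity) h2) h1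
    exact (pow_lt_pow_iff_right₀ (by norm_num)).1 h3
  obtain ⟨g', rfl⟩ : ∃ g', g = e + 1 + g' := ⟨g - (e + 1), by omega⟩
  obtain ⟨D', rfl⟩ : ∃ D', D = e + 1 + D' := ⟨D - (e + 1), by omega⟩
  have hyr : ∀ r ∈ C, -2 ^ g' ≤ y r ∧ y r < 2 ^ g' := by
    intro r hr
    have h1 := abs_lt.1 (hd r hr)
    rw [hy r hr, pow_add, pow_succ] at h1
    have hp : (0 : ℤ) < 2 ^ e := by positivity
    have a1 : -(2 * 2 ^ g') < 2 * y r + 1 := lt_of_mul_lt_mul_left (by linarith [h1.1]) hp.le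
    have a2 : 2 * y r + 1 < 2 * 2 ^ g' := lt_of_mul_lt_mul_left (by linarith [h1.2]) hp.le
    omega
  -- There are `2 ^ (g' + 1)` possible values of `y`. Each determines `r` modulo `2 ^ D'`, and the
  -- quotient of `r` by `2 ^ D'` has `2 ^ (e + 1)` values; the product is `2 ^ (g + 1)`.
  have key : C.card ≤ (Finset.Ico (-2 ^ g' : ℤ) (2 ^ g') ×ˢ Finset.range (2 ^ (e + 1))).card := by
    refine Finset.card_le_card_of_injOn (fun r => (y r, r / 2 ^ D')) (fun r hr => ?_) ?_
    · rw [Finset.mem_coe, Finset.mem_product, Finset.mem_Ico, Finset.mem_range]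
      refine ⟨hyr r hr, Nat.div_lt_of_lt_mul ?_⟩
      rw [← pow_add, add_comm]; exact (hC r hr).1
    · intro r hr r' hr' h
      obtain ⟨h1, h2⟩ := Prod.mk.inj h
      have hdd : d r = d r' := by rw [hy r hr, hy r' hr', h1]
      have h3 := dvd_sub (hdvd r hr) (hdvd r' hr')
      rw [hdd] at h3
      have h4 : (2 ^ (e + 1) * 2 ^ D' : ℤ) ∣ 2 ^ (e + 1) * (((r : ℤ) - r') * o) := by
        rw [← pow_add]
        have h3' : (2 : ℤ) ^ (e + 1) * (((r : ℤ) - r') * o) =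
            (2 * r + 1) * ((2 ^ e * o : ℕ) : ℤ) - d r' -
              ((2 * r' + 1) * ((2 ^ e * o : ℕ) : ℤ) - d r') := by push_cast; ring
        rw [h3']
        exact h3
      have h5 := (Int.mul_dvd_mul_iff_left (by positivity)).1 h4
      have hco : IsCoprime (2 ^ D' : ℤ) (o : ℤ) := by
        apply IsCoprime.pow_left
        exact_mod_cast Nat.isCoprime_iff_coprime.2 (Nat.coprime_two_left.2 ho)
      have h6 := hco.dvd_of_dvd_mul_right h5
      have h7 : r % 2 ^ D' = r' % 2 ^ D' := by
        have h8 := (Int.modEq_iff_dvd.2 h6).symm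
        exact (Int.natCast_modEq_iff (n := 2 ^ D')).1 (by exact_mod_cast h8)
      have e1 := Nat.div_add_mod r (2 ^ D')
      have e2 := Nat.div_add_mod r' (2 ^ D')
      rw [h2, h7] at e1
      omega
  refine key.trans (le_of_eq ?_)
  rw [Finset.card_product, Int.card_Ico, Finset.card_range]
  have : ((2 : ℤ) ^ g' - -2 ^ g').toNat = 2 ^ (g' + 1) := by
    rw [sub_neg_eq_add, ← two_mul, ← pow_succ']
    exact_mod_cast Int.toNat_natCast (2 ^ (g' + 1))
  rw [this]
  ring

/-- Hash values in a common block of length `2 ^ g` differ by less than `2 ^ g`, and modulo `2 ^ D`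
their difference is the multiplier times the difference of the coordinates; `card_near_zero_le`
counts such multipliers. -/
theorem expect_collision_le {D g i j : ℕ} (hi : i < 2 ^ D) (hj : j < 2 ^ D) (hij : i ≠ j) :
    expect (fun ω => if hashMul D ω * j % 2 ^ D / 2 ^ g = hashMul D ω * i % 2 ^ D / 2 ^ g
      then 1 else 0) ≤ 2 ^ (g + 1) / 2 ^ D := by
  set C := (Finset.range (2 ^ D)).filter fun r =>
    (2 * r + 1) * j % 2 ^ D / 2 ^ g = (2 * r + 1) * i % 2 ^ D / 2 ^ g with hCdef
  have hlt : ∀ ω, hashIndex D ω < 2 ^ D := fun ω => by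
    have := Nat.two_pow_pos D
    unfold hashIndex
    omega
  have e : ∀ ω, (if hashMul D ω * j % 2 ^ D / 2 ^ g = hashMul D ω * i % 2 ^ D / 2 ^ g
      then (1 : ℝ) else 0) = if hashIndex D ω ∈ C then 1 else 0 := fun ω =>
    if_congr (by simp only [hCdef, Finset.mem_filter, Finset.mem_range, hlt, true_and, hashMul])
      rfl rfl
  simp only [e]
  refine (expect_hashIndex_mem_le D C).trans ?_
  gcongr
  have aux : ∀ i j : ℕ, i < j → j < 2 ^ D → (∀ r ∈ C,
      (2 * r + 1) * j % 2 ^ D / 2 ^ g = (2 * r + 1) * i % 2 ^ D / 2 ^ g) →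
      C.card ≤ 2 ^ (g + 1) := by
    intro i j hij hj hr
    refine card_near_zero_le (D := D) (z := j - i) (by omega) (by omega) fun r hrC => ⟨?_, ?_⟩
    · exact Finset.mem_range.1 (Finset.mem_filter.1 hrC).1
    · refine ⟨((2 * r + 1) * j % 2 ^ D : ℕ) - ((2 * r + 1) * i % 2 ^ D : ℕ), ?_, ?_⟩
      · have h := hr r hrC
        have hp := Nat.two_pow_pos g
        have e1 := Nat.div_add_mod ((2 * r + 1) * j % 2 ^ D) (2 ^ g)
        have e2 := Nat.div_add_mod ((2 * r + 1) * i % 2 ^ D) (2 ^ g)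
        have l1 := Nat.mod_lt ((2 * r + 1) * j % 2 ^ D) hp
        have l2 := Nat.mod_lt ((2 * r + 1) * i % 2 ^ D) hp
        have n1 := Nat.zero_le ((2 * r + 1) * j % 2 ^ D % 2 ^ g)
        have n2 := Nat.zero_le ((2 * r + 1) * i % 2 ^ D % 2 ^ g)
        rw [h] at e1
        rw [abs_lt]
        zify at e1 e2 l1 l2 n1 n2
        push_cast
        constructor <;> linarith
      · have e1 := Nat.div_add_mod ((2 * r + 1) * j) (2 ^ D)
        have e2 := Nat.div_add_mod ((2 * r + 1) * i) (2 ^ D)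
        refine ⟨((2 * r + 1) * j / 2 ^ D : ℕ) - ((2 * r + 1) * i / 2 ^ D : ℕ), ?_⟩
        zify at e1 e2
        push_cast [Nat.cast_sub hij.le]
        linear_combination e2 - e1
  have hmem : ∀ r ∈ C, (2 * r + 1) * j % 2 ^ D / 2 ^ g = (2 * r + 1) * i % 2 ^ D / 2 ^ g :=
    fun r hr => (Finset.mem_filter.1 hr).2
  have : C.card ≤ 2 ^ (g + 1) := by
    rcases hij.lt_or_gt with h | h
    · exact aux i j h hj hmem
    · exact aux j i h hi fun r hr => (hmem r hr).symm
  exact_mod_cast this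

end CorrelatedSampling

namespace CorrelatedSampling

/-! ### The stretch -/

/-- The weight of the other coordinates whose hash values agree with that of `i` in all but the
last `g` bits. -/
noncomputable def crowd {n : ℕ} (D a : ℕ) (x : Fin n → ℝ) (i : Fin n) (g : ℕ) : ℝ :=
  ∑ j, if j ≠ i ∧ a * j % 2 ^ D / 2 ^ g = a * i % 2 ^ D / 2 ^ g then x j else 0

/-- A bound for the effect of coordinate `i` at the nodes of height `g`: `1` for the top `K + 1`
levels and by the weight of the colliding coordinates below. -/
noncomputable def levelBound {n : ℕ} (K D a : ℕ) (x : Fin n → ℝ) (i : Fin n) (g : ℕ) : ℝ :=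
  if D - K < g then 1 else 4 * crowd D a x i g

/-- Up to height `D` a node determines both the leading bits of the hash value and the side of the
cut, because the bit for the cut stands above all hash bits. -/
theorem slot_block {D a g : ℕ} {τ t t' : ℝ} {i j : ℕ} (hg : g ≤ D)
    (h : slot D a τ t i / 2 ^ g = slot D a τ t' j / 2 ^ g) :
    a * i % 2 ^ D / 2 ^ g = a * j % 2 ^ D / 2 ^ g ∧ (τ < t ↔ τ < t') := by
  obtain ⟨f, rfl⟩ := Nat.exists_eq_add_of_le hg
  have hp := Nat.two_pow_pos g
  have e : ∀ s k, slot (g + f) a τ s k / 2 ^ g =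
      2 ^ (f + 1) + (a * k % 2 ^ (g + f) / 2 ^ g + if τ < s then 2 ^ f else 0) := by
    intro s k
    have : slot (g + f) a τ s k =
        a * k % 2 ^ (g + f) + 2 ^ g * (2 ^ (f + 1) + if τ < s then 2 ^ f else 0) := by
      unfold slot
      split_ifs <;> ring
    rw [this, Nat.add_mul_div_left _ _ hp]
    ring
  have l : ∀ k, a * k % 2 ^ (g + f) / 2 ^ g < 2 ^ f := fun k => by
    refine Nat.div_lt_of_lt_mul ?_
    rw [← pow_add]; exact Nat.mod_lt _ (Nat.two_pow_pos _)
  rw [e, e] at h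
  have l1 := l i
  have l2 := l j
  generalize a * i % 2 ^ (g + f) / 2 ^ g = A at h l1 ⊢
  generalize a * j % 2 ^ (g + f) / 2 ^ g = A' at h l2 ⊢
  by_cases h1 : τ < t <;> by_cases h2 : τ < t' <;>
    simp only [h1, h2, if_true, if_false, iff_true, and_true, not_true, iff_false] at h ⊢ <;> omega

section Coordinate

variable {n D a K : ℕ} {τ T : ℝ} {x : Fin n → ℝ} {i : Fin n}

theorem crowd_nonneg (hx : ∀ j, 0 ≤ x j) (g : ℕ) : 0 ≤ crowd D a x i g :=
  Finset.sum_nonneg fun j _ => by split_ifs <;> [exact hx j; exact le_rfl]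

theorem levelBound_nonneg (hx : ∀ j, 0 ≤ x j) (g : ℕ) : 0 ≤ levelBound K D a x i g := by
  have := crowd_nonneg (D := D) (a := a) (i := i) hx g
  unfold levelBound; split_ifs <;> linarith

theorem nodeSum_le_crowd (hx : ∀ j, 0 ≤ x j) (s : ℝ) {g : ℕ} (hg : g ≤ D) :
    nodeSum (weights D a τ (Function.update x i 0)) g (slot D a τ s i / 2 ^ g) ≤
      crowd D a x i g := by
  rw [nodeSum_weights]
  refine Finset.sum_le_sum fun j _ => ?_
  by_cases hj : j = i
  · subst hj; simp
  · rw [Function.update_of_ne hj]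
    by_cases h : slot D a τ (x j) j / 2 ^ g = slot D a τ s i / 2 ^ g
    · rw [if_pos h, if_pos ⟨hj, (slot_block hg h).1⟩]
    · rw [if_neg h]; split_ifs <;> [exact hx j; exact le_rfl]

/-- Here the cut is used. If `s` is at most the cut, it is at most `1/2`, and exceeding `T ≥ 3/4`
takes other weight above `1/4`. If `s` is above the cut, any companion below the node lies on the
same side of the cut and alone weighs more than `1/4`. Either way four times the crowd is at least
one. -/
theorem one_le_levelBound (hx : ∀ j, 0 ≤ x j) (hτ : 1 / 4 ≤ τ) (hτ' : τ ≤ 1 / 2) (hT : 3 / 4 ≤ T)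
    {s : ℝ} {g : ℕ} (h0 : 0 < nodeSum (weights D a τ (Function.update x i 0)) g
      (slot D a τ s i / 2 ^ g))
    (h1 : T < nodeSum (weights D a τ (Function.update x i 0)) g (slot D a τ s i / 2 ^ g) + s) :
    1 ≤ levelBound K D a x i g := by
  unfold levelBound
  split_ifs with hgK
  · exact le_rfl
  have hg : g ≤ D := by omega
  have hle := nodeSum_le_crowd (a := a) (τ := τ) (i := i) hx s hg
  rcases le_or_gt s τ with hs | hs
  · linarith
  · rw [nodeSum_weights] at h0
    obtain ⟨j, -, hj⟩ := Finset.exists_lt_of_sum_lt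
      (f := fun _ : Fin n => (0 : ℝ)) (by simpa using h0)
    split_ifs at hj with hc
    · by_cases hji : j = i
      · subst hji; simp at hj
      · rw [Function.update_of_ne hji] at hc hj
        obtain ⟨c1, c2⟩ := slot_block hg hc
        have hxj := c2.2 hs
        have : x j ≤ crowd D a x i g := by
          have := Finset.single_le_sum (f := fun j => if j ≠ i ∧ a * j % 2 ^ D / 2 ^ g =
            a * i % 2 ^ D / 2 ^ g then x j else 0)
            (fun j _ => by split_ifs <;> [exact hx j; exact le_rfl]) (Finset.mem_univ j)
          rwa [if_pos ⟨hji, c1⟩] at this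
        linarith
    · exact absurd hj (lt_irrefl _)

theorem expect_treeCost_leaf_le (hn : n ≤ 2 ^ D) (ha : Odd a) (hx : ∀ j, 0 ≤ x j) (hτ : 1 / 4 ≤ τ)
    (hτ' : τ ≤ 1 / 2) (hT : 3 / 4 ≤ T) (hT' : T < 1) {r s : ℝ} (hr : 0 ≤ r) (hrs : r ≤ s)
    (hs : s ≤ 1) :
    expect (fun ω => treeCost
      (Function.update (weights D a τ (Function.update x i 0)) (slot D a τ s i) r)
      (Function.update (weights D a τ (Function.update x i 0)) (slot D a τ s i) s) T ω (D + 1)) ≤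
    ∑ g ∈ Finset.range (D + 1), levelBound K D a x i (g + 1) * nodeCharge T
      (nodeSum (weights D a τ (Function.update x i 0)) (g + 1) (slot D a τ s i / 2 ^ (g + 1)) + r)
      (nodeSum (weights D a τ (Function.update x i 0)) (g + 1) (slot D a τ s i / 2 ^ (g + 1)) + s)
      + 3 * (s - r) :=
  expect_treeCost_le (weights_nonneg fun j => by
      by_cases h : j = i
      · subst h; simp
      · rw [Function.update_of_ne h]; exact hx j)
    (weights_update_zero hn ha x i s) hr hrs hs hT' (levelBound_nonneg hx)
    (fun _ _ => one_le_levelBound hx hτ hτ' hT) (slot_div ..)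

/-- Unless the cut lies between `t` and `x i`, the coordinate keeps its leaf and only the weight of
that leaf changes. Otherwise the coordinate is removed from one leaf and inserted at another; each
of these changes has node charges at most four and final term at most three, which gives the factor
`8` and the summand `6`. -/
theorem expect_treeCost_coord_le (hn : n ≤ 2 ^ D) (ha : Odd a) (hx : ∀ j, 0 ≤ x j) (hτ : 1 / 4 ≤ τ)
    (hτ' : τ ≤ 1 / 2) (hT : 3 / 4 ≤ T) (hT' : T < 1) {t : ℝ} (ht : 0 ≤ t) (hti : t ≤ x i)
    (hi : x i ≤ 1) :
    expect (fun ω => treeCost (weights D a τ (Function.update x i t)) (weights D a τ x) T ω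
      (D + 1)) ≤
    ∑ g ∈ Finset.range (D + 1), levelBound K D a x i (g + 1) * nodeCharge T
      (nodeSum (weights D a τ (Function.update x i 0)) (g + 1)
        (slot D a τ (x i) i / 2 ^ (g + 1)) + t)
      (nodeSum (weights D a τ (Function.update x i 0)) (g + 1)
        (slot D a τ (x i) i / 2 ^ (g + 1)) + x i) + 3 * (x i - t) +
      (if t ≤ τ ∧ τ < x i then 1 else 0) *
        (8 * ∑ g ∈ Finset.range (D + 1), levelBound K D a x i (g + 1) + 6) := by
  set w := weights D a τ (Function.update x i 0) with hw
  have hx1 : weights D a τ x = Function.update w (slot D a τ (x i) i) (x i) := by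
    rw [← weights_update' hn ha x i (x i), Function.update_eq_self]
  have hb := levelBound_nonneg (K := K) (D := D) (a := a) (i := i) hx
  have hw0 : ∀ q, 0 ≤ w q := weights_nonneg fun j => by
    by_cases h : j = i
    · subst h; simp
    · rw [Function.update_of_ne h]; exact hx j
  rw [weights_update' hn ha x i t, hx1]
  by_cases hc : t ≤ τ ∧ τ < x i
  · rw [if_pos hc, one_mul]
    have e : ∀ s, Function.update w (slot D a τ s i) 0 = w := fun s =>
      Function.update_eq_self_iff.2 (weights_update_zero hn ha x i s).symm
    have key : ∀ s, 0 ≤ s → s ≤ 1 → expect (fun ω => treeCost w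
        (Function.update w (slot D a τ s i) s) T ω (D + 1)) ≤
        4 * ∑ g ∈ Finset.range (D + 1), levelBound K D a x i (g + 1) + 3 := by
      intro s hs hs1
      have h := expect_treeCost_leaf_le (K := K) (i := i) hn ha hx hτ hτ' hT hT' le_rfl hs hs1
      rw [← hw, e s] at h
      refine h.trans (add_le_add ?_ (by linarith))
      rw [Finset.mul_sum]
      refine Finset.sum_le_sum fun g _ => ?_
      rw [mul_comm]
      exact mul_le_mul_of_nonneg_right (nodeCharge_le.trans (by linarith)) (hb _)
    have k1 := key t ht (hti.trans hi)
    have k2 := key (x i) (ht.trans hti) hi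
    have hW := fun s (hs : 0 ≤ s) => update_nonneg hw0 (slot D a τ s i) hs
    have B1 := bddMeas_treeCost hw0 (hW t ht) hT' (D + 1)
    have B2 := bddMeas_treeCost hw0 (hW _ (ht.trans hti)) hT' (D + 1)
    have tri := expect_mono (bddMeas_treeCost (hW t ht) (hW _ (ht.trans hti)) hT' (D + 1))
      (B1.add B2) fun ω => by
        have := treeCost_triangle (Function.update w (slot D a τ t i) t) w
          (Function.update w (slot D a τ (x i) i) (x i)) T ω (D + 1)
        rwa [treeCost_comm _ w] at this
    rw [expect_add B1 B2] at tri
    have hnn : 0 ≤ ∑ g ∈ Finset.range (D + 1), levelBound K D a x i (g + 1) * nodeCharge T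
      (nodeSum w (g + 1) (slot D a τ (x i) i / 2 ^ (g + 1)) + t)
      (nodeSum w (g + 1) (slot D a τ (x i) i / 2 ^ (g + 1)) + x i) :=
      Finset.sum_nonneg fun g _ => mul_nonneg (hb _) (nodeCharge_nonneg (by linarith))
    linarith
  · rw [if_neg hc, zero_mul, add_zero]
    have hsl : slot D a τ t i = slot D a τ (x i) i := by
      unfold slot
      have : τ < t ↔ τ < x i := ⟨fun h => h.trans_le hti, fun h => by
        by_contra h'; exact hc ⟨not_lt.1 h', h⟩⟩
      simp only [this]
    rw [hsl]
    exact expect_treeCost_leaf_le hn ha hx hτ hτ' hT hT' ht hti hi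

end Coordinate

section Average

variable {n D K k : ℕ} {x : Fin n → ℝ} {i : Fin n}

theorem bddMeas_levelBound (K D : ℕ) (x : Fin n → ℝ) (i : Fin n) (g : ℕ) :
    BddMeas fun ω => levelBound K D (hashMul D ω) x i g := by
  unfold levelBound crowd
  by_cases h : D - K < g
  · simp only [h, if_true]; exact .const _
  · simp only [h, if_false]
    refine .const_mul _ (.sum _ fun j _ => ?_)
    have : ∀ ω, (if j ≠ i ∧ hashMul D ω * j % 2 ^ D / 2 ^ g = hashMul D ω * i % 2 ^ D / 2 ^ g
        then x j else 0) = x j * if j ≠ i ∧ hashMul D ω * j % 2 ^ D / 2 ^ g =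
          hashMul D ω * i % 2 ^ D / 2 ^ g then 1 else 0 := fun ω => by
      rw [mul_ite, mul_one, mul_zero]
    simp only [this]
    exact .const_mul _ (.indicator (measurable_hashMul D (MeasurableSet.of_discrete (s :=
      {a : ℕ | j ≠ i ∧ a * j % 2 ^ D / 2 ^ g = a * i % 2 ^ D / 2 ^ g}))))

/-- Below the top levels each of the other coordinates, of total weight at most `k`, collides with
probability at most `2 ^ (g + 1) / 2 ^ D`, and `levelBound` has the factor four. -/
theorem expect_levelBound_le (hn : n ≤ 2 ^ D) (hx : ∀ j, 0 ≤ x j) (hk : ∑ j, x j ≤ k) (g : ℕ) :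
    expect (fun ω => levelBound K D (hashMul D ω) x i g) ≤
      if D - K < g then (1 : ℝ) else 8 * k * (2 ^ g / 2 ^ D) := by
  by_cases h : D - K < g
  · simp only [levelBound, h, if_true, expect_const, le_refl]
  have B : ∀ j : Fin n, BddMeas fun ω => if hashMul D ω * j % 2 ^ D / 2 ^ g =
      hashMul D ω * i % 2 ^ D / 2 ^ g then (1 : ℝ) else 0 := fun j =>
    .indicator (measurable_hashMul D (MeasurableSet.of_discrete (s :=
      {a : ℕ | a * j % 2 ^ D / 2 ^ g = a * i % 2 ^ D / 2 ^ g})))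
  have e : ∀ ω, levelBound K D (hashMul D ω) x i g = 4 * ∑ j ∈ Finset.univ.erase i, x j *
      if hashMul D ω * j % 2 ^ D / 2 ^ g = hashMul D ω * i % 2 ^ D / 2 ^ g then 1 else 0 := by
    intro ω
    simp only [levelBound, h, if_false, crowd]
    rw [← Finset.add_sum_erase _ _ (Finset.mem_univ i)]
    simp only [ne_eq, not_true, false_and, if_false, zero_add, mul_ite, mul_one, mul_zero]
    congr 1
    refine Finset.sum_congr rfl fun j hj => ?_
    simp [Finset.ne_of_mem_erase hj]
  simp only [e, h, if_false]
  rw [expect_const_mul, expect_sum _ fun j _ => (B j).const_mul _]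
  have hsum : ∑ j ∈ Finset.univ.erase i, expect (fun ω => x j *
      if hashMul D ω * j % 2 ^ D / 2 ^ g = hashMul D ω * i % 2 ^ D / 2 ^ g then 1 else 0) ≤
      ∑ j ∈ Finset.univ.erase i, x j * (2 ^ (g + 1) / 2 ^ D) := by
    refine Finset.sum_le_sum fun j hj => ?_
    rw [expect_const_mul]
    refine mul_le_mul_of_nonneg_left (expect_collision_le (i.2.trans_le hn) (j.2.trans_le hn)
      fun h => Finset.ne_of_mem_erase hj (Fin.ext h.symm)) (hx j)
  rw [← Finset.sum_mul] at hsum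
  have h2 : ∑ j ∈ Finset.univ.erase i, x j ≤ k := by
    have := Finset.add_sum_erase Finset.univ x (Finset.mem_univ i)
    linarith [hx i]
  have h3 : (0 : ℝ) ≤ 2 ^ (g + 1) / 2 ^ D := by positivity
  calc _ ≤ 4 * (k * (2 ^ (g + 1) / 2 ^ D : ℝ)) := by
        linarith [mul_le_mul_of_nonneg_right h2 h3]
    _ = _ := by rw [pow_succ]; ring

/-- At most `K + 1` top levels contribute one each. Below them the geometric series is dominated by
its top term and, as `k ≤ 2 ^ K`, sums to at most `16`. -/
theorem sum_expect_levelBound_le (hn : n ≤ 2 ^ D) (hx : ∀ j, 0 ≤ x j) (hk : ∑ j, x j ≤ k)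
    (hK : k ≤ 2 ^ K) :
    ∑ g ∈ Finset.range (D + 1), expect (fun ω => levelBound K D (hashMul D ω) x i (g + 1)) ≤
      K + 17 := by
  refine (Finset.sum_le_sum fun g _ => expect_levelBound_le hn hx hk (g + 1)).trans ?_
  rw [← Finset.sum_range_add_sum_Ico _ (show D - K ≤ D + 1 by omega)]
  rw [Finset.sum_congr rfl fun g hg => if_neg (by have := Finset.mem_range.1 hg; omega),
    Finset.sum_congr (s₁ := Finset.Ico _ _) rfl fun g hg => if_pos (by
      have := Finset.mem_Ico.1 hg; omega)]
  have h2 : ∑ g ∈ Finset.Ico (D - K) (D + 1), (1 : ℝ) ≤ K + 1 := by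
    rw [Finset.sum_const, Nat.card_Ico, nsmul_eq_mul, mul_one]
    exact_mod_cast (by omega : D + 1 - (D - K) ≤ K + 1)
  have h1 : ∑ g ∈ Finset.range (D - K), 8 * (k : ℝ) * (2 ^ (g + 1) / 2 ^ D) ≤ 16 := by
    rcases le_or_gt D K with h | h
    · rw [Nat.sub_eq_zero_of_le h]; simp
    obtain ⟨M, rfl⟩ := Nat.exists_eq_add_of_le h.le
    rw [Nat.add_sub_cancel_left, ← Finset.mul_sum, ← Finset.sum_div]
    have hg : ∑ g ∈ Finset.range M, (2 : ℝ) ^ (g + 1) ≤ 2 * 2 ^ M := by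
      simp only [pow_succ]
      rw [← Finset.sum_mul, geom_sum_eq (by norm_num)]
      linarith
    have hk' : (k : ℝ) ≤ 2 ^ K := by exact_mod_cast hK
    calc 8 * (k : ℝ) * ((∑ g ∈ Finset.range M, (2 : ℝ) ^ (g + 1)) / 2 ^ (K + M))
        ≤ 8 * 2 ^ K * ((2 * 2 ^ M) / 2 ^ (K + M)) := by gcongr
      _ = 16 := by rw [pow_add]; field_simp; norm_num
  linarith

/-- Average over seed entry `1` first, with all other entries fixed: the hash function and the cut,
hence `B` and `S`, do not depend on it, while the threshold depends on nothing else. -/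
theorem expect_mul_nodeCharge_le {B S : Seed → ℝ} (hB : BddMeas B) (hB0 : ∀ ω, 0 ≤ B ω)
    (hS : Measurable S) (hB1 : ∀ ω ω' : Seed, (∀ j ≠ 1, ω j = ω' j) → B ω = B ω')
    (hS1 : ∀ ω ω' : Seed, (∀ j ≠ 1, ω j = ω' j) → S ω = S ω') {t t' : ℝ} (h : t ≤ t') :
    BddMeas (fun ω => B ω * nodeCharge (threshold ω) (S ω + t) (S ω + t')) ∧
    expect (fun ω => B ω * nodeCharge (threshold ω) (S ω + t) (S ω + t')) ≤
      18 * (t' - t) * expect B := by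
  have hN : BddMeas fun ω => nodeCharge (threshold ω) (S ω + t) (S ω + t') :=
    ⟨measurable_nodeCharge measurable_threshold (hS.add_const t) (hS.add_const t'),
      2 * (t' - t) + 2, fun ω => by
        rw [abs_of_nonneg (nodeCharge_nonneg (by linarith))]
        exact nodeCharge_le.trans (by linarith)⟩
  refine ⟨hB.mul hN, ?_⟩
  rw [expect_merge {1}ᶜ (hB.mul hN), ← expect_const_mul]
  refine expect_mono ((hB.mul hN).merge_left _) (hB.const_mul _) fun ω' => ?_
  have e : ∀ ω, ∀ j ≠ 1, mergeSeed {1}ᶜ ω' ω j = ω' j := fun ω j hj =>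
    mergeSeed_of_mem _ _ (by simpa using hj)
  have e1 : ∀ ω, threshold (mergeSeed {1}ᶜ ω' ω) = threshold ω := fun ω => by
    unfold threshold
    rw [mergeSeed_of_notMem _ _ (by simp)]
  simp only [hB1 _ _ (e _), hS1 _ _ (e _), e1]
  rw [expect_const_mul]
  have := expect_nodeCharge_le (s := S ω' + t) (s' := S ω' + t') (by linarith)
  have h2 := mul_le_mul_of_nonneg_left this (hB0 ω')
  linarith

theorem hashMul_congr {ω ω' : Seed} (h : ω 0 = ω' 0) : hashMul D ω = hashMul D ω' := by
  unfold hashMul hashIndex; rw [h]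

theorem bddMeas_treeCost_random {x y : Fin n → ℝ} (hx : ∀ j, 0 ≤ x j) (hy : ∀ j, 0 ≤ y j) (D : ℕ) :
    BddMeas fun ω => treeCost (weights D (hashMul D ω) (cut ω) x)
      (weights D (hashMul D ω) (cut ω) y) (threshold ω) ω (D + 1) :=
  ⟨measurable_treeCost (measurable_weights D x) (measurable_weights D y) measurable_threshold _,
    ∑ j, x j + ∑ j, y j + 2, fun ω => by
      rw [abs_of_nonneg (by exact cost_nonneg ..)]
      have := treeCost_le (weights_nonneg (D := D) (a := hashMul D ω) (τ := cut ω) hx)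
        (weights_nonneg (D := D) (a := hashMul D ω) (τ := cut ω) hy) (threshold_mem ω).2 ω (D + 1)
      rwa [nodeSum_weights_root, nodeSum_weights_root] at this⟩

/-- The expected effect of one coordinate. -/
theorem expect_treeCost_random_le (hn : n ≤ 2 ^ D) (hx : ∀ j, 0 ≤ x j) (hx1 : ∀ j, x j ≤ 1)
    (hk : ∑ j, x j ≤ k) (hK : k ≤ 2 ^ K) {t : ℝ} (ht : 0 ≤ t) (hti : t ≤ x i) :
    expect (fun ω => treeCost (weights D (hashMul D ω) (cut ω) (Function.update x i t))
      (weights D (hashMul D ω) (cut ω) x) (threshold ω) ω (D + 1)) ≤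
      (50 * K + 877) * (x i - t) := by
  have hxt : ∀ j, 0 ≤ Function.update x i t j := fun j => by
    by_cases h : j = i
    · subst h; simpa
    · rw [Function.update_of_ne h]; exact hx j
  set S : ℕ → Seed → ℝ := fun g ω => nodeSum (weights D (hashMul D ω) (cut ω)
    (Function.update x i 0)) g (slot D (hashMul D ω) (cut ω) (x i) i / 2 ^ g) with hS
  set B : ℕ → Seed → ℝ := fun g ω => levelBound K D (hashMul D ω) x i g with hB
  have hBm : ∀ g, BddMeas (B g) := bddMeas_levelBound K D x i
  have hSm : ∀ g, Measurable (S g) := fun g => by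
    simp only [hS, nodeSum_weights]
    refine Finset.measurable_sum _ fun j _ => Measurable.ite (measurableSet_eq_fun
      ((measurable_from_nat (f := (· / 2 ^ g))).comp (measurable_slot D _ j))
      ((measurable_from_nat (f := (· / 2 ^ g))).comp (measurable_slot D _ i)))
      measurable_const measurable_const
  have hm := fun g => expect_mul_nodeCharge_le (hBm g) (fun ω => levelBound_nonneg hx g) (hSm g)
    (fun ω ω' e => by simp only [hB]; rw [hashMul_congr (e 0 (by norm_num))])
    (fun ω ω' e => by
      have e2 : cut ω = cut ω' := by unfold cut; rw [e 2 (by norm_num)]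
      simp only [hS]; rw [hashMul_congr (e 0 (by norm_num)), e2]) hti
  have hI := BddMeas.indicator (measurableSet_cut t (x i))
  have hR : BddMeas fun ω => 8 * ∑ g ∈ Finset.range (D + 1), B (g + 1) ω + 6 :=
    ((BddMeas.sum _ fun g _ => hBm (g + 1)).const_mul 8).add (.const 6)
  have hQ : BddMeas fun ω => ∑ g ∈ Finset.range (D + 1),
      B (g + 1) ω * nodeCharge (threshold ω) (S (g + 1) ω + t) (S (g + 1) ω + x i) :=
    .sum _ fun g _ => (hm (g + 1)).1
  have hF := bddMeas_treeCost_random hxt hx D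
  rw [expect_merge {0, 1, 2} hF]
  have step := expect_mono (hF.merge_left {0, 1, 2})
    ((hQ.add (.const (3 * (x i - t)))).add (hI.mul hR)) fun ω' => by
    have e : ∀ ω, ∀ j < 3, mergeSeed {0, 1, 2} ω' ω j = ω' j := fun ω j hj =>
      mergeSeed_of_mem _ _ (by simp; omega)
    have e' : ∀ ω, ∀ j, 3 ≤ j → mergeSeed {0, 1, 2} ω' ω j = ω j := fun ω j hj =>
      mergeSeed_of_notMem _ _ (by simp; omega)
    have a1 : ∀ ω, hashMul D (mergeSeed {0, 1, 2} ω' ω) = hashMul D ω' := fun ω =>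
      hashMul_congr (e ω 0 (by norm_num))
    have a2 : ∀ ω, threshold (mergeSeed {0, 1, 2} ω' ω) = threshold ω' := fun ω => by
      unfold threshold; rw [e ω 1 (by norm_num)]
    have a3 : ∀ ω, cut (mergeSeed {0, 1, 2} ω' ω) = cut ω' := fun ω => by
      unfold cut; rw [e ω 2 (by norm_num)]
    simp only [a1, a2, a3, treeCost_congr_seed (e' _)]
    exact expect_treeCost_coord_le (K := K) hn (hashMul_odd D ω') hx (cut_mem ω').1 (cut_mem ω').2
      (threshold_mem ω').1 (threshold_mem ω').2 ht hti (hx1 i)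
  refine step.trans ?_
  have hsum := sum_expect_levelBound_le (i := i) hn hx hk hK
  rw [expect_add (hQ.add (.const _)) (hI.mul hR), expect_add hQ (.const _), expect_const,
    expect_sum _ fun g _ => (hm (g + 1)).1,
    expect_mul {2} hI hR (fun ω ω' e => by
      rw [show cut ω = cut ω' by unfold cut; rw [e 2 (by simp)]])
      (fun ω ω' e => by simp only [hB, hashMul_congr (e 0 (by simp))]),
    expect_add ((BddMeas.sum _ fun g _ => hBm (g + 1)).const_mul 8) (.const 6), expect_const,
    expect_const_mul, expect_sum _ fun g _ => hBm (g + 1)]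
  have q1 := Finset.sum_le_sum fun g (_ : g ∈ Finset.range (D + 1)) => (hm (g + 1)).2
  rw [← Finset.mul_sum] at q1
  have q2 := expect_cut_le hti
  have hε : 0 ≤ x i - t := by linarith
  have hX : 0 ≤ ∑ g ∈ Finset.range (D + 1), expect (B (g + 1)) :=
    Finset.sum_nonneg fun g _ => expect_nonneg fun ω => levelBound_nonneg hx _
  have q3 := mul_le_mul_of_nonneg_right q2
    (show 0 ≤ 8 * ∑ g ∈ Finset.range (D + 1), expect (B (g + 1)) + 6 by linarith)
  have q4 := mul_le_mul_of_nonneg_left hsum hε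
  -- The constant is the sum of `18 * (K + 17)` for the path, `3` for the final term, and `4 * (8 *
  -- (K + 17) + 6)` for the cut.
  linarith

/-- Lower the coordinates one at a time; all intermediate vectors stay below `x`, so the bound `k`
on the total weight persists and the costs add by the triangle inequality. -/
theorem expect_treeCost_random_le_of_le {z : Fin n → ℝ} (hn : n ≤ 2 ^ D) (hx1 : ∀ j, x j ≤ 1)
    (hk : ∑ j, x j ≤ k) (hK : k ≤ 2 ^ K) (hz : ∀ j, 0 ≤ z j) (hzx : ∀ j, z j ≤ x j) :
    expect (fun ω => treeCost (weights D (hashMul D ω) (cut ω) z)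
      (weights D (hashMul D ω) (cut ω) x) (threshold ω) ω (D + 1)) ≤
      (50 * K + 877) * ∑ j, (x j - z j) := by
  have hx : ∀ j, 0 ≤ x j := fun j => (hz j).trans (hzx j)
  have key : ∀ s : Finset (Fin n), expect (fun ω => treeCost
      (weights D (hashMul D ω) (cut ω) (s.piecewise z x))
      (weights D (hashMul D ω) (cut ω) x) (threshold ω) ω (D + 1)) ≤
      (50 * K + 877) * ∑ j ∈ s, (x j - z j) := by
    intro s
    induction s using Finset.induction_on with
    | empty =>
      have : ∀ (w : ℕ → ℝ) (T : ℝ) (ω : Seed), treeCost w w T ω (D + 1) = 0 := fun _ _ _ =>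
        cost_self ..
      simp [this, expect_const]
    | insert i s his ih =>
      have hu : ∀ j, 0 ≤ s.piecewise z x j ∧ s.piecewise z x j ≤ x j := fun j => by
        by_cases h : j ∈ s
        · rw [Finset.piecewise_eq_of_mem _ _ _ h]; exact ⟨hz j, hzx j⟩
        · rw [Finset.piecewise_eq_of_notMem _ _ _ h]; exact ⟨hx j, le_rfl⟩
      have hi : s.piecewise z x i = x i := Finset.piecewise_eq_of_notMem _ _ _ his
      have hv : ∀ j, 0 ≤ (insert i s).piecewise z x j := fun j => by
        by_cases h : j ∈ insert i s
        · rw [Finset.piecewise_eq_of_mem _ _ _ h]; exact hz j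
        · rw [Finset.piecewise_eq_of_notMem _ _ _ h]; exact hx j
      have h1 := expect_treeCost_random_le (i := i) hn (fun j => (hu j).1)
        (fun j => (hu j).2.trans (hx1 j)) ((Finset.sum_le_sum fun j _ => (hu j).2).trans hk) hK
        (hz i) (by rw [hi]; exact hzx i)
      rw [← Finset.piecewise_insert, hi] at h1
      have B1 := bddMeas_treeCost_random hv (fun j => (hu j).1) D
      have B2 := bddMeas_treeCost_random (fun j => (hu j).1) hx D
      have tri := expect_mono (bddMeas_treeCost_random hv hx D) (B1.add B2)
        fun ω => treeCost_triangle ..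
      rw [expect_add B1 B2] at tri
      rw [Finset.sum_insert his, mul_add]
      linarith
  have := key Finset.univ
  rwa [Finset.piecewise_univ] at this

end Average

/-! ### The correlated sampling algorithm -/

/-- The random set. -/
noncomputable def randomSet {n : ℕ} (D : ℕ) (ω : Seed) (x : Fin n → ℝ) : Finset (Fin n) :=
  sampler D (hashMul D ω) (threshold ω) (cut ω) ω x

/-- The leaf of a coordinate depends on the seed, so the event is decomposed according to the value
of that leaf. -/
theorem measurableSet_randomSet {n : ℕ} (D : ℕ) (x : Fin n → ℝ) (i : Fin n) :
    MeasurableSet {ω | i ∈ randomSet D ω x} := by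
  have e : {ω | i ∈ randomSet D ω x} = ⋃ q : ℕ, {ω | slot D (hashMul D ω) (cut ω) (x i) i = q} ∩
      {ω | leafCount (weights D (hashMul D ω) (cut ω) x) (threshold ω) ω (D + 1) 1
        (rootCount (weights D (hashMul D ω) (cut ω) x) ω (D + 1)) q ≠ 0} := by
    ext ω
    simp [randomSet, sampler]
  rw [e]
  refine MeasurableSet.iUnion fun q => (measurable_slot D (x i) i (measurableSet_singleton q)).inter
    (measurable_leafCount (measurable_weights D x) measurable_threshold
      (measurable_rootCount (measurable_weights D x) (D + 1)) (D + 1) 1 q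
      (MeasurableSet.of_discrete (s := {N : ℕ | N ≠ 0})))

section Sampling

variable {n D : ℕ} {x y : Fin n → ℝ}

/-- The marginals are exact for every fixed hash function, threshold and cut, hence also on average
over them. -/
theorem expect_mem_randomSet (hn : n ≤ 2 ^ D) (hx : ∀ j, 0 ≤ x j ∧ x j ≤ 1) (i : Fin n) :
    expect (fun ω => if i ∈ randomSet D ω x then 1 else 0) = x i := by
  have hF : BddMeas fun ω => if i ∈ randomSet D ω x then (1 : ℝ) else 0 :=
    .indicator (measurableSet_randomSet D x i)
  rw [expect_merge {0, 1, 2} hF, ← expect_const (x i)]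
  congr 1
  ext ω'
  have e : ∀ ω, ∀ j < 3, mergeSeed {0, 1, 2} ω' ω j = ω' j := fun ω j hj =>
    mergeSeed_of_mem _ _ (by simp; omega)
  have e' : ∀ ω, ∀ j, 3 ≤ j → mergeSeed {0, 1, 2} ω' ω j = ω j := fun ω j hj =>
    mergeSeed_of_notMem _ _ (by simp; omega)
  have a1 : ∀ ω, hashMul D (mergeSeed {0, 1, 2} ω' ω) = hashMul D ω' := fun ω =>
    hashMul_congr (e ω 0 (by norm_num))
  have a2 : ∀ ω, threshold (mergeSeed {0, 1, 2} ω' ω) = threshold ω' := fun ω => by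
    unfold threshold; rw [e ω 1 (by norm_num)]
  have a3 : ∀ ω, cut (mergeSeed {0, 1, 2} ω' ω) = cut ω' := fun ω => by
    unfold cut; rw [e ω 2 (by norm_num)]
  have hodd := hashMul_odd D ω'
  have hT := (threshold_mem ω').2
  have a4 : ∀ ω, (if i ∈ randomSet D (mergeSeed {0, 1, 2} ω' ω) x then (1 : ℝ) else 0) =
      (leafCount (weights D (hashMul D ω') (cut ω') x) (threshold ω') ω (D + 1) 1
      (rootCount (weights D (hashMul D ω') (cut ω') x) ω (D + 1))
      (slot D (hashMul D ω') (cut ω') (x i) i) : ℝ) := by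
    intro ω
    have := leafCount_slot (τ := cut ω') hn hodd hT hx (mergeSeed {0, 1, 2} ω' ω) i
    rw [leafCount_congr_seed (fun j hj => e' ω j (by omega)),
      show rootCount (weights D (hashMul D ω') (cut ω') x) (mergeSeed {0, 1, 2} ω' ω) (D + 1) =
        rootCount (weights D (hashMul D ω') (cut ω') x) ω (D + 1) by
        unfold rootCount nodeUnif; rw [e' ω _ (by norm_num)]] at this
    rw [this, randomSet, a1, a2, a3]
    push_cast
    rfl
  simp only [a4]
  rw [expect_leafCount_root (weights_nonneg fun j => (hx j).1) hT (slot_div ..),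
    weights_slot hn hodd]

/-- Passing through the coordinatewise minimum makes both changes increases, and the two total
increases add up to the `ℓ₁` distance. -/
theorem expect_card_symmDiff_le {k K : ℕ} (hn : n ≤ 2 ^ D) (hx : ∀ j, 0 ≤ x j ∧ x j ≤ 1)
    (hy : ∀ j, 0 ≤ y j ∧ y j ≤ 1) (hkx : ∑ j, x j ≤ k) (hky : ∑ j, y j ≤ k) (hK : k ≤ 2 ^ K) :
    expect (fun ω => ((symmDiff (randomSet D ω x) (randomSet D ω y)).card : ℝ)) ≤
      (50 * K + 877) * ∑ j, |x j - y j| := by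
  have hz : ∀ j, 0 ≤ min (x j) (y j) := fun j => le_min (hx j).1 (hy j).1
  have Bx := bddMeas_treeCost_random hz (fun j => (hx j).1) D
  have By := bddMeas_treeCost_random hz (fun j => (hy j).1) D
  have h1 := expect_treeCost_random_le_of_le hn (fun j => (hx j).2) hkx hK hz
    fun j => min_le_left ..
  have h2 := expect_treeCost_random_le_of_le hn (fun j => (hy j).2) hky hK hz
    fun j => min_le_right ..
  have hle : expect (fun ω => ((symmDiff (randomSet D ω x) (randomSet D ω y)).card : ℝ)) ≤
      expect (fun ω => treeCost (weights D (hashMul D ω) (cut ω) fun j => min (x j) (y j))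
        (weights D (hashMul D ω) (cut ω) x) (threshold ω) ω (D + 1) +
        treeCost (weights D (hashMul D ω) (cut ω) fun j => min (x j) (y j))
        (weights D (hashMul D ω) (cut ω) y) (threshold ω) ω (D + 1)) := by
    refine integral_mono_of_nonneg (Filter.Eventually.of_forall fun ω => Nat.cast_nonneg _)
      (Bx.add By).integrable (Filter.Eventually.of_forall fun ω => ?_)
    have := card_symmDiff_sampler (τ := cut ω) hn (hashMul_odd D ω) (threshold_mem ω).2 hx hy ω
    refine this.trans ((treeCost_triangle _ (weights D (hashMul D ω) (cut ω)
      fun j => min (x j) (y j)) _ _ ω _).trans (le_of_eq ?_))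
    rw [treeCost_comm]
  rw [expect_add Bx By] at hle
  have : ∑ j, |x j - y j| = ∑ j, (x j - min (x j) (y j)) + ∑ j, (y j - min (x j) (y j)) := by
    rw [← Finset.sum_add_distrib]
    refine Finset.sum_congr rfl fun j _ => ?_
    rcases le_total (x j) (y j) with h | h
    · rw [min_eq_left h, abs_of_nonpos (by linarith)]; ring
    · rw [min_eq_right h, abs_of_nonneg (by linarith)]; ring
  rw [this, mul_add]
  linarith

theorem isCorrelatedSampling_randomSet {k : ℕ} (hn : n ≤ 2 ^ D) (hk : 1 ≤ k) {C : ℝ}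
    (hC : 1000 ≤ C) :
    IsCorrelatedSampling seedMeasure n k (C * max 1 (Real.logb 2 k)) (randomSet D) where
  measurable x _ i := measurableSet_randomSet D x i
  cardinality ω x hx := by
    have e : ∑ i, |x i| = ∑ i, x i := Finset.sum_congr rfl fun i _ => abs_of_nonneg (hx.1 i).1
    rw [e]
    exact card_sampler_cases hn (hashMul_odd D ω) (threshold_mem ω).2 hx.1 ω
  marginals x hx i := by
    rw [← expect_mem_randomSet hn hx.1 i]
    have e : (fun ω => if i ∈ randomSet D ω x then (1 : ℝ) else 0) =
        {ω | i ∈ randomSet D ω x}.indicator fun _ => 1 := by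
      ext ω; simp [Set.indicator_apply]
    rw [expect, e, integral_indicator (measurableSet_randomSet D x i), setIntegral_const,
      smul_eq_mul, mul_one, Measure.real, ENNReal.ofReal_toReal (measure_ne_top _ _)]
  stretch x hx y hy := by
    have e : ∀ z ∈ hypersimplex n k, ∑ i, z i ≤ k := fun z hz => by
      rw [Finset.sum_congr rfl fun i _ => (abs_of_nonneg (hz.1 i).1).symm]; exact hz.2
    refine (expect_card_symmDiff_le hn hx.1 hy.1 (e x hx) (e y hy)
      (Nat.le_pow_clog one_lt_two k)).trans (mul_le_mul_of_nonneg_right ?_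
      (Finset.sum_nonneg fun i _ => abs_nonneg _))
    have h1 : (Nat.clog 2 k : ℝ) ≤ Real.logb 2 k + 1 := by
      rw [← Real.natCeil_logb_natCast 2 k]
      exact (Nat.ceil_lt_add_one (Real.logb_nonneg one_lt_two (by exact_mod_cast hk))).le
    have h2 := le_max_left 1 (Real.logb 2 k)
    have h3 := le_max_right 1 (Real.logb 2 k)
    -- With `L = Real.logb 2 k`, the constant is at most `50 * (L + 1) + 877`, which is below `1000
    -- * max 1 L`.
    nlinarith

end Sampling

end CorrelatedSampling

namespace CorrelatedSampling

/-! ### Counts by depth -/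

/-- The count of the node `v` at depth `d` of a tree of height `H`. -/
noncomputable def nodeCount (w : ℕ → ℝ) (T : ℝ) (ω : Seed) (H : ℕ) : ℕ → ℕ → ℕ
  | 0, _ => rootCount w ω H
  | d + 1, v =>
    if v % 2 = 0 then nodeLeft w T ω (H - (d + 1)) (v / 2) (nodeCount w T ω H d (v / 2))
    else nodeCount w T ω H d (v / 2) -
      nodeLeft w T ω (H - (d + 1)) (v / 2) (nodeCount w T ω H d (v / 2))

/-- Links the recursive definition, which follows one leaf, to the level-by-level computation of all
counts at a given depth that the program performs. -/
theorem leafCount_nodeCount (w : ℕ → ℝ) (T : ℝ) (ω : Seed) {H d q : ℕ} (hd : d ≤ H)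
    (hq : q / 2 ^ H = 1) : leafCount w T ω H 1 (rootCount w ω H) q =
      leafCount w T ω (H - d) (q / 2 ^ (H - d)) (nodeCount w T ω H d (q / 2 ^ (H - d))) q := by
  induction d with
  | zero => rw [Nat.sub_zero, hq]; rfl
  | succ d ih =>
    rw [ih (by omega)]
    obtain ⟨h, hh⟩ : ∃ h, H - d = h + 1 := ⟨H - d - 1, by omega⟩
    have hh' : H - (d + 1) = h := by omega
    rw [hh, hh', leafCount, nodeCount, hh', ← div_two_pow_succ]
    rcases below_cases (q := q) (h := h) rfl with e | e
    · rw [if_pos e, if_pos (by omega), e]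
    · rw [if_neg (by omega), if_neg (by omega), e]

theorem leafCount_eq_nodeCount (w : ℕ → ℝ) (T : ℝ) (ω : Seed) {H q : ℕ} (hq : q / 2 ^ H = 1) :
    leafCount w T ω H 1 (rootCount w ω H) q = nodeCount w T ω H H q := by
  rw [leafCount_nodeCount w T ω le_rfl hq]
  simp [leafCount]

theorem admissible_nodeCount {w : ℕ → ℝ} (hw : ∀ q, 0 ≤ w q) {T : ℝ} (hT : T < 1) (ω : Seed)
    {H d v : ℕ} (hd : d ≤ H) (hv : v / 2 ^ d = 1) :
    Admissible (nodeSum w (H - d) v) (nodeCount w T ω H d v) := by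
  induction d generalizing v with
  | zero =>
    have : v = 1 := by simpa using hv
    subst this
    exact admissible_rootCount hw ω H
  | succ d ih =>
    have h := ih (v := v / 2) (by omega) (by rw [Nat.div_div_eq_div_mul, ← pow_succ', hv])
    obtain ⟨g, hg⟩ : ∃ g, H - d = g + 1 := ⟨H - d - 1, by omega⟩
    have hg' : H - (d + 1) = g := by omega
    rw [hg] at h
    obtain ⟨h1, h2, -⟩ := admissible_nodeLeft hw hT ω h
    rw [nodeCount, hg']
    split_ifs with hp
    · rwa [show 2 * (v / 2) = v by omega] at h1
    · rwa [show 2 * (v / 2) + 1 = v by omega] at h2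

/-! ### Running programs -/

section Write

variable {β : Type} {N : ℕ} {addr : ℕ → ℕ} {val : ℕ → β} {M : ℕ → β}

theorem parWrite_of_ne {j : ℕ} (h : ∀ i < N, addr i ≠ j) : parWrite N addr val M j = M j := by
  have : (List.range N).find? (fun i => addr i == j) = none := by
    rw [List.find?_eq_none]
    intro i hi
    simpa using h i (List.mem_range.1 hi)
  rw [parWrite, this]

theorem parWrite_apply (hinj : ∀ i < N, ∀ j < N, addr i = addr j → i = j) {i : ℕ} (hi : i < N) :
    parWrite N addr val M (addr i) = val i := by
  have : (List.range N).find? (fun l => addr l == addr i) = some i := by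
    cases hf : (List.range N).find? (fun l => addr l == addr i) with
    | none => exact absurd (List.find?_eq_none.1 hf i (List.mem_range.2 hi)) (by simp)
    | some l =>
      have h1 := List.find?_some hf
      have h2 := List.mem_range.1 (List.mem_of_find?_eq_some hf)
      rw [hinj l h2 i hi (by simpa using h1)]
  rw [parWrite, this]

theorem parWrite_block {A : ℕ} (h : ∀ i < N, addr i = A + i) (j : ℕ) :
    parWrite N addr val M j = if A ≤ j ∧ j < A + N then val (j - A) else M j := by
  split_ifs with hj
  · have e : addr (j - A) = j := by rw [h _ (by omega)]; omega
    have := parWrite_apply (addr := addr) (val := val) (M := M) (fun i hi l hl e => by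
      rw [h i hi, h l hl] at e; omega) (show j - A < N by omega)
    rwa [e] at this
  · exact parWrite_of_ne fun i hi e => hj (by rw [h i hi] at e; omega)

end Write

/-- The program `p` started in `s` halts in a memory with the property `Q`, with work at most `W`
and depth at most `D`. -/
def Runs (w : ℕ) (ω : Seed) (p : Program) (s : Mem) (Q : Mem → Prop) (W D : ℕ) : Prop :=
  ∃ s' W' D', Exec w ω p s s' W' D' ∧ W' ≤ W ∧ D' ≤ D ∧ Q s'

section Runs

variable {w : ℕ} {ω : Seed} {s : Mem} {Q R : Mem → Prop} {W D W' D' : ℕ}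

theorem Runs.seq {p q : Program} (hp : Runs w ω p s Q W D)
    (hq : ∀ s', Q s' → Runs w ω q s' R W' D') : Runs w ω (.seq p q) s R (W + W') (D + D') := by
  obtain ⟨s', W₁, D₁, h1, h2, h3, h4⟩ := hp
  obtain ⟨s'', W₂, D₂, g1, g2, g3, g4⟩ := hq s' h4
  exact ⟨s'', _, _, .seq h1 g1, by omega, by omega, g4⟩

theorem Runs.mono {p : Program} (hp : Runs w ω p s Q W D) (hW : W ≤ W') (hD : D ≤ D') :
    Runs w ω p s Q W' D' := by
  obtain ⟨s', W₁, D₁, h1, h2, h3, h4⟩ := hp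
  exact ⟨s', _, _, h1, h2.trans hW, h3.trans hD, h4⟩

theorem Runs.parW {N : Expr .word} {a : ℕ} {addr val : Expr .word} {ν κ : ℕ}
    (hN : N.eval w ω s 0 = ν) (hκ : N.size + addr.size + val.size + 2 ≤ κ)
    (hQ : Q (s.setW a (parWrite ν (fun i => addr.eval w ω s i) (fun i => val.eval w ω s i)
      (s.word a)))) : Runs w ω (.parW N a addr val) s Q (κ * (ν + 1)) κ := by
  subst hN
  refine ⟨_, _, _, .parW N a addr val s, ?_, by omega, hQ⟩
  have h := Nat.mul_le_mul_left (N.eval w ω s 0) (show addr.size + val.size + 1 ≤ κ by omega)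
  rw [Nat.mul_succ κ, Nat.mul_comm κ]
  omega

theorem Runs.parR {N : Expr .word} {a : ℕ} {addr : Expr .word} {val : Expr .real} {ν κ : ℕ}
    (hN : N.eval w ω s 0 = ν) (hκ : N.size + addr.size + val.size + 2 ≤ κ)
    (hQ : Q (s.setR a (parWrite ν (fun i => addr.eval w ω s i) (fun i => val.eval w ω s i)
      (s.real a)))) : Runs w ω (.parR N a addr val) s Q (κ * (ν + 1)) κ := by
  subst hN
  refine ⟨_, _, _, .parR N a addr val s, ?_, by omega, hQ⟩
  have h := Nat.mul_le_mul_left (N.eval w ω s 0) (show addr.size + val.size + 1 ≤ κ by omega)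
  rw [Nat.mul_succ κ, Nat.mul_comm κ]
  omega

/-- The work bound `V j` may vary with the iteration, so that geometrically changing level sizes add
up to linear work; the depth bound is uniform. -/
theorem Runs.while {c : Expr .bool} {p : Program} {I : ℕ → Mem → Prop} {J : ℕ} {V : ℕ → ℕ}
    {κ : ℕ} (hκ : c.size + 1 ≤ κ)
    (hstep : ∀ j < J, ∀ s, I j s → c.eval w ω s 0 ∧ Runs w ω p s (I (j + 1)) (V j) D)
    (hend : ∀ s, I J s → ¬ c.eval w ω s 0) (h0 : I 0 s) :
    Runs w ω (.while c p) s (I J) (∑ j ∈ Finset.range J, (V j + κ) + κ) (J * (D + κ) + κ) := by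
  induction J generalizing I V s with
  | zero => exact ⟨s, _, _, .whileFalse (hend s h0), by simpa using hκ, by simpa using hκ, h0⟩
  | succ J ih =>
    obtain ⟨hc, s', W₁, D₁, h1, h2, h3, h4⟩ := hstep 0 (Nat.succ_pos J) s h0
    obtain ⟨s'', W₂, D₂, g1, g2, g3, g4⟩ := ih (I := fun j => I (j + 1)) (V := fun j => V (j + 1))
      (fun j hj => hstep (j + 1) (by omega)) hend h4
    refine ⟨s'', _, _, .whileTrue hc h1 g1, ?_, ?_, g4⟩
    · rw [Finset.sum_range_succ']; omega
    · rw [Nat.succ_mul]; omega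

end Runs

section Eval

variable {w : ℕ} {ω : Seed} {s : Mem} {i : ℕ}

theorem eval_lit {v : ℕ} (h : v < 2 ^ w) : (Expr.lit v).eval w ω s i = v := Nat.mod_eq_of_lt h

theorem eval_pid : Expr.pid.eval w ω s i = i := rfl

theorem eval_loadW {a j v : ℕ} {e : Expr .word} (he : e.eval w ω s i = j) (h : s.word a j = v) :
    (Expr.loadW a e).eval w ω s i = v := by subst he; exact h

theorem eval_loadR {a j : ℕ} {v : ℝ} {e : Expr .word} (he : e.eval w ω s i = j)
    (h : s.real a j = v) : (Expr.loadR a e).eval w ω s i = v := by subst he; exact h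

theorem eval_addW {e f : Expr .word} {a b : ℕ} (he : e.eval w ω s i = a)
    (hf : f.eval w ω s i = b) (h : a + b < 2 ^ w) :
    (Expr.wop .add e f).eval w ω s i = a + b := by
  subst he hf; exact Nat.mod_eq_of_lt h

theorem eval_mulW {e f : Expr .word} {a b : ℕ} (he : e.eval w ω s i = a)
    (hf : f.eval w ω s i = b) (h : a * b < 2 ^ w) :
    (Expr.wop .mul e f).eval w ω s i = a * b := by
  subst he hf; exact Nat.mod_eq_of_lt h

theorem eval_subW {e f : Expr .word} {a b : ℕ} (he : e.eval w ω s i = a)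
    (hf : f.eval w ω s i = b) (hab : b ≤ a) (h : a < 2 ^ w) :
    (Expr.wop .sub e f).eval w ω s i = a - b := by
  subst he hf
  change (_ + 2 ^ w - _) % 2 ^ w = _
  rw [Nat.sub_add_comm hab, Nat.add_mod_right]
  exact Nat.mod_eq_of_lt (by omega)

theorem eval_divW {e f : Expr .word} {a b : ℕ} (he : e.eval w ω s i = a)
    (hf : f.eval w ω s i = b) : (Expr.wop .div e f).eval w ω s i = a / b := by subst he hf; rfl

theorem eval_modW {e f : Expr .word} {a b : ℕ} (he : e.eval w ω s i = a)
    (hf : f.eval w ω s i = b) : (Expr.wop .mod e f).eval w ω s i = a % b := by subst he hf; rfl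

theorem eval_addR {e f : Expr .real} {a b : ℝ} (he : e.eval w ω s i = a)
    (hf : f.eval w ω s i = b) : (Expr.rop .add e f).eval w ω s i = a + b := by subst he hf; rfl

theorem eval_subR {e f : Expr .real} {a b : ℝ} (he : e.eval w ω s i = a)
    (hf : f.eval w ω s i = b) : (Expr.rop .sub e f).eval w ω s i = a - b := by subst he hf; rfl

theorem eval_mulR {e f : Expr .real} {a b : ℝ} (he : e.eval w ω s i = a)
    (hf : f.eval w ω s i = b) : (Expr.rop .mul e f).eval w ω s i = a * b := by subst he hf; rfl

theorem eval_divR {e f : Expr .real} {a b : ℝ} (he : e.eval w ω s i = a)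
    (hf : f.eval w ω s i = b) : (Expr.rop .div e f).eval w ω s i = a / b := by subst he hf; rfl

theorem eval_ofWord {e : Expr .word} {a : ℕ} (he : e.eval w ω s i = a) :
    (Expr.ofWord e).eval w ω s i = (a : ℝ) := by subst he; rfl

theorem eval_randU {e : Expr .word} {a : ℕ} (he : e.eval w ω s i = a) :
    (Expr.randU e).eval w ω s i = (ω a : ℝ) := by subst he; rfl

theorem eval_randE {e : Expr .word} {a : ℕ} (he : e.eval w ω s i = a) :
    (Expr.randE e).eval w ω s i = - Real.log (ω a : ℝ) := by subst he; rfl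

theorem eval_ltW {e f : Expr .word} {a b : ℕ} (he : e.eval w ω s i = a)
    (hf : f.eval w ω s i = b) : (Expr.ltW e f).eval w ω s i ↔ a < b := by subst he hf; exact Iff.rfl

theorem eval_ltR {e f : Expr .real} {a b : ℝ} (he : e.eval w ω s i = a)
    (hf : f.eval w ω s i = b) : (Expr.ltR e f).eval w ω s i ↔ a < b := by subst he hf; exact Iff.rfl

theorem eval_cond {t : Ty} {c : Expr .bool} {e f : Expr t} {p : Prop} [Decidable p] {a b : t.Val}
    (hc : c.eval w ω s i ↔ p) (he : e.eval w ω s i = a) (hf : f.eval w ω s i = b) :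
    (Expr.cond c e f).eval w ω s i = if p then a else b := by
  subst he hf
  by_cases h : p
  · rw [if_pos h]; exact if_pos (hc.2 h)
  · rw [if_neg h]; exact if_neg fun h' => h (hc.1 h')

end Eval

end CorrelatedSampling

namespace CorrelatedSampling

/-! ### The program

Word arrays: `0` input, `1` output, `2` scalars (cell `0`: number of hash values, cell `1`:
multiplier, cell `2`: size of the current level), `3` ceilings, `4` counts of the nodes, `5` leaves
of the coordinates, `6` counts of the left children. Real arrays: `0` input, `1` weights,
`2` priorities. -/

namespace Prog

def sizeE : Expr .word := .loadW 0 (.lit 0)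

def widthE : Expr .word := .loadW 2 (.lit 0)

def mulE : Expr .word := .loadW 2 (.lit 1)

def levelE : Expr .word := .loadW 2 (.lit 2)

def natE (a : ℕ) : Expr .real := .ofWord (.lit a)

def thresholdE : Expr .real :=
  .rop .add (.rop .div (natE 3) (natE 4)) (.rop .div (.randU (.lit 1)) (natE 8))

def cutE : Expr .real :=
  .rop .add (.rop .div (natE 1) (natE 4)) (.rop .div (.randU (.lit 2)) (natE 4))

/-- The uniform variable of a node. -/
def unifE (v : Expr .word) : Expr .real :=
  .cond (.ltR (.randU (.wop .add v (.lit 3))) (natE 1)) (.randU (.wop .add v (.lit 3))) (natE 0)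

/-- The exponential variable of a leaf. -/
def clockE (q : Expr .word) : Expr .real :=
  .cond (.ltR (natE 0) (.randE (.wop .add q (.lit 3)))) (.randE (.wop .add q (.lit 3))) (natE 1)

def slotE : Expr .word :=
  .wop .add (.wop .add widthE widthE) (.wop .add (.wop .mod (.wop .mul mulE .pid) widthE)
    (.cond (.ltR cutE (.loadR 0 .pid)) widthE (.lit 0)))

/-- The node that a processor is responsible for. -/
def nodeE : Expr .word := .wop .add levelE .pid

def leftE : Expr .word := .wop .add nodeE nodeE

def rightE : Expr .word := .wop .add leftE (.lit 1)

def sumE : Expr .real := .rop .add (.loadR 1 leftE) (.loadR 1 rightE)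

def maxE : Expr .real :=
  .cond (.ltR (.loadR 2 leftE) (.loadR 2 rightE)) (.loadR 2 rightE) (.loadR 2 leftE)

def ceilE : Expr .word :=
  .wop .add (.wop .add (.loadW 3 leftE) (.loadW 3 rightE))
    (.cond (.ltR (.ofWord (.wop .add (.wop .add (.loadW 3 leftE) (.loadW 3 rightE)) (.lit 1))) sumE)
      (.lit 1) (.lit 0))

/-- The difference between the count and the weight of a node. -/
def excessE : Expr .real := .rop .sub (.ofWord (.loadW 4 nodeE)) sumE

def splitE : Expr .real :=
  .rop .sub (.rop .add (.loadR 1 leftE) (.cond (.ltR excessE (natE 0)) excessE (natE 0)))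
    (.rop .mul (.rop .sub (natE 1)
      (.cond (.ltR excessE (natE 0)) (.rop .sub (natE 0) excessE) excessE)) (unifE nodeE))

/-- `b` plus one if `b` is less than `h`. -/
def roundE (b : Expr .word) (h : Expr .real) : Expr .word :=
  .wop .add b (.cond (.ltR (.ofWord b) h) (.lit 1) (.lit 0))

def leftCountE : Expr .word :=
  .cond (.ltR thresholdE sumE) (roundE (.loadW 3 leftE) splitE)
    (.cond (.ltR (.loadR 2 leftE) (.loadR 2 rightE)) (.lit 0) (.loadW 4 nodeE))

def rootCountE : Expr .word :=
  roundE (.loadW 3 (.lit 1)) (.rop .sub (.loadR 1 (.lit 1)) (unifE (.lit 0)))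

/-- The node of the next level that a processor is responsible for. -/
def childE : Expr .word := .wop .add (.wop .add levelE levelE) .pid

def parentE : Expr .word := .wop .div childE (.lit 2)

def countE : Expr .word :=
  .cond (.ltW (.wop .mod childE (.lit 2)) (.lit 1)) (.loadW 6 parentE)
    (.wop .sub (.loadW 4 parentE) (.loadW 6 parentE))

def setScalar (j : ℕ) (e : Expr .word) : Program := .parW (.lit 1) 2 (.lit j) e

def widthLoop : Program := .while (.ltW widthE sizeE) (setScalar 0 (.wop .add widthE widthE))

def drawMul : Program :=
  setScalar 1 (.wop .add (.wop .mul (.lit 2) (.randW (.lit 0) widthE)) (.lit 1))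

def fillLeaves : Program :=
  .seq (.parW sizeE 5 .pid slotE) (.seq (.parR sizeE 1 (.loadW 5 .pid) (.loadR 0 .pid))
    (.parR sizeE 2 (.loadW 5 .pid) (.rop .div (.loadR 0 .pid) (clockE (.loadW 5 .pid)))))

def upBody : Program :=
  .seq (.parR levelE 1 nodeE sumE) (.seq (.parR levelE 2 nodeE maxE)
    (.seq (.parW levelE 3 nodeE ceilE) (setScalar 2 (.wop .div levelE (.lit 2)))))

def upLoop : Program := .while (.ltW (.lit 0) levelE) upBody

def downBody : Program :=
  .seq (.parW levelE 6 nodeE leftCountE)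
    (.seq (.parW (.wop .add levelE levelE) 4 childE countE)
      (setScalar 2 (.wop .add levelE levelE)))

def downLoop : Program := .while (.ltW levelE (.wop .add widthE widthE)) downBody

def sampling : Program :=
  .seq (setScalar 0 (.lit 1)) (.seq widthLoop (.seq drawMul (.seq fillLeaves
    (.seq (setScalar 2 widthE) (.seq upLoop (.seq (.parW (.lit 1) 4 (.lit 1) rootCountE)
      (.seq (setScalar 2 (.lit 1)) (.seq downLoop
        (.parW sizeE 1 .pid (.loadW 4 (.loadW 5 .pid)))))))))))

end Prog

/-- The machine cannot round a real to a word. A number in the unit interval below `s` has a ceiling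
that exceeds `⌈s⌉ - 1` by zero or one, so one comparison with the stored word decides it; for `s =
0` truncated subtraction gives the right base value. -/
theorem ceil_of_near {s h : ℝ} (hs : 0 ≤ s) (h1 : s - 1 < h) (h2 : h ≤ s) :
    ⌈h⌉₊ = (⌈s⌉₊ - 1) + if ((⌈s⌉₊ - 1 : ℕ) : ℝ) < h then 1 else 0 := by
  have c1 := Nat.le_ceil s
  have c2 := Nat.ceil_lt_add_one hs
  rcases Nat.eq_zero_or_pos ⌈s⌉₊ with h0 | h0
  · have hh : h ≤ 0 := h2.trans (Nat.ceil_eq_zero.1 h0)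
    rw [h0, Nat.ceil_eq_zero.2 hh, if_neg (by push_cast; linarith)]
  · obtain ⟨b, hb⟩ : ∃ b, ⌈s⌉₊ = b + 1 := ⟨⌈s⌉₊ - 1, by omega⟩
    rw [hb] at c1 c2 ⊢
    push_cast at c1 c2
    rw [Nat.add_sub_cancel]
    split_ifs with h3
    · rw [Nat.ceil_eq_iff (by omega)]
      push_cast
      constructor <;> linarith [show ((b + 1 - 1 : ℕ) : ℝ) = b by simp]
    · rcases Nat.eq_zero_or_pos b with hb0 | hb0
      · subst hb0
        exact Nat.ceil_eq_zero.2 (by simpa using h3)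
      · rw [add_zero, Nat.ceil_eq_iff hb0.ne', Nat.cast_pred hb0]
        exact ⟨by linarith, not_lt.1 h3⟩

/-- The stored word for a node is thus obtained from those of its children by one comparison. The
case of a child of weight zero is separate, since there `⌈0⌉ - 1` is truncated to zero. -/
theorem ceil_add_sub_one {a b : ℝ} (ha : 0 ≤ a) (hb : 0 ≤ b) :
    ⌈a + b⌉₊ - 1 = (⌈a⌉₊ - 1) + (⌈b⌉₊ - 1) +
      if (((⌈a⌉₊ - 1) + (⌈b⌉₊ - 1) + 1 : ℕ) : ℝ) < a + b then 1 else 0 := by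
  rcases ha.eq_or_lt with rfl | ha'
  · have := Nat.le_ceil b
    rw [zero_add, Nat.ceil_zero, Nat.zero_sub, zero_add, if_neg, add_zero]
    rw [not_lt]
    refine this.trans ?_
    exact_mod_cast (by omega)
  rcases hb.eq_or_lt with rfl | hb'
  · have := Nat.le_ceil a
    rw [add_zero, Nat.ceil_zero, Nat.zero_sub, add_zero, if_neg, add_zero]
    rw [not_lt]
    refine this.trans ?_
    exact_mod_cast (by omega)
  obtain ⟨c, hc⟩ : ∃ c, ⌈a⌉₊ = c + 1 := ⟨⌈a⌉₊ - 1, by have := Nat.ceil_pos.2 ha'; omega⟩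
  obtain ⟨d, hd⟩ : ∃ d, ⌈b⌉₊ = d + 1 := ⟨⌈b⌉₊ - 1, by have := Nat.ceil_pos.2 hb'; omega⟩
  have a1 := Nat.le_ceil a
  have a2 := Nat.ceil_lt_add_one ha
  have b1 := Nat.le_ceil b
  have b2 := Nat.ceil_lt_add_one hb
  rw [hc] at a1 a2
  rw [hd] at b1 b2
  push_cast at a1 a2 b1 b2
  have key : ⌈a + b⌉₊ = c + d + 1 + if ((c + d + 1 : ℕ) : ℝ) < a + b then 1 else 0 := by
    rw [Nat.ceil_eq_iff (by omega)]
    split_ifs with h <;> simp only [Nat.add_sub_cancel, add_zero] <;> push_cast at h ⊢ <;>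
      constructor <;> linarith
  rw [key, hc, hd, Nat.add_sub_cancel, Nat.add_sub_cancel]
  omega

/-! ### Memory invariants of the program -/

section States

variable {n : ℕ} (x : Fin n → ℝ) (ω : Seed) (D : ℕ)

/-- The weights of the leaves for the hash function and the cut of the seed. -/
noncomputable abbrev seedWeights : ℕ → ℝ := weights D (hashMul D ω) (cut ω) x

/-- The data that are kept from the moment the coordinates have been hashed. -/
structure Setup (s : Mem) : Prop where
  size : s.word 0 0 = n
  width : s.word 2 0 = 2 ^ D
  slots : ∀ i : Fin n, s.word 5 i = slot D (hashMul D ω) (cut ω) (x i) i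

/-- The weights of the nodes of height at most `j` have been computed. -/
def SumOK (j : ℕ) (s : Mem) : Prop := ∀ h ≤ j, ∀ v, 2 ^ (D + 1 - h) ≤ v → v < 2 * 2 ^ (D + 1 - h) →
  s.real 1 v = nodeSum (seedWeights x ω D) h v

/-- The priorities of the nodes of height at most `j` have been computed. -/
def MaxOK (j : ℕ) (s : Mem) : Prop := ∀ h ≤ j, ∀ v, 2 ^ (D + 1 - h) ≤ v → v < 2 * 2 ^ (D + 1 - h) →
  s.real 2 v = nodeMax (priority (seedWeights x ω D) ω) h v

/-- The ceilings of the nodes of height at most `j` have been computed. -/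
def CeilOK (j : ℕ) (s : Mem) : Prop := ∀ h ≤ j, ∀ v, 2 ^ (D + 1 - h) ≤ v →
  v < 2 * 2 ^ (D + 1 - h) → s.word 3 v = ⌈nodeSum (seedWeights x ω D) h v⌉₊ - 1

/-- The counts of the nodes at depth `j` have been computed. -/
def CountOK (j : ℕ) (s : Mem) : Prop := ∀ v, 2 ^ j ≤ v → v < 2 * 2 ^ j →
  s.word 4 v = nodeCount (seedWeights x ω D) (threshold ω) ω (D + 1) j v

variable {x ω D}

theorem Setup.setR {s : Mem} (hs : Setup x ω D s) (a : ℕ) (M : ℕ → ℝ) :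
    Setup x ω D (s.setR a M) := ⟨hs.size, hs.width, hs.slots⟩

theorem Setup.setW {s : Mem} (hs : Setup x ω D s) {a : ℕ} (M : ℕ → ℕ) (h0 : a ≠ 0) (h2 : a ≠ 2)
    (h5 : a ≠ 5) : Setup x ω D (s.setW a M) := by
  refine ⟨?_, ?_, ?_⟩ <;> simp only [Mem.setW, Function.update_of_ne h0.symm,
    Function.update_of_ne h2.symm, Function.update_of_ne h5.symm]
  exacts [hs.size, hs.width, hs.slots]

theorem Setup.setScalar {s : Mem} (hs : Setup x ω D s) {M : ℕ → ℕ} (hM : M 0 = s.word 2 0) :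
    Setup x ω D (s.setW 2 M) :=
  ⟨hs.size, hM.trans hs.width, hs.slots⟩

end States

end CorrelatedSampling

namespace CorrelatedSampling

/-- The numbers that occur in the program for `n` coordinates and `2 ^ D` hash values fit into
words of `W` bits. -/
structure Fits (n D W : ℕ) : Prop where
  width : 2 ^ D ≤ 2 * n
  word : 16 * (n + 2) ^ 2 ≤ 2 ^ W

/-! ### Word bounds, evaluation of the expressions, and one level of each pass -/

section Steps

variable {n D W : ℕ} {x : Fin n → ℝ} {ω : Seed} {s : Mem}

theorem Fits.lin (hF : Fits n D W) : 16 * n + 64 ≤ 2 ^ W := by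
  have := hF.word
  nlinarith

theorem Fits.lit (hF : Fits n D W) {v : ℕ} (hv : v ≤ 8) : v < 2 ^ W := by
  have := hF.lin; omega

theorem Fits.node (hF : Fits n D W) {v : ℕ} (hv : v < 4 * 2 ^ D + 8) : v < 2 ^ W := by
  have := hF.lin
  have := hF.width
  omega

theorem hashMul_lt (D : ℕ) (ω : Seed) : hashMul D ω < 2 * 2 ^ D := by
  have := Nat.two_pow_pos D
  unfold hashMul hashIndex
  omega

/-- The only product of two input-dependent numbers: a multiplier below `4 * n` times a coordinate
below `n`, which explains the quadratic bound in `Fits`. -/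
theorem Fits.mul (hF : Fits n D W) {a i : ℕ} (ha : a < 2 * 2 ^ D) (hi : i < n) : a * i < 2 ^ W := by
  have h1 := hF.word
  have h2 := hF.width
  have h3 : a * i ≤ (4 * n) * n := Nat.mul_le_mul (by omega) hi.le
  nlinarith

theorem nodeSum_seedWeights_le (hx : ∀ i, 0 ≤ x i ∧ x i ≤ 1) (h v : ℕ) :
    nodeSum (seedWeights x ω D) h v ≤ n := by
  rw [nodeSum_weights]
  refine (Finset.sum_le_sum (g := fun _ => (1 : ℝ)) fun i _ => ?_).trans (by simp)
  split_ifs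
  exacts [(hx i).2, zero_le_one]

theorem seedWeights_nonneg (hx : ∀ i, 0 ≤ x i ∧ x i ≤ 1) (q : ℕ) : 0 ≤ seedWeights x ω D q :=
  weights_nonneg (fun i => (hx i).1) q

theorem ceil_seedWeights_le (hx : ∀ i, 0 ≤ x i ∧ x i ≤ 1) (h v : ℕ) :
    ⌈nodeSum (seedWeights x ω D) h v⌉₊ - 1 ≤ n :=
  (Nat.sub_le _ _).trans (Nat.ceil_le.2 (nodeSum_seedWeights_le hx h v))

theorem nodeCount_le (hx : ∀ i, 0 ≤ x i ∧ x i ≤ 1) {j v : ℕ} (hj : j ≤ D + 1)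
    (hv : v / 2 ^ j = 1) :
    nodeCount (seedWeights x ω D) (threshold ω) ω (D + 1) j v ≤ n := by
  have h1 := abs_lt.1 (admissible_nodeCount (seedWeights_nonneg (ω := ω) (D := D) hx)
    (threshold_mem ω).2 ω hj hv)
  have h2 := nodeSum_seedWeights_le (ω := ω) (D := D) hx (D + 1 - j) v
  exact Nat.lt_succ_iff.1 (Nat.cast_lt (α := ℝ) |>.1 (by push_cast; linarith))

theorem div_two_pow_eq_one {v e : ℕ} (h1 : 2 ^ e ≤ v) (h2 : v < 2 * 2 ^ e) : v / 2 ^ e = 1 := by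
  rw [Nat.div_eq_iff (Nat.two_pow_pos e)]; omega

open Prog

variable {i L v : ℕ}

theorem eval_natE (hF : Fits n D W) {a : ℕ} (ha : a ≤ 8) : (natE a).eval W ω s i = (a : ℝ) :=
  eval_ofWord (eval_lit (hF.lit ha))

theorem eval_sizeE (hF : Fits n D W) (h : s.word 0 0 = n) : sizeE.eval W ω s i = n :=
  eval_loadW (eval_lit (hF.lit (by norm_num))) h

theorem eval_widthE (hF : Fits n D W) {m : ℕ} (h : s.word 2 0 = m) : widthE.eval W ω s i = m :=
  eval_loadW (eval_lit (hF.lit (by norm_num))) h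

theorem eval_levelE (hF : Fits n D W) (h : s.word 2 2 = L) : levelE.eval W ω s i = L :=
  eval_loadW (eval_lit (hF.lit (by norm_num))) h

theorem eval_thresholdE (hF : Fits n D W) : thresholdE.eval W ω s i = threshold ω := by
  have : thresholdE.eval W ω s i = ((3 : ℕ) : ℝ) / ((4 : ℕ) : ℝ) + (ω 1 : ℝ) / ((8 : ℕ) : ℝ) :=
    eval_addR (eval_divR (eval_natE hF (by norm_num)) (eval_natE hF (by norm_num)))
      (eval_divR (eval_randU (eval_lit (hF.lit (by norm_num)))) (eval_natE hF (by norm_num)))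
  rw [this, threshold]
  norm_num

theorem eval_cutE (hF : Fits n D W) : cutE.eval W ω s i = cut ω := by
  have : cutE.eval W ω s i = ((1 : ℕ) : ℝ) / ((4 : ℕ) : ℝ) + (ω 2 : ℝ) / ((4 : ℕ) : ℝ) :=
    eval_addR (eval_divR (eval_natE hF (by norm_num)) (eval_natE hF (by norm_num)))
      (eval_divR (eval_randU (eval_lit (hF.lit (by norm_num)))) (eval_natE hF (by norm_num)))
  rw [this, cut]
  norm_num

theorem eval_unifE (hF : Fits n D W) {e : Expr .word} (he : e.eval W ω s i = v)
    (hv : v + 3 < 2 ^ W) : (unifE e).eval W ω s i = nodeUnif ω v := by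
  have h1 : (Expr.randU (.wop .add e (.lit 3))).eval W ω s i = (ω (v + 3) : ℝ) :=
    eval_randU (eval_addW he (eval_lit (hF.lit (by norm_num))) hv)
  have : (unifE e).eval W ω s i =
      if (ω (v + 3) : ℝ) < ((1 : ℕ) : ℝ) then (ω (v + 3) : ℝ) else ((0 : ℕ) : ℝ) :=
    eval_cond (eval_ltR h1 (eval_natE hF (by norm_num))) h1 (eval_natE hF (by norm_num))
  rw [this, nodeUnif]
  norm_num

theorem eval_clockE (hF : Fits n D W) {e : Expr .word} (he : e.eval W ω s i = v)
    (hv : v + 3 < 2 ^ W) : (clockE e).eval W ω s i = clock ω v := by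
  have h1 : (Expr.randE (.wop .add e (.lit 3))).eval W ω s i = - Real.log (ω (v + 3) : ℝ) :=
    eval_randE (eval_addW he (eval_lit (hF.lit (by norm_num))) hv)
  have : (clockE e).eval W ω s i = if ((0 : ℕ) : ℝ) < - Real.log (ω (v + 3) : ℝ)
      then - Real.log (ω (v + 3) : ℝ) else ((1 : ℕ) : ℝ) :=
    eval_cond (eval_ltR (eval_natE hF (by norm_num)) h1) h1 (eval_natE hF (by norm_num))
  rw [this, clock, Nat.cast_zero, Nat.cast_one]

theorem eval_roundE (hF : Fits n D W) {b : ℕ} {r : ℝ} {e : Expr .word} {f : Expr .real}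
    (he : e.eval W ω s i = b) (hf : f.eval W ω s i = r) (hb : b ≤ n) :
    (roundE e f).eval W ω s i = b + if (b : ℝ) < r then 1 else 0 := by
  have := hF.lin
  refine eval_addW he (eval_cond (eval_ltR (eval_ofWord he) hf) (eval_lit (hF.lit (by norm_num)))
    (eval_lit (hF.lit (by norm_num)))) ?_
  split_ifs <;> omega

/-! #### Nodes and their children -/

theorem eval_nodeE (hF : Fits n D W) (hL : s.word 2 2 = L) (h : L + i < 4 * 2 ^ D) :
    nodeE.eval W ω s i = L + i :=
  eval_addW (eval_levelE hF hL) eval_pid (hF.node (by omega))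

theorem eval_leftE (hF : Fits n D W) (hL : s.word 2 2 = L) (h : 2 * (L + i) < 4 * 2 ^ D) :
    leftE.eval W ω s i = 2 * (L + i) := by
  rw [two_mul]
  have := eval_nodeE (ω := ω) hF hL (show L + i < 4 * 2 ^ D by omega)
  exact eval_addW this this (hF.node (by omega))

theorem eval_rightE (hF : Fits n D W) (hL : s.word 2 2 = L) (h : 2 * (L + i) < 4 * 2 ^ D) :
    rightE.eval W ω s i = 2 * (L + i) + 1 :=
  eval_addW (eval_leftE hF hL h) (eval_lit (hF.lit (by norm_num))) (hF.node (by omega))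

section Values

variable {sl sr rl rr : ℝ} {bl br N : ℕ}

theorem eval_sumE (hF : Fits n D W) (hL : s.word 2 2 = L) (h : 2 * (L + i) < 4 * 2 ^ D)
    (hl : s.real 1 (2 * (L + i)) = sl) (hr : s.real 1 (2 * (L + i) + 1) = sr) :
    sumE.eval W ω s i = sl + sr :=
  eval_addR (eval_loadR (eval_leftE hF hL h) hl) (eval_loadR (eval_rightE hF hL h) hr)

theorem eval_maxE (hF : Fits n D W) (hL : s.word 2 2 = L) (h : 2 * (L + i) < 4 * 2 ^ D)
    (hl : s.real 2 (2 * (L + i)) = rl) (hr : s.real 2 (2 * (L + i) + 1) = rr) :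
    maxE.eval W ω s i = max rl rr := by
  have e1 : (Expr.loadR 2 leftE).eval W ω s i = rl := eval_loadR (eval_leftE hF hL h) hl
  have e2 : (Expr.loadR 2 rightE).eval W ω s i = rr := eval_loadR (eval_rightE hF hL h) hr
  have : maxE.eval W ω s i = if rl < rr then rr else rl := eval_cond (eval_ltR e1 e2) e2 e1
  rw [this]
  split_ifs with hlt
  · rw [max_eq_right hlt.le]
  · rw [max_eq_left (not_lt.1 hlt)]

theorem eval_ceilE (hF : Fits n D W) (hL : s.word 2 2 = L) (h : 2 * (L + i) < 4 * 2 ^ D)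
    (hl : s.real 1 (2 * (L + i)) = sl) (hr : s.real 1 (2 * (L + i) + 1) = sr)
    (hbl : s.word 3 (2 * (L + i)) = bl) (hbr : s.word 3 (2 * (L + i) + 1) = br)
    (hbl' : bl ≤ n) (hbr' : br ≤ n) :
    ceilE.eval W ω s i = bl + br + if ((bl + br + 1 : ℕ) : ℝ) < sl + sr then 1 else 0 := by
  have := hF.lin
  have e1 : (Expr.wop .add (.loadW 3 leftE) (.loadW 3 rightE)).eval W ω s i = bl + br :=
    eval_addW (eval_loadW (eval_leftE hF hL h) hbl) (eval_loadW (eval_rightE hF hL h) hbr)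
      (by omega)
  have o1 : (Expr.lit 1).eval W ω s i = 1 := eval_lit (hF.lit (by norm_num))
  refine eval_addW e1 (eval_cond (eval_ltR (eval_ofWord (eval_addW e1 o1 (by omega)))
    (eval_sumE hF hL h hl hr)) o1 (eval_lit (hF.lit (by norm_num)))) ?_
  split_ifs <;> omega

theorem eval_splitE (hF : Fits n D W) (hL : s.word 2 2 = L) (h : 2 * (L + i) < 4 * 2 ^ D)
    (hl : s.real 1 (2 * (L + i)) = sl) (hr : s.real 1 (2 * (L + i) + 1) = sr)
    (hN : s.word 4 (L + i) = N) :
    splitE.eval W ω s i = splitPoint (nodeUnif ω (L + i)) sl sr N := by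
  have hv := eval_nodeE (ω := ω) hF hL (show L + i < 4 * 2 ^ D by omega)
  have hd : excessE.eval W ω s i = (N : ℝ) - (sl + sr) :=
    eval_subR (eval_ofWord (eval_loadW hv hN)) (eval_sumE hF hL h hl hr)
  have z : (natE 0).eval W ω s i = ((0 : ℕ) : ℝ) := eval_natE hF (by norm_num)
  have hlt := eval_ltR hd z
  have : splitE.eval W ω s i = (sl + if (N : ℝ) - (sl + sr) < ((0 : ℕ) : ℝ)
      then (N : ℝ) - (sl + sr) else ((0 : ℕ) : ℝ)) - (((1 : ℕ) : ℝ) -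
        if (N : ℝ) - (sl + sr) < ((0 : ℕ) : ℝ) then ((0 : ℕ) : ℝ) - ((N : ℝ) - (sl + sr))
        else (N : ℝ) - (sl + sr)) * nodeUnif ω (L + i) :=
    eval_subR (eval_addR (eval_loadR (eval_leftE hF hL h) hl) (eval_cond hlt hd z))
      (eval_mulR (eval_subR (eval_natE hF (by norm_num)) (eval_cond hlt (eval_subR z hd) hd))
        (eval_unifE hF hv (hF.node (by omega))))
  rw [this, splitPoint, Nat.cast_zero, Nat.cast_one, zero_sub]
  rcases lt_or_ge ((N : ℝ) - (sl + sr)) 0 with hd0 | hd0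
  · rw [if_pos hd0, if_pos hd0, min_eq_left hd0.le, abs_of_neg hd0]
  · rw [if_neg (not_lt.2 hd0), if_neg (not_lt.2 hd0), min_eq_right hd0, abs_of_nonneg hd0]

/-- The split point lies in the unit interval below `sl`, so the stored ceiling of the left child
and one comparison yield its ceiling. The truncation of `leftCount` at `N` need not be computed, by
`leftCount_big`. -/
theorem eval_leftCountE (hF : Fits n D W) (hL : s.word 2 2 = L) (h : 2 * (L + i) < 4 * 2 ^ D)
    (hl : s.real 1 (2 * (L + i)) = sl) (hr : s.real 1 (2 * (L + i) + 1) = sr)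
    (hrl : s.real 2 (2 * (L + i)) = rl) (hrr : s.real 2 (2 * (L + i) + 1) = rr)
    (hb : s.word 3 (2 * (L + i)) = ⌈sl⌉₊ - 1) (hN : s.word 4 (L + i) = N)
    (hl0 : 0 ≤ sl) (hr0 : 0 ≤ sr) (hbn : ⌈sl⌉₊ - 1 ≤ n) (hA : Admissible (sl + sr) N) :
    leftCountE.eval W ω s i = leftCount (threshold ω) (nodeUnif ω (L + i)) sl sr rl rr N := by
  have hv := eval_nodeE (ω := ω) hF hL (show L + i < 4 * 2 ^ D by omega)
  have hsp := eval_splitE (ω := ω) hF hL h hl hr hN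
  obtain ⟨u0, u1⟩ := nodeUnif_mem ω (L + i)
  have hA' := abs_lt.1 hA
  have this : leftCountE.eval W ω s i = if threshold ω < sl + sr then
      (⌈sl⌉₊ - 1) + (if ((⌈sl⌉₊ - 1 : ℕ) : ℝ) < splitPoint (nodeUnif ω (L + i)) sl sr N
        then 1 else 0) else if rl < rr then 0 else N :=
    eval_cond (eval_ltR (eval_thresholdE hF) (eval_sumE hF hL h hl hr))
      (eval_roundE hF (eval_loadW (eval_leftE hF hL h) hb) hsp hbn)
      (eval_cond (eval_ltR (eval_loadR (eval_leftE hF hL h) hrl)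
        (eval_loadR (eval_rightE hF hL h) hrr)) (eval_lit (hF.lit (by norm_num)))
        (eval_loadW hv hN))
  rw [this]
  rcases lt_or_ge (threshold ω) (sl + sr) with hT | hT
  · rw [if_pos hT, leftCount_big u0 hr0 hA.le hT, ← ceil_of_near hl0
      (lt_splitPoint u1 hA'.1 hA'.2.le) (splitPoint_le u0 hA.le)]
  · rw [if_neg (not_lt.2 hT), leftCount, if_pos hT]
    rcases lt_or_ge rl rr with hr | hr
    · rw [if_pos hr, if_neg (not_le.2 hr)]
    · rw [if_neg (not_lt.2 hr), if_pos hr]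

end Values

/-! #### The loops -/

/-- A parallel step of the upward pass completes one more level. -/
theorem level_step {β : Type} {A : ℕ → β} {f : ℕ → ℕ → β} {j : ℕ} (hj : j ≤ D)
    {addr : ℕ → ℕ} {val : ℕ → β} (haddr : ∀ i < 2 ^ (D - j), addr i = 2 ^ (D - j) + i)
    (hval : ∀ i < 2 ^ (D - j), val i = f (j + 1) (2 ^ (D - j) + i))
    (hA : ∀ h ≤ j, ∀ v, 2 ^ (D + 1 - h) ≤ v → v < 2 * 2 ^ (D + 1 - h) → A v = f h v) :
    ∀ h ≤ j + 1, ∀ v, 2 ^ (D + 1 - h) ≤ v → v < 2 * 2 ^ (D + 1 - h) →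
      parWrite (2 ^ (D - j)) addr val A v = f h v := by
  intro h hh v h1 h2
  rw [parWrite_block haddr]
  rcases Nat.lt_or_ge j h with hjh | hjh
  · obtain rfl : h = j + 1 := by omega
    rw [Nat.add_sub_add_right] at h1 h2
    rw [if_pos ⟨h1, by omega⟩, hval _ (by omega), Nat.add_sub_cancel' h1]
  · have : 2 ^ (D + 1 - j) ≤ 2 ^ (D + 1 - h) := Nat.pow_le_pow_right (by norm_num) (by omega)
    rw [show D + 1 - j = D - j + 1 by omega, pow_succ] at this
    rw [if_neg (by omega), hA h hjh v h1 h2]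

theorem two_pow_level {j : ℕ} (hj : j ≤ D) : 2 ^ (D + 1 - j) = 2 * 2 ^ (D - j) := by
  rw [show D + 1 - j = D - j + 1 by omega, pow_succ, mul_comm]

theorem runs_setScalar (hF : Fits n D W) {j : ℕ} (hj : j ≤ 8) {e : Expr .word}
    (he : e.eval W ω s 0 = v) (hκ : e.size ≤ 400) {Q : Mem → Prop}
    (hQ : ∀ M : ℕ → ℕ, M j = v → (∀ l ≠ j, M l = s.word 2 l) → Q (s.setW 2 M)) :
    Runs W ω (setScalar j e) s Q 1000 500 := by
  refine Runs.parW (ν := 1) (κ := 500) (eval_lit (hF.lit (by norm_num)))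
    (by simp only [Expr.size]; omega) (hQ _ ?_ fun l hl => ?_)
  · rw [parWrite_block (A := j) fun i hi => by
      rw [eval_lit (hF.lit hj), Nat.lt_one_iff.1 hi, add_zero]]
    simp [he]
  · exact parWrite_of_ne fun i _ => by rw [eval_lit (hF.lit hj)]; exact hl.symm

/-- The state of the upward pass after `j` levels. -/
structure Up (x : Fin n → ℝ) (ω : Seed) (D j : ℕ) (s : Mem) : Prop where
  setup : Setup x ω D s
  level : s.word 2 2 = 2 ^ D / 2 ^ j
  sums : SumOK x ω D j s
  maxs : MaxOK x ω D j s
  ceils : CeilOK x ω D j s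

theorem runs_upBody (hF : Fits n D W) (hx : ∀ i, 0 ≤ x i ∧ x i ≤ 1) {j : ℕ} (hj : j ≤ D)
    (hs : Up x ω D j s) :
    Runs W ω upBody s (Up x ω D (j + 1)) (1500 * (2 ^ (D - j) + 1) + 1000) 2000 := by
  have hp := two_pow_level hj
  have hLD : 2 ^ (D - j) ≤ 2 ^ D := Nat.pow_le_pow_right (by norm_num) (by omega)
  have hL : 2 ^ D / 2 ^ j = 2 ^ (D - j) := Nat.pow_div hj (by norm_num)
  have hb : ∀ i < 2 ^ (D - j), 2 * (2 ^ (D - j) + i) < 4 * 2 ^ D := fun i hi => by omega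
  have hnode : ∀ s' : Mem, s'.word 2 2 = 2 ^ D / 2 ^ j → ∀ i < 2 ^ (D - j),
      nodeE.eval W ω s' i = 2 ^ (D - j) + i := fun s' h i hi =>
    eval_nodeE hF (h.trans hL) (by have := hb i hi; omega)
  have lo : ∀ i < 2 ^ (D - j), 2 ^ (D + 1 - j) ≤ 2 * (2 ^ (D - j) + i) := fun i _ => by omega
  have hi' : ∀ i < 2 ^ (D - j), 2 * (2 ^ (D - j) + i) + 1 < 2 * 2 ^ (D + 1 - j) :=
    fun i _ => by omega
  have w0 := seedWeights_nonneg (ω := ω) (D := D) hx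
  have r1 : Runs W ω (.parR levelE 1 nodeE sumE) s (fun s' => Setup x ω D s' ∧
      s'.word 2 2 = 2 ^ D / 2 ^ j ∧ SumOK x ω D (j + 1) s' ∧ MaxOK x ω D j s' ∧ CeilOK x ω D j s')
      (500 * (2 ^ (D - j) + 1)) 500 := by
    refine Runs.parR (eval_levelE hF (hs.level.trans hL)) (by decide)
      ⟨hs.setup.setR _ _, hs.level, ?_, hs.maxs, hs.ceils⟩
    refine level_step hj (hnode s hs.level) (fun i hi => ?_) hs.sums
    exact eval_sumE hF (hs.level.trans hL) (hb i hi)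
      (hs.sums j le_rfl _ (lo i hi) (by have := hi' i hi; omega))
      (hs.sums j le_rfl _ (by have := lo i hi; omega) (hi' i hi))
  have r2 : ∀ s', (Setup x ω D s' ∧ s'.word 2 2 = 2 ^ D / 2 ^ j ∧ SumOK x ω D (j + 1) s' ∧
      MaxOK x ω D j s' ∧ CeilOK x ω D j s') → Runs W ω (.parR levelE 2 nodeE maxE) s'
      (fun s' => Setup x ω D s' ∧ s'.word 2 2 = 2 ^ D / 2 ^ j ∧ SumOK x ω D (j + 1) s' ∧
        MaxOK x ω D (j + 1) s' ∧ CeilOK x ω D j s') (500 * (2 ^ (D - j) + 1)) 500 := by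
    rintro s' ⟨h1, h2, h3, h4, h5⟩
    refine Runs.parR (eval_levelE hF (h2.trans hL)) (by decide) ⟨h1.setR _ _, h2, h3, ?_, h5⟩
    refine level_step hj (hnode s' h2) (fun i hi => ?_) h4
    exact eval_maxE hF (h2.trans hL) (hb i hi)
      (h4 j le_rfl _ (lo i hi) (by have := hi' i hi; omega))
      (h4 j le_rfl _ (by have := lo i hi; omega) (hi' i hi))
  have r3 : ∀ s', (Setup x ω D s' ∧ s'.word 2 2 = 2 ^ D / 2 ^ j ∧ SumOK x ω D (j + 1) s' ∧
      MaxOK x ω D (j + 1) s' ∧ CeilOK x ω D j s') → Runs W ω (.parW levelE 3 nodeE ceilE) s'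
      (fun s' => Setup x ω D s' ∧ s'.word 2 2 = 2 ^ D / 2 ^ j ∧ SumOK x ω D (j + 1) s' ∧
        MaxOK x ω D (j + 1) s' ∧ CeilOK x ω D (j + 1) s') (500 * (2 ^ (D - j) + 1)) 500 := by
    rintro s' ⟨h1, h2, h3, h4, h5⟩
    refine Runs.parW (eval_levelE hF (h2.trans hL)) (by decide)
      ⟨h1.setW _ (by decide) (by decide) (by decide), h2, h3, h4, ?_⟩
    refine level_step (f := fun h v => ⌈nodeSum (seedWeights x ω D) h v⌉₊ - 1) hj (hnode s' h2)
      (fun i hi => ?_) h5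
    refine (eval_ceilE hF (h2.trans hL) (hb i hi)
      (h3 j (by omega) _ (lo i hi) (by have := hi' i hi; omega))
      (h3 j (by omega) _ (by have := lo i hi; omega) (hi' i hi))
      (h5 j le_rfl _ (lo i hi) (by have := hi' i hi; omega))
      (h5 j le_rfl _ (by have := lo i hi; omega) (hi' i hi))
      (ceil_seedWeights_le hx _ _) (ceil_seedWeights_le hx _ _)).trans ?_
    exact (ceil_add_sub_one (nodeSum_nonneg w0) (nodeSum_nonneg w0)).symm
  have r4 : ∀ s', (Setup x ω D s' ∧ s'.word 2 2 = 2 ^ D / 2 ^ j ∧ SumOK x ω D (j + 1) s' ∧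
      MaxOK x ω D (j + 1) s' ∧ CeilOK x ω D (j + 1) s') →
      Runs W ω (setScalar 2 (.wop .div levelE (.lit 2))) s' (Up x ω D (j + 1)) 1000 500 := by
    rintro s' ⟨h1, h2, h3, h4, h5⟩
    refine runs_setScalar hF (by norm_num) (eval_divW (eval_levelE hF h2)
      (eval_lit (hF.lit (by norm_num)))) (by decide) fun M hM hM' => ?_
    refine ⟨h1.setScalar (hM' 0 (by decide)), ?_, h3, h4, h5⟩
    exact hM.trans (by rw [Nat.div_div_eq_div_mul, ← pow_succ])
  exact (r1.seq fun s1 q1 => (r2 s1 q1).seq fun s2 q2 => (r3 s2 q2).seq r4).mono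
    (by omega) (by omega)

/-- The state of the downward pass after `j` levels. -/
structure Down (x : Fin n → ℝ) (ω : Seed) (D j : ℕ) (s : Mem) : Prop where
  setup : Setup x ω D s
  level : s.word 2 2 = 2 ^ j
  sums : SumOK x ω D (D + 1) s
  maxs : MaxOK x ω D (D + 1) s
  ceils : CeilOK x ω D (D + 1) s
  counts : CountOK x ω D j s

theorem runs_downBody (hF : Fits n D W) (hx : ∀ i, 0 ≤ x i ∧ x i ≤ 1) {j : ℕ} (hj : j ≤ D)
    (hs : Down x ω D j s) :
    Runs W ω downBody s (Down x ω D (j + 1)) (1500 * 2 ^ j + 2000) 1500 := by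
  have hLD : 2 ^ j ≤ 2 ^ D := Nat.pow_le_pow_right (by norm_num) hj
  have w0 := seedWeights_nonneg (ω := ω) (D := D) hx
  have hp : 2 ^ (D + 1 - (D - j)) = 2 * 2 ^ j := by
    rw [show D + 1 - (D - j) = j + 1 by omega, pow_succ, mul_comm]
  have hbl : ∀ i < 2 ^ j, 2 * (2 ^ j + i) < 4 * 2 ^ D := fun i hi => by omega
  have hll : (Expr.wop .add levelE levelE).eval W ω s 0 = 2 ^ j + 2 ^ j :=
    eval_addW (eval_levelE hF hs.level) (eval_levelE hF hs.level) (hF.node (by omega))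
  have r1 : Runs W ω (.parW levelE 6 nodeE leftCountE) s (fun s' => Down x ω D j s' ∧
      ∀ v, 2 ^ j ≤ v → v < 2 * 2 ^ j → s'.word 6 v = nodeLeft (seedWeights x ω D) (threshold ω) ω
        (D - j) v (nodeCount (seedWeights x ω D) (threshold ω) ω (D + 1) j v))
      (500 * (2 ^ j + 1)) 500 := by
    refine Runs.parW (eval_levelE hF hs.level) (by decide)
      ⟨⟨hs.setup.setW _ (by decide) (by decide) (by decide), hs.level, hs.sums, hs.maxs, hs.ceils,
        hs.counts⟩, fun v h1 h2 => ?_⟩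
    change parWrite _ _ _ _ v = _
    rw [parWrite_block (A := 2 ^ j) fun i hi => eval_nodeE hF hs.level (by omega),
      if_pos ⟨h1, by omega⟩]
    obtain ⟨i, rfl⟩ := Nat.exists_eq_add_of_le h1
    rw [Nat.add_sub_cancel_left]
    have hi : i < 2 ^ j := by omega
    have hA := admissible_nodeCount w0 (threshold_mem ω).2 ω (show j ≤ D + 1 by omega)
      (div_two_pow_eq_one h1 h2)
    rw [show D + 1 - j = D - j + 1 by omega] at hA
    exact eval_leftCountE hF hs.level (hbl i hi)
      (hs.sums (D - j) (by omega) _ (by omega) (by omega))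
      (hs.sums (D - j) (by omega) _ (by omega) (by omega))
      (hs.maxs (D - j) (by omega) _ (by omega) (by omega))
      (hs.maxs (D - j) (by omega) _ (by omega) (by omega))
      (hs.ceils (D - j) (by omega) _ (by omega) (by omega)) (hs.counts _ h1 h2)
      (nodeSum_nonneg w0) (nodeSum_nonneg w0) (ceil_seedWeights_le hx _ _) hA
  have r2 : ∀ s', (Down x ω D j s' ∧ ∀ v, 2 ^ j ≤ v → v < 2 * 2 ^ j → s'.word 6 v =
      nodeLeft (seedWeights x ω D) (threshold ω) ω (D - j) v
        (nodeCount (seedWeights x ω D) (threshold ω) ω (D + 1) j v)) →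
      Runs W ω (.parW (.wop .add levelE levelE) 4 childE countE) s' (fun s' => Setup x ω D s' ∧
        s'.word 2 2 = 2 ^ j ∧ SumOK x ω D (D + 1) s' ∧ MaxOK x ω D (D + 1) s' ∧
        CeilOK x ω D (D + 1) s' ∧ CountOK x ω D (j + 1) s') (500 * (2 ^ j + 2 ^ j + 1)) 500 := by
    rintro s' ⟨h, h6⟩
    have hll' : ∀ i, (Expr.wop .add levelE levelE).eval W ω s' i = 2 ^ j + 2 ^ j := fun i =>
      eval_addW (eval_levelE hF h.level) (eval_levelE hF h.level) (hF.node (by omega))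
    have hc : ∀ i < 2 ^ j + 2 ^ j, childE.eval W ω s' i = 2 ^ j + 2 ^ j + i := fun i hi =>
      eval_addW (hll' i) eval_pid (hF.node (by omega))
    refine Runs.parW (hll' 0) (by decide)
      ⟨h.setup.setW _ (by decide) (by decide) (by decide), h.level, h.sums, h.maxs, h.ceils,
        fun v h1 h2 => ?_⟩
    change parWrite _ _ _ _ v = _
    rw [pow_succ] at h1 h2
    rw [parWrite_block (A := 2 ^ j + 2 ^ j) hc, if_pos ⟨by omega, by omega⟩]
    have hv : childE.eval W ω s' (v - (2 ^ j + 2 ^ j)) = v :=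
      (hc (v - (2 ^ j + 2 ^ j)) (by omega)).trans (Nat.add_sub_cancel' (by omega))
    have e2 : (Expr.lit 2).eval W ω s' (v - (2 ^ j + 2 ^ j)) = 2 :=
      eval_lit (hF.lit (by norm_num))
    have hpar : parentE.eval W ω s' (v - (2 ^ j + 2 ^ j)) = v / 2 := eval_divW hv e2
    have l1 : 2 ^ j ≤ v / 2 := by omega
    have l2 : v / 2 < 2 * 2 ^ j := by omega
    have hle := nodeCount_le (ω := ω) hx (show j ≤ D + 1 by omega) (div_two_pow_eq_one l1 l2)
    have e3 : countE.eval W ω s' (v - (2 ^ j + 2 ^ j)) = if v % 2 < 1 then _ else _ :=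
      eval_cond (eval_ltW (eval_modW hv e2) (eval_lit (hF.lit (by norm_num))))
        (eval_loadW hpar (h6 _ l1 l2)) (eval_subW (eval_loadW hpar (h.counts _ l1 l2))
          (eval_loadW hpar (h6 _ l1 l2)) (nodeLeft_le ..) (by have := hF.lin; omega))
    rw [e3, nodeCount, Nat.add_sub_add_right]
    exact if_congr Nat.lt_one_iff rfl rfl
  have r3 : ∀ s', (Setup x ω D s' ∧ s'.word 2 2 = 2 ^ j ∧ SumOK x ω D (D + 1) s' ∧
      MaxOK x ω D (D + 1) s' ∧ CeilOK x ω D (D + 1) s' ∧ CountOK x ω D (j + 1) s') →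
      Runs W ω (setScalar 2 (.wop .add levelE levelE)) s' (Down x ω D (j + 1)) 1000 500 := by
    rintro s' ⟨h1, h2, h3, h4, h5, h6⟩
    refine runs_setScalar hF (by norm_num) (eval_addW (eval_levelE hF h2) (eval_levelE hF h2)
      (hF.node (by omega))) (by decide) fun M hM hM' => ?_
    exact ⟨h1.setScalar (hM' 0 (by decide)), hM.trans (by rw [pow_succ, mul_two]), h3, h4, h5, h6⟩
  exact (r1.seq fun s1 q1 => (r2 s1 q1).seq r3).mono (by omega) (by omega)

end Steps

end CorrelatedSampling

namespace CorrelatedSampling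

/-! ### The phases of the program and their composition -/

section Run

open Prog

variable {n D W : ℕ} {x : Fin n → ℝ} {ω : Seed} {s : Mem}

theorem eval_randW {e f : Expr .word} {i a b : ℕ} (he : e.eval W ω s i = a)
    (hf : f.eval W ω s i = b) :
    (Expr.randW e f).eval W ω s i = min ⌊(b : ℝ) * (ω a : ℝ)⌋₊ (b - 1) := by subst he hf; rfl

/-- The state before the coordinates are hashed, with `m` in the first scalar. -/
structure Fresh (x : Fin n → ℝ) (m : ℕ) (s : Mem) : Prop where
  size : s.word 0 0 = n
  input : ∀ i : Fin n, s.real 0 i = x i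
  weights : ∀ v, s.real 1 v = 0
  priorities : ∀ v, s.real 2 v = 0
  ceils : ∀ v, s.word 3 v = 0
  width : s.word 2 0 = m

theorem runs_widthLoop (hF : Fits n (Nat.clog 2 n) W) (hs : Fresh x 1 s) :
    Runs W ω widthLoop s (Fresh x (2 ^ Nat.clog 2 n)) (1500 * Nat.clog 2 n + 500)
      (1000 * Nat.clog 2 n + 500) := by
  refine (Runs.while (I := fun j => Fresh x (2 ^ j)) (J := Nat.clog 2 n) (V := fun _ => 1000)
    (κ := 500) (D := 500) (by decide) (fun j hj s hs => ⟨?_, ?_⟩) (fun s hs => ?_)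
    (by simpa using hs)).mono (by simp; omega) (by omega)
  · rw [eval_ltW (eval_widthE hF hs.width) (eval_sizeE hF hs.size)]
    exact (Nat.lt_clog_iff_pow_lt one_lt_two).1 hj
  · have hlt : 2 ^ j < 2 ^ Nat.clog 2 n := Nat.pow_lt_pow_right one_lt_two hj
    refine runs_setScalar hF (by norm_num) (eval_addW (eval_widthE hF hs.width)
      (eval_widthE hF hs.width) (hF.node (by omega))) (by decide) fun M hM _ =>
      ⟨hs.size, hs.input, hs.weights, hs.priorities, hs.ceils, ?_⟩
    exact hM.trans (by rw [pow_succ, mul_two])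
  · rw [eval_ltW (eval_widthE hF hs.width) (eval_sizeE hF hs.size), not_lt]
    exact Nat.le_pow_clog one_lt_two n

theorem runs_drawMul (hF : Fits n D W) (hs : Fresh x (2 ^ D) s) :
    Runs W ω drawMul s (fun s => Fresh x (2 ^ D) s ∧ s.word 2 1 = hashMul D ω) 1000 500 := by
  have h := hashMul_lt D ω
  have h2 : 2 * hashIndex D ω + 1 < 2 * 2 ^ D := h
  have e : (Expr.wop .add (.wop .mul (.lit 2) (.randW (.lit 0) widthE)) (.lit 1)).eval W ω s 0 =
      2 * hashIndex D ω + 1 :=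
    eval_addW (eval_mulW (eval_lit (hF.lit (by norm_num)))
      (eval_randW (eval_lit (hF.lit (by norm_num))) (eval_widthE hF hs.width))
      (hF.node (by change 2 * hashIndex D ω < _; omega))) (eval_lit (hF.lit (by norm_num)))
      (hF.node (by change 2 * hashIndex D ω + 1 < _; omega))
  refine runs_setScalar hF (by norm_num) e (by decide) fun M hM hM' => ⟨⟨hs.size, hs.input,
    hs.weights, hs.priorities, hs.ceils, ?_⟩, hM⟩
  exact (hM' 0 (by decide)).trans hs.width

theorem runs_slots (hF : Fits n D W) (hs : Fresh x (2 ^ D) s) (ha : s.word 2 1 = hashMul D ω) :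
    Runs W ω (.parW sizeE 5 .pid slotE) s (fun s => Fresh x (2 ^ D) s ∧ Setup x ω D s)
      (500 * (n + 1)) 500 := by
  refine Runs.parW (eval_sizeE hF hs.size) (by decide) ⟨⟨hs.size, hs.input, hs.weights,
    hs.priorities, hs.ceils, hs.width⟩, hs.size, hs.width, fun i => ?_⟩
  change parWrite _ _ _ _ (i : ℕ) = _
  rw [parWrite_block (A := 0) fun i _ => by rw [eval_pid, zero_add],
    if_pos ⟨Nat.zero_le _, by omega⟩, Nat.sub_zero]
  have ew : widthE.eval W ω s i = 2 ^ D := eval_widthE hF hs.width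
  have e1 : (Expr.wop .add widthE widthE).eval W ω s i = 2 ^ (D + 1) := by
    rw [pow_succ, mul_two]
    exact eval_addW ew ew (hF.node (by omega))
  have hm := Nat.mod_lt (hashMul D ω * i) (Nat.two_pow_pos D)
  have e2 : (Expr.cond (.ltR cutE (.loadR 0 .pid)) widthE (.lit 0)).eval W ω s i =
      if cut ω < x i then 2 ^ D else 0 :=
    eval_cond (eval_ltR (eval_cutE hF) (eval_loadR eval_pid (hs.input i))) ew
      (eval_lit (hF.lit (by norm_num)))
  have e3 : (Expr.wop .mod (.wop .mul mulE .pid) widthE).eval W ω s i =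
      hashMul D ω * i % 2 ^ D :=
    eval_modW (eval_mulW (eval_loadW (eval_lit (hF.lit (by norm_num))) ha) eval_pid
      (hF.mul (hashMul_lt D ω) i.2)) ew
  refine eval_addW e1 (eval_addW e3 e2 (hF.node ?_)) (hF.node ?_)
  · split_ifs <;> omega
  · rw [pow_succ]
    split_ifs <;> omega

/-- The scattered writes hit distinct cells because hashing is injective, so no conflict arises.
Cells of unoccupied leaves keep their old value, which must already be correct; for weights and
priorities it is the initial zero. -/
theorem parWrite_slots {β : Type} (hn : n ≤ 2 ^ D) {addr : ℕ → ℕ} {val M f : ℕ → β}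
    (haddr : ∀ i : Fin n, addr i = slot D (hashMul D ω) (cut ω) (x i) i)
    (hval : ∀ i : Fin n, val i = f (slot D (hashMul D ω) (cut ω) (x i) i))
    (hM : ∀ v, (∀ i : Fin n, slot D (hashMul D ω) (cut ω) (x i) i ≠ v) → M v = f v) (v : ℕ) :
    parWrite n addr val M v = f v := by
  by_cases h : ∃ i : Fin n, slot D (hashMul D ω) (cut ω) (x i) i = v
  · obtain ⟨i, rfl⟩ := h
    rw [← haddr i, parWrite_apply (fun i hi j hj e => ?_) i.2, hval, haddr]
    rw [haddr ⟨i, hi⟩, haddr ⟨j, hj⟩] at e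
    exact congrArg Fin.val (slot_inj hn (hashMul_odd D ω) e)
  · rw [not_exists] at h
    rw [parWrite_of_ne fun i hi => by rw [haddr ⟨i, hi⟩]; exact h _, hM v h]

theorem runs_fillLeaves (hF : Fits n D W) (hn : n ≤ 2 ^ D) (hs : Fresh x (2 ^ D) s)
    (ha : s.word 2 1 = hashMul D ω) :
    Runs W ω fillLeaves s (fun s => Setup x ω D s ∧ (∀ v, s.real 1 v = seedWeights x ω D v) ∧
      (∀ v, s.real 2 v = priority (seedWeights x ω D) ω v) ∧ ∀ v, s.word 3 v = 0)
      (1500 * (n + 1)) 1500 := by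
  have hw := fun i => weights_slot (τ := cut ω) hn (hashMul_odd D ω) x i
  have r2 : ∀ s, (Fresh x (2 ^ D) s ∧ Setup x ω D s) → Runs W ω
      (.parR sizeE 1 (.loadW 5 .pid) (.loadR 0 .pid)) s (fun s => Setup x ω D s ∧
        (∀ i : Fin n, s.real 0 i = x i) ∧ (∀ v, s.real 1 v = seedWeights x ω D v) ∧
        (∀ v, s.real 2 v = 0) ∧ ∀ v, s.word 3 v = 0) (500 * (n + 1)) 500 := by
    rintro s ⟨h1, h2⟩
    refine Runs.parR (eval_sizeE hF h1.size) (by decide) ⟨h2.setR _ _, h1.input, ?_,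
      h1.priorities, h1.ceils⟩
    refine parWrite_slots hn (fun i => eval_loadW eval_pid (h2.slots i))
      (fun i => (eval_loadR eval_pid (h1.input i)).trans (hw i).symm) fun v hv => ?_
    rw [h1.weights, seedWeights, weights_eq_zero hv]
  have r3 : ∀ s, (Setup x ω D s ∧ (∀ i : Fin n, s.real 0 i = x i) ∧
      (∀ v, s.real 1 v = seedWeights x ω D v) ∧ (∀ v, s.real 2 v = 0) ∧ ∀ v, s.word 3 v = 0) →
      Runs W ω (.parR sizeE 2 (.loadW 5 .pid) (.rop .div (.loadR 0 .pid) (clockE (.loadW 5 .pid))))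
        s (fun s => Setup x ω D s ∧ (∀ v, s.real 1 v = seedWeights x ω D v) ∧
      (∀ v, s.real 2 v = priority (seedWeights x ω D) ω v) ∧ ∀ v, s.word 3 v = 0)
      (500 * (n + 1)) 500 := by
    rintro s ⟨h1, h2, h3, h4, h5⟩
    refine Runs.parR (eval_sizeE hF h1.size) (by decide) ⟨h1.setR _ _, h3, ?_, h5⟩
    refine parWrite_slots hn (fun i => eval_loadW eval_pid (h1.slots i)) (fun i => ?_)
      fun v hv => ?_
    · rw [priority, seedWeights, hw]
      refine eval_divR (eval_loadR eval_pid (h2 i)) (eval_clockE hF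
        (eval_loadW eval_pid (h1.slots i)) (hF.node ?_))
      have := (Nat.div_eq_iff (Nat.two_pow_pos _)).1
        (slot_div D (hashMul D ω) (cut ω) (x i) i)
      rw [pow_succ] at this
      omega
    · rw [h4, priority, seedWeights, weights_eq_zero hv, zero_div]
  exact ((runs_slots hF hs ha).seq fun s1 q1 => (r2 s1 q1).seq r3).mono (by omega) (by omega)

theorem sum_two_pow (J : ℕ) : ∑ j ∈ Finset.range J, 2 ^ j + 1 = 2 ^ J := by
  induction J with
  | zero => rfl
  | succ J ih => rw [Finset.sum_range_succ, pow_succ]; omega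

theorem runs_upLoop (hF : Fits n D W) (hx : ∀ i, 0 ≤ x i ∧ x i ≤ 1) (hs : Up x ω D 0 s) :
    Runs W ω upLoop s (Up x ω D (D + 1)) (3000 * 2 ^ D + 3000 * (D + 1) + 500)
      (2500 * (D + 1) + 500) := by
  refine (Runs.while (I := Up x ω D) (J := D + 1) (V := fun j => 1500 * (2 ^ (D - j) + 1) + 1000)
    (κ := 500) (D := 2000) (by decide) (fun j hj s hs => ⟨?_, runs_upBody hF hx (by omega) hs⟩)
    (fun s hs => ?_) hs).mono ?_ (by omega)
  · rw [eval_ltW (eval_lit (hF.lit (by norm_num))) (eval_levelE hF hs.level)]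
    exact Nat.div_pos (Nat.pow_le_pow_right (by norm_num) (by omega)) (Nat.two_pow_pos _)
  · rw [eval_ltW (eval_lit (hF.lit (by norm_num))) (eval_levelE hF hs.level), pow_succ,
      Nat.div_eq_of_lt (by have := Nat.two_pow_pos D; omega)]
    exact lt_irrefl 0
  -- The level sizes halve from `2 ^ D` to `1`, so the total work is linear in `2 ^ D` up to a cost
  -- per level.
  · have h1 := Finset.sum_range_reflect (fun j => 2 ^ j) (D + 1)
    have h2 := sum_two_pow (D + 1)
    simp only [Nat.add_sub_cancel] at h1
    simp only [mul_add, Finset.sum_add_distrib, ← Finset.mul_sum, h1, Finset.sum_const,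
      Finset.card_range, smul_eq_mul]
    rw [pow_succ] at h2
    omega

theorem runs_downLoop (hF : Fits n D W) (hx : ∀ i, 0 ≤ x i ∧ x i ≤ 1) (hs : Down x ω D 0 s) :
    Runs W ω downLoop s (Down x ω D (D + 1)) (3000 * 2 ^ D + 2500 * (D + 1) + 500)
      (2000 * (D + 1) + 500) := by
  have hc : ∀ j ≤ D + 1, ∀ s, Down x ω D j s →
      ((Expr.ltW levelE (.wop .add widthE widthE)).eval W ω s 0 ↔ 2 ^ j < 2 ^ (D + 1)) := by
    intro j _ s hs
    have ew := eval_widthE (ω := ω) (i := 0) hF hs.setup.width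
    rw [eval_ltW (eval_levelE hF hs.level) (eval_addW ew ew (hF.node (by omega))), pow_succ,
      mul_two]
  refine (Runs.while (I := Down x ω D) (J := D + 1) (V := fun j => 1500 * 2 ^ j + 2000)
    (κ := 500) (D := 1500) (by decide) (fun j hj s hs => ⟨?_, runs_downBody hF hx (by omega) hs⟩)
    (fun s hs => ?_) hs).mono ?_ (by omega)
  · rw [hc j hj.le s hs]
    exact Nat.pow_lt_pow_right one_lt_two hj
  · rw [hc _ le_rfl s hs]
    exact lt_irrefl _
  · have h2 := sum_two_pow (D + 1)
    simp only [Finset.sum_add_distrib, ← Finset.mul_sum, Finset.sum_const, Finset.card_range,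
      smul_eq_mul]
    rw [pow_succ] at h2
    omega

theorem runs_root (hF : Fits n D W) (hx : ∀ i, 0 ≤ x i ∧ x i ≤ 1) (hs : Up x ω D (D + 1) s) :
    Runs W ω (.parW (.lit 1) 4 (.lit 1) rootCountE) s (fun s => Setup x ω D s ∧
      SumOK x ω D (D + 1) s ∧ MaxOK x ω D (D + 1) s ∧ CeilOK x ω D (D + 1) s ∧
      CountOK x ω D 0 s) 1000 500 := by
  have w0 := seedWeights_nonneg (ω := ω) (D := D) hx
  have l1 : ∀ i, (Expr.lit 1).eval W ω s i = 1 := fun i => eval_lit (hF.lit (by norm_num))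
  have hlv : 2 ^ (D + 1 - (D + 1)) = 1 := by simp
  refine Runs.parW (ν := 1) (κ := 500) (l1 0) (by decide) ⟨hs.setup.setW _ (by decide) (by decide)
    (by decide), hs.sums, hs.maxs, hs.ceils, fun v h1 h2 => ?_⟩
  obtain rfl : v = 1 := by omega
  change parWrite _ _ _ _ 1 = rootCount _ _ _
  rw [parWrite_block (A := 1) fun i hi => by rw [l1, Nat.lt_one_iff.1 hi], if_pos (by decide)]
  obtain ⟨u0, u1⟩ := nodeUnif_mem ω 0
  have := eval_roundE (f := .rop .sub (.loadR 1 (.lit 1)) (unifE (.lit 0))) (ω := ω) (i := 0) hF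
    (eval_loadW (l1 0) (hs.ceils (D + 1) le_rfl 1 (by omega) (by omega)))
    (eval_subR (eval_loadR (l1 0) (hs.sums (D + 1) le_rfl 1 (by omega) (by omega)))
      (eval_unifE hF (eval_lit (hF.lit (by norm_num))) (hF.lit (by norm_num))))
    (ceil_seedWeights_le hx _ _)
  refine this.trans ?_
  rw [rootCount, ← ceil_of_near (nodeSum_nonneg w0) (by linarith) (by linarith)]

theorem runs_sampling {k : ℕ} (hF : Fits n (Nat.clog 2 n) W) (hx : ∀ i, 0 ≤ x i ∧ x i ≤ 1) :
    Runs W ω sampling (initMem k x) (fun s => output n s = randomSet (Nat.clog 2 n) ω x)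
      (6000 * 2 ^ Nat.clog 2 n + 7000 * (Nat.clog 2 n + 1) + 2000 * n + 10000)
      (5500 * (Nat.clog 2 n + 1) + 7500) := by
  have hn : n ≤ 2 ^ Nat.clog 2 n := Nat.le_pow_clog one_lt_two n
  set D := Nat.clog 2 n with hD
  have q0 : Fresh x 0 (initMem k x) := by
    refine ⟨by simp [initMem], fun i => by simp [initMem], ?_, ?_, ?_, ?_⟩ <;> simp [initMem]
  have r0 : Runs W ω (setScalar 0 (.lit 1)) (initMem k x) (Fresh x 1) 1000 500 :=
    runs_setScalar hF (by norm_num) (eval_lit (hF.lit (by norm_num))) (by decide) fun M hM _ =>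
      ⟨q0.size, q0.input, q0.weights, q0.priorities, q0.ceils, hM⟩
  have r1 : ∀ s, Fresh x 1 s → Runs W ω widthLoop s _ _ _ := fun s h => runs_widthLoop hF h
  rw [← hD] at r1
  have r2 : ∀ s, Fresh x (2 ^ D) s → Runs W ω drawMul s _ _ _ := fun s h => runs_drawMul hF h
  have r3 : ∀ s, (Fresh x (2 ^ D) s ∧ s.word 2 1 = hashMul D ω) → Runs W ω fillLeaves s _ _ _ :=
    fun s h => runs_fillLeaves hF hn h.1 h.2
  have r4 : ∀ s, (Setup x ω D s ∧ (∀ v, s.real 1 v = seedWeights x ω D v) ∧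
      (∀ v, s.real 2 v = priority (seedWeights x ω D) ω v) ∧ ∀ v, s.word 3 v = 0) →
      Runs W ω (setScalar 2 widthE) s (Up x ω D 0) 1000 500 := by
    rintro s ⟨h1, h2, h3, h4⟩
    refine runs_setScalar hF (by norm_num) (eval_widthE hF h1.width) (by decide) fun M hM hM' =>
      ⟨h1.setScalar (hM' 0 (by decide)), hM.trans (by simp), fun h hh v _ _ => ?_,
        fun h hh v _ _ => ?_, fun h hh v _ _ => ?_⟩
    · obtain rfl : h = 0 := by omega
      exact h2 v
    · obtain rfl : h = 0 := by omega
      exact h3 v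
    · obtain rfl : h = 0 := by omega
      -- Leaf weights are at most one, so the word to be stored for a leaf is zero and the initial
      -- memory already contains it.
      have : ⌈seedWeights x ω D v⌉₊ ≤ 1 := Nat.ceil_le.2 (by
        simpa using weights_le_one hn (hashMul_odd D ω) (fun i => (hx i).2) v)
      exact (h4 v).trans (Nat.sub_eq_zero_of_le this).symm
  have r5 : ∀ s, Up x ω D 0 s → Runs W ω upLoop s _ _ _ := fun s h => runs_upLoop hF hx h
  have r6 : ∀ s, Up x ω D (D + 1) s → Runs W ω (.parW (.lit 1) 4 (.lit 1) rootCountE) s _ _ _ :=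
    fun s h => runs_root hF hx h
  have r7 : ∀ s, (Setup x ω D s ∧ SumOK x ω D (D + 1) s ∧ MaxOK x ω D (D + 1) s ∧
      CeilOK x ω D (D + 1) s ∧ CountOK x ω D 0 s) →
      Runs W ω (setScalar 2 (.lit 1)) s (Down x ω D 0) 1000 500 := by
    rintro s ⟨h1, h2, h3, h4, h5⟩
    exact runs_setScalar hF (by norm_num) (eval_lit (hF.lit (by norm_num))) (by decide)
      fun M hM hM' => ⟨h1.setScalar (hM' 0 (by decide)), hM, h2, h3, h4, h5⟩
  have r8 : ∀ s, Down x ω D 0 s → Runs W ω downLoop s _ _ _ := fun s h => runs_downLoop hF hx h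
  have r9 : ∀ s, Down x ω D (D + 1) s →
      Runs W ω (.parW sizeE 1 .pid (.loadW 4 (.loadW 5 .pid))) s
        (fun s => output n s = randomSet D ω x) (500 * (n + 1)) 500 := by
    intro s hs
    refine Runs.parW (eval_sizeE hF hs.setup.size) (by decide) ?_
    ext i
    have hsl := slot_div D (hashMul D ω) (cut ω) (x i) i
    obtain ⟨l1, l2⟩ := (Nat.div_eq_iff (Nat.two_pow_pos _)).1 hsl
    have hp := Nat.two_pow_pos (D + 1)
    have e : (Expr.loadW 4 (.loadW 5 .pid)).eval W ω s i = _ :=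
      eval_loadW (eval_loadW eval_pid (hs.setup.slots i)) (hs.counts _ (by omega) (by omega))
    rw [← leafCount_eq_nodeCount _ _ _ hsl] at e
    have hw : parWrite n (fun i => Expr.pid.eval W ω s i)
        (fun i => (Expr.loadW 4 (.loadW 5 .pid)).eval W ω s i) (s.word 1) i =
        (Expr.loadW 4 (.loadW 5 .pid)).eval W ω s i := by
      rw [parWrite_block (A := 0) fun i _ => by rw [eval_pid, zero_add],
        if_pos ⟨Nat.zero_le _, by omega⟩, Nat.sub_zero]
    simp only [output, randomSet, sampler, Finset.mem_filter, Finset.mem_univ, true_and, Mem.setW,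
      Function.update_self]
    rw [hw, e]
  exact (r0.seq fun s1 q1 => (r1 s1 q1).seq fun s2 q2 => (r2 s2 q2).seq fun s3 q3 =>
    (r3 s3 q3).seq fun s4 q4 => (r4 s4 q4).seq fun s5 q5 => (r5 s5 q5).seq fun s6 q6 =>
    (r6 s6 q6).seq fun s7 q7 => (r7 s7 q7).seq fun s8 q8 => (r8 s8 q8).seq r9).mono
    (by omega) (by omega)

end Run

/-! ### The word size and the final resource bounds -/

theorem two_pow_clog_le {n : ℕ} (hn : 1 ≤ n) : 2 ^ Nat.clog 2 n ≤ 2 * n := by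
  rcases Nat.eq_zero_or_pos (Nat.clog 2 n) with h | h
  · rw [h]; omega
  · have := (Nat.lt_clog_iff_pow_lt one_lt_two).1 (Nat.sub_lt h Nat.one_pos)
    obtain ⟨d, hd⟩ : ∃ d, Nat.clog 2 n = d + 1 := ⟨_, (Nat.succ_pred_eq_of_pos h).symm⟩
    rw [hd, Nat.add_sub_cancel] at this
    rw [hd, pow_succ]
    omega

theorem fits_wordSize {n : ℕ} (hn : 1 ≤ n) (k : ℕ) (hk : 1 ≤ k) :
    Fits n (Nat.clog 2 n) (wordSize 8 n k) := by
  refine ⟨two_pow_clog_le hn, ?_⟩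
  have h1 : n + k + 1 ≤ 2 ^ Nat.clog 2 (n + k + 1) := Nat.le_pow_clog one_lt_two _
  -- The factor `8` in the word size leaves six spare powers of `n + 2 ≥ 3` to absorb the constant
  -- `16`.
  calc 16 * (n + 2) ^ 2 ≤ 3 ^ 6 * (n + 2) ^ 2 := Nat.mul_le_mul_right _ (by norm_num)
    _ ≤ (n + 2) ^ 6 * (n + 2) ^ 2 := Nat.mul_le_mul_right _ (Nat.pow_le_pow_left (by omega) 6)
    _ = (n + 2) ^ 8 := by ring
    _ ≤ (2 ^ Nat.clog 2 (n + k + 1)) ^ 8 := Nat.pow_le_pow_left (by omega) 8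
    _ = 2 ^ wordSize 8 n k := by rw [← pow_mul, mul_comm, wordSize]

/-- The program in fact runs with work `O(n)` and depth `O(log n)`; the factor with `logStar` is at
least one and is only slack. -/
theorem implements_sampling {n k : ℕ} (hn : 1 ≤ n) (hk : 1 ≤ k) :
    Prog.sampling.Implements 8 n k (randomSet (Nat.clog 2 n)) (50000 * (n * max 1 (logStar n : ℝ)))
      (50000 * (max 1 (Real.logb 2 n) * max 1 (logStar n : ℝ))) := by
  intro ω x hx
  obtain ⟨s, work, depth, h1, h2, h3, h4⟩ :=
    runs_sampling (ω := ω) (k := k) (fits_wordSize hn k hk) hx.1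
  refine ⟨s, work, depth, h1, h4, ?_, ?_⟩
  · have hD := two_pow_clog_le hn
    have hD' : Nat.clog 2 n < 2 ^ Nat.clog 2 n := Nat.lt_two_pow_self
    have hw : (work : ℝ) ≤ 50000 * n := by
      exact_mod_cast (show work ≤ 50000 * n by omega)
    refine hw.trans (mul_le_mul_of_nonneg_left ?_ (by norm_num))
    exact le_mul_of_one_le_right (Nat.cast_nonneg n) (le_max_left _ _)
  · have hl : (Nat.clog 2 n : ℝ) ≤ Real.logb 2 n + 1 := by
      rw [← Real.natCeil_logb_natCast 2 n]
      exact (Nat.ceil_lt_add_one (Real.logb_nonneg one_lt_two (by exact_mod_cast hn))).le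
    have hd : (depth : ℝ) ≤ 5500 * (Nat.clog 2 n + 1) + 7500 := by exact_mod_cast h3
    have m1 := le_max_left 1 (Real.logb 2 n)
    have m2 := le_max_right 1 (Real.logb 2 n)
    calc (depth : ℝ) ≤ 50000 * max 1 (Real.logb 2 n) := by linarith
      _ ≤ _ := mul_le_mul_of_nonneg_left
        (le_mul_of_one_le_right (by linarith) (le_max_left _ _)) (by norm_num)

end CorrelatedSampling

theorem mainTheorem5 :
    ∃ (p : CorrelatedSampling.Program) (c : ℕ) (C : ℝ), ∀ n k : ℕ, 1 ≤ n → 1 ≤ k →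
      ∃ A : CorrelatedSampling.Seed → (Fin n → ℝ) → Finset (Fin n),
        CorrelatedSampling.IsCorrelatedSampling CorrelatedSampling.seedMeasure n k
          (C * max 1 (Real.logb 2 k)) A ∧
        p.Implements c n k A
          (C * (n * max 1 (CorrelatedSampling.logStar n : ℝ)))
          (C * (max 1 (Real.logb 2 n) * max 1 (CorrelatedSampling.logStar n : ℝ))) :=
  ⟨CorrelatedSampling.Prog.sampling, 8, 50000, fun n _ hn hk =>
    ⟨CorrelatedSampling.randomSet (Nat.clog 2 n),
      CorrelatedSampling.isCorrelatedSampling_randomSet (Nat.le_pow_clog one_lt_two n) hk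
        (by norm_num), CorrelatedSampling.implements_sampling hn hk⟩⟩
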